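/- Let $n\ge 1$, $a\ge 1$, $b>0$. A seller has two items and faces $n$ bidders whose types $t_i\in[0,b]$ are i.i.d. with a density $f$ that is differentiable on $[0,b]$ and positive on $(0,b)$; let $F$ be the distribution function. A bidder of type $t$ has value $v^1=t$ for the first item and $v^2=(b-t)/a$ for the second, so $v^1+av^2=b$. A (direct) mechanism consists of allocation probabilities $q^j_i(\mathbf t)\ge 0$ with $\sum_i q^j_i(\mathbf t)\le 1$ ($j=1,2$) and payments $pay_i(\mathbf t)$; the ex post utility is $u_i(\mathbf t)=t_iq^1_i(\mathbf t)+\frac{b-t_i}{a}q^2_i(\mathbf t)-pay_i(\mathbf t)$, and interim quantities are expectations over the truthful types of the other bidders. BIC means that truthful reporting maximizes the interim utility of every type; IIR (ex post IR) means that interim (ex post) utilities are nonnegative; revenue is the expected sum of the payments. For $t^*\in[0,b]$ let $h(t,t^*)=tf(t)+F(t)$ for $t\le t^*$ and $h(t,t^*)=tf(t)+F(t)-1$ for $t>t^*$; let $H(z,t^*)=\int_0^{F^{-1}(z)}h(t,t^*)\,dt$ for $z\in[0,1]$, let $H^{ir}(\cdot,t^*)$ be the largest convex function on $[0,1]$ below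 $H(\cdot,t^*)$, let $\varphi(t)=\varphi(t,t^*)=\frac{\partial H^{ir}}{\partial z}(F(t),t^*)$ be the ironed virtual value (one-sided derivatives at the endpoints) and $h^{ir}=\varphi f$. Put $$B(t^*)=\int_0^b\frac{1-F(t)^n}{n}\,\frac{\partial\varphi(t,t^*)}{\partial t}\,dt+\frac1a\int_0^b\frac{1-(1-F(t))^n}{n}\,\frac{\partial\varphi(t,t^*)}{\partial t}\,dt .$$ A measurable $q:[0,b]\to[0,1]$ is Border-feasible if $\int_S qf\le \frac1n\bigl(1-(1-\int_S f)^n\bigr)$ for all measurable $S\subseteq[0,b]$. Then there exist $t^*\in[0,b]$ and functions $q^1,q^2,u$ on $[0,b]$ such that: (1) $q^1,q^2$ are Border-feasible, $u$ is convex, $u\ge 0$, $u(t^*)=0$, and $u'=q^1-q^2/a$ almost everywhere, with $u(t)=u(0)+\int_0^t(q^1-q^2/a)\,ds$ for all $t\in[0,b]$. (2) For all Border-feasible $p^1,p^2$, $\int_0^b\bigl(p^1h^{ir}(t,t^*)+p^2\,\frac{bf-h^{ir}(t,t^*)}{a}\bigr)dt\le B(t^*)$, and $\int_0^b\bigl(tq^1+\frac{b-t}{a}q^2-u\bigr)f\,dt=B(t^*)$.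 (3) There is a mechanism in which every bidder has the interim allocations $q^1,q^2$ and the interim utility $u$. It is BIC, IIR and ex post IR, its revenue is $nB(t^*)$, and no BIC and IIR mechanism has larger revenue. Its payments are $$pay_i(\mathbf t)=\Bigl(1-\frac{u(t_i)}{t_iq^1(t_i)+\frac{b-t_i}{a}q^2(t_i)}\Bigr)\Bigl(t_i\,q^1_i(\mathbf t)+\tfrac{b-t_i}{a}\,q^2_i(\mathbf t)\Bigr),$$ with positive denominators. For some $\alpha\in[0,1]$ its allocation is an $\alpha$ : $(1-\alpha)$ randomization between two extreme allocation rules $A$ and $B$ of the following kind. For $\tau\in[0,b]$ rank types by $\varphi$ and, among the types with $\varphi(t)=\varphi(t^*)$, rank those with $t\ge\tau$ above those with $t<\tau$; let $P_\tau$ be the rule that gives the first item, uniformly, to the bidders of highest rank and the second one, uniformly, to the bidders of lowest rank. Call $t$ a touching point if $H^{ir}(F(t),t^*)=H(F(t),t^*)$; let $\tau_2$ be the first touching point in $[t^*,b]$ and $\tau_1$ the last one in $[0,t^*]$. Then either $A=P_{\tau_2}$ and $B=P_{\tau_1}$; or $\varphi(t^*)=0$, $B=P_{\tau_2}$ and $A$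 is $P_{\tau_2}$ with the first item withheld from the types $t<\tau_2$ with $\varphi(t)=\varphi(t^*)$. -/

import Mathlib

open Set MeasureTheory

noncomputable section

namespace TwoItemAuction

/-! ### Types, virtual values and ironing

A bidder of type `t ∈ [0,b]` values the first item at `t` and the second item at `(b - t) / a`;
`f` is the density of `t` on `[0,b]`. -/

/-- The distribution of a single type: density `f` on `[0,b]`. -/
def typeLaw (b : ℝ) (f : ℝ → ℝ) : Measure ℝ :=
  (volume.restrict (Icc 0 b)).withDensity (fun t => ENNReal.ofReal (f t))

/-- The joint distribution of the types of `n` i.i.d. bidders. -/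
def profileLaw (n : ℕ) (b : ℝ) (f : ℝ → ℝ) : Measure (Fin n → ℝ) :=
  Measure.pi (fun _ => typeLaw b f)

/-- The set `[0,b]^n` of type profiles. -/
def profiles (n : ℕ) (b : ℝ) : Set (Fin n → ℝ) := {s | ∀ i, s i ∈ Icc (0 : ℝ) b}

/-- The cumulative distribution function. -/
def cdf (f : ℝ → ℝ) (t : ℝ) : ℝ := ∫ s in (0 : ℝ)..t, f s

/-- The inverse `[0,1] → [0,b]` of the cumulative distribution function. -/
def quantile (b : ℝ) (f : ℝ → ℝ) (z : ℝ) : ℝ := Function.invFunOn (cdf f) (Icc 0 b) z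

/-- `h(t, t*)`. -/
def hFun (f : ℝ → ℝ) (tstar t : ℝ) : ℝ :=
  if t ≤ tstar then t * f t + cdf f t else t * f t + cdf f t - 1

/-- `H(z, t*) = ∫_0^{F⁻¹(z)} h(t, t*) dt`, for `z ∈ [0,1]`. -/
def HFun (b : ℝ) (f : ℝ → ℝ) (tstar z : ℝ) : ℝ :=
  ∫ t in (0 : ℝ)..quantile b f z, hFun f tstar t

/-- `H^ir(·, t*)`: the largest convex function on `[0,1]` below `H(·, t*)`. -/
def HIr (b : ℝ) (f : ℝ → ℝ) (tstar z : ℝ) : ℝ :=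
  sSup {y | ∃ g : ℝ → ℝ, ConvexOn ℝ (Icc 0 1) g ∧
    (∀ x ∈ Icc (0 : ℝ) 1, g x ≤ HFun b f tstar x) ∧ y = g z}

/-- The ironed virtual value `h^ir(t, t*) / f(t) = ∂H^ir/∂z (F(t), t*)`
(a one-sided derivative at the two endpoints of `[0,1]`). -/
def ironedValue (b : ℝ) (f : ℝ → ℝ) (tstar t : ℝ) : ℝ :=
  derivWithin (HIr b f tstar) (Icc 0 1) (cdf f t)

/-- `h^ir(t, t*)`, the density for which `H^ir(F(t), t*) = ∫_0^t h^ir(s, t*) ds`. -/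
def hIr (b : ℝ) (f : ℝ → ℝ) (tstar t : ℝ) : ℝ := ironedValue b f tstar t * f t

/-- The allocation-independent upper bound on the revenue per bidder, for a given `t*`. -/
def revenueBound (n : ℕ) (a b : ℝ) (f : ℝ → ℝ) (tstar : ℝ) : ℝ :=
  (∫ t in (0 : ℝ)..b, (1 - cdf f t ^ n) / n * deriv (ironedValue b f tstar) t) +
    1 / a * ∫ t in (0 : ℝ)..b, (1 - (1 - cdf f t) ^ n) / n * deriv (ironedValue b f tstar) t

/-! ### Interim (reduced form) rules -/

/-- Interim allocation probabilities of one item in the symmetric case, subject to Border's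
feasibility constraint. -/
structure IsBorderFeasible (n : ℕ) (b : ℝ) (f q : ℝ → ℝ) : Prop where
  measurable : Measurable ((Icc (0 : ℝ) b).domRestrict q)
  mem_Icc : ∀ t ∈ Icc (0 : ℝ) b, q t ∈ Icc (0 : ℝ) 1
  border : ∀ S : Set ℝ, MeasurableSet S → S ⊆ Icc 0 b →
    ∫ t in S, q t * f t ≤ (1 - (1 - ∫ t in S, f t) ^ n) / n

/-- The constraints of the seller's problem in reduced form. At kinks of the convex function `u` the
relation `u' = q¹ - q² / a` is understood in the integrated form. -/
structure IsReducedFeasible (n : ℕ) (a b : ℝ) (f q1 q2 u : ℝ → ℝ) : Prop where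
  border_one : IsBorderFeasible n b f q1
  border_two : IsBorderFeasible n b f q2
  nonneg : ∀ t ∈ Icc (0 : ℝ) b, 0 ≤ u t
  convex : ConvexOn ℝ (Icc 0 b) u
  hasDerivAt : ∀ᵐ t ∂volume.restrict (Icc (0 : ℝ) b), HasDerivAt u (q1 t - q2 t / a) t
  eq_integral : ∀ t ∈ Icc (0 : ℝ) b, u t = u 0 + ∫ s in (0 : ℝ)..t, (q1 s - q2 s / a)

/-- `REV / n` in terms of the interim rules. -/
def reducedRevenue (a b : ℝ) (f q1 q2 u : ℝ → ℝ) : ℝ :=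
  ∫ t in (0 : ℝ)..b, (t * q1 t + (b - t) / a * q2 t - u t) * f t

/-- The ironed virtual surplus (the objective of the relaxed problem). -/
def ironedSurplus (a b : ℝ) (f : ℝ → ℝ) (tstar : ℝ) (q1 q2 : ℝ → ℝ) : ℝ :=
  ∫ t in (0 : ℝ)..b, (q1 t * hIr b f tstar t + q2 t * ((b * f t - hIr b f tstar t) / a))

/-! ### Direct mechanisms -/

/-- A direct mechanism for two items (item `0` is the first item, item `1` the second one) and `n`
bidders; only the values on type profiles in `[0,b]^n` matter. The expected and the interim
payments are assumed to exist. -/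
structure Mechanism (n : ℕ) (b : ℝ) (f : ℝ → ℝ) where
  alloc : Fin 2 → Fin n → (Fin n → ℝ) → ℝ
  pay : Fin n → (Fin n → ℝ) → ℝ
  alloc_measurable : ∀ j i, Measurable ((profiles n b).domRestrict (alloc j i))
  alloc_nonneg : ∀ j i, ∀ s ∈ profiles n b, 0 ≤ alloc j i s
  alloc_sum_le_one : ∀ j, ∀ s ∈ profiles n b, ∑ i, alloc j i s ≤ 1
  pay_measurable : ∀ i, Measurable ((profiles n b).domRestrict (pay i))
  pay_integrable : ∀ i, Integrable (pay i) (profileLaw n b f)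
  pay_interim_integrable : ∀ i, ∀ t ∈ Icc (0 : ℝ) b,
    Integrable (fun s => pay i (Function.update s i t)) (profileLaw n b f)

namespace Mechanism

variable {n : ℕ} {b : ℝ} {f : ℝ → ℝ}

/-- Utility of bidder `i` of true type `t` when the reported profile is `s`. -/
def utility (M : Mechanism n b f) (a : ℝ) (i : Fin n) (t : ℝ) (s : Fin n → ℝ) : ℝ :=
  M.alloc 0 i s * t + M.alloc 1 i s * ((b - t) / a) - M.pay i s

/-- Expected utility of bidder `i` of true type `t` who reports `t'`, the others being truthful. -/
def interimUtility (M : Mechanism n b f) (a : ℝ) (i : Fin n) (t t' : ℝ) : ℝ :=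
  ∫ s, M.utility a i t (Function.update s i t') ∂profileLaw n b f

/-- Expected probability that bidder `i` gets item `j` when he reports `t`. -/
def interimAlloc (M : Mechanism n b f) (j : Fin 2) (i : Fin n) (t : ℝ) : ℝ :=
  ∫ s, M.alloc j i (Function.update s i t) ∂profileLaw n b f

/-- Bayesian incentive compatibility. -/
def IsBIC (M : Mechanism n b f) (a : ℝ) : Prop :=
  ∀ i, ∀ t ∈ Icc (0 : ℝ) b, ∀ t' ∈ Icc (0 : ℝ) b,
    M.interimUtility a i t t' ≤ M.interimUtility a i t t

/-- Interim individual rationality. -/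
def IsInterimIR (M : Mechanism n b f) (a : ℝ) : Prop :=
  ∀ i, ∀ t ∈ Icc (0 : ℝ) b, 0 ≤ M.interimUtility a i t t

/-- Ex post individual rationality. -/
def IsExPostIR (M : Mechanism n b f) (a : ℝ) : Prop :=
  ∀ i, ∀ s ∈ profiles n b, 0 ≤ M.utility a i (s i) s

/-- Expected revenue. -/
def revenue (M : Mechanism n b f) : ℝ := ∫ s, ∑ i, M.pay i s ∂profileLaw n b f

end Mechanism

/-! ### The extreme allocation rules -/

/-- The convex hull touches `H(·, t*)` at type `t`. -/
def Touches (b : ℝ) (f : ℝ → ℝ) (tstar t : ℝ) : Prop :=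
  HIr b f tstar (cdf f t) = HFun b f tstar (cdf f t)

/-- `F⁻¹(l₂^min(t*, t*))`: the first touching point to the right of `t*`. -/
def rightSplit (b : ℝ) (f : ℝ → ℝ) (tstar : ℝ) : ℝ :=
  sInf {t | t ∈ Icc tstar b ∧ Touches b f tstar t}

/-- `F⁻¹(l₁^max(t*, t*))`: the last touching point to the left of `t*`. -/
def leftSplit (b : ℝ) (f : ℝ → ℝ) (tstar : ℝ) : ℝ :=
  sSup {t | t ∈ Icc 0 tstar ∧ Touches b f tstar t}

/-- The priority order: types are ranked by ironed virtual value, and those with the ironed virtual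
value of `t*` are moreover separated into the ones below and the ones above the split point. -/
def RanksBelow (b : ℝ) (f : ℝ → ℝ) (tstar split s t : ℝ) : Prop :=
  ironedValue b f tstar s < ironedValue b f tstar t ∨
    (ironedValue b f tstar s = ironedValue b f tstar tstar ∧
      ironedValue b f tstar t = ironedValue b f tstar tstar ∧ s < split ∧ split ≤ t)

open Classical in
/-- The bidders of highest rank. -/
def topBidders {n : ℕ} (b : ℝ) (f : ℝ → ℝ) (tstar split : ℝ) (s : Fin n → ℝ) : Finset (Fin n) :=
  Finset.univ.filter (fun i => ∀ k, ¬ RanksBelow b f tstar split (s i) (s k))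

open Classical in
/-- The bidders of lowest rank. -/
def bottomBidders {n : ℕ} (b : ℝ) (f : ℝ → ℝ) (tstar split : ℝ) (s : Fin n → ℝ) :
    Finset (Fin n) :=
  Finset.univ.filter (fun i => ∀ k, ¬ RanksBelow b f tstar split (s k) (s i))

open Classical in
/-- The first item goes, uniformly, to the bidders of highest rank, the second one to the bidders of
lowest rank. -/
def priorityAlloc {n : ℕ} (b : ℝ) (f : ℝ → ℝ) (tstar split : ℝ)
    (j : Fin 2) (i : Fin n) (s : Fin n → ℝ) : ℝ :=
  if j = 0 then
    if i ∈ topBidders b f tstar split s then 1 / ((topBidders b f tstar split s).card : ℝ) else 0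
  else
    if i ∈ bottomBidders b f tstar split s then 1 / ((bottomBidders b f tstar split s).card : ℝ)
    else 0

open Classical in
/-- The same rule, except that the first item is withheld from the types that have the ironed virtual
value of `t*` and lie below the split point. -/
def reserveAlloc {n : ℕ} (b : ℝ) (f : ℝ → ℝ) (tstar split : ℝ)
    (j : Fin 2) (i : Fin n) (s : Fin n → ℝ) : ℝ :=
  if j = 0 ∧ ironedValue b f tstar (s i) = ironedValue b f tstar tstar ∧ s i < split then 0
  else priorityAlloc b f tstar split j i s

/-- The pair `(A, B)` of extreme allocation rules at `t*`: either the two priority rules with the split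
at the first touching point right of `t*` and at the last one left of `t*`; or, which is only
admitted if the ironed virtual value of `t*` is zero, the first of these rules with and without
withholding of the first item. -/
def IsExtremePair {n : ℕ} (b : ℝ) (f : ℝ → ℝ) (tstar : ℝ)
    (A B : Fin 2 → Fin n → (Fin n → ℝ) → ℝ) : Prop :=
  (A = priorityAlloc b f tstar (rightSplit b f tstar) ∧
      B = priorityAlloc b f tstar (leftSplit b f tstar)) ∨
    (ironedValue b f tstar tstar = 0 ∧
      A = reserveAlloc b f tstar (rightSplit b f tstar) ∧
      B = priorityAlloc b f tstar (rightSplit b f tstar))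

end TwoItemAuction

end

/-! Write `D = q¹ - q²/a`. Under BIC, `D` selects subgradients of the interim utility `u`, so `D` is
monotone and `u` convex. Integration by parts on `[0,t*]` and on `[t*,b]` turns the revenue from one
bidder into `∫ D (h - h^ir) + S - u(t*)`, where `S` is the ironed surplus
(`IsPivot.reducedRevenue_eq`). The first term is nonpositive because `D` increases and `H^ir ≤ H`;
Border's condition on the superlevel sets of `φ` and of `b - φ` gives `S ≤ B(t*)`
(`IsPivot.ironedSurplus_le`); individual rationality gives `u(t*) ≥ 0`. All three are equalities if
`D` is constant near every type at which the hull does not touch, the items are allotted in the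
order of `φ`, and `u(t*) = 0`. Priority rules split at a touching point meet the first two demands.
For the third, `u` is taken to be the primitive of `D` that vanishes at `t*`, and it is nonnegative
once `D(t*) = 0`. So it remains to find a `t*` and an optimal rule with `D(t*) = 0`.

The search is parametrized by the ironed value `s = φ(t*)` instead of `t*`. In terms of `t`, the
function `H` is the minimum of `t F(t)` and `t* - t (1 - F(t))`, so `t*` merely shifts the second
branch. Given `s`, choose `t*` such that one line of slope `s` supports both branches (`IsPivot`).
It meets the first branch at the maximizers of `(s - t) F(t)`, with extremes `x₁ ≤ x₂`, and the
second at the maximizers of `(t - s)(1 - F(t))`, with extremes `y₁ ≤ y₂`, and `x₂ < t* < y₁`. Hence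
`φ = s` exactly on `[x₁, y₂]`, and the two split points are `x₂` and `y₁`. With the split at `y₁`
the pivotal type ties with `[x₁, y₁)`, with the split at `x₂` it ties with `[x₂, y₂]`. In both cases
`D(t*)` is a positive multiple of the increment of `P(z) = z^n + (1 - z)^n / a` over the image of
the tie class under `F` (`IsPivot.slope_mul`).

The values `s` that have a pair of contacts with nonpositive increment of `P`, and those that have
one with nonnegative increment, form two closed sets covering `[0,b]`. The second contains `b`,
because `a ≥ 1` makes `P(1)` the maximum of `P`. If the first contains `0`, connectedness yields an
`s` in both; convexity of `P` moves the signs to the pairs `(x₁, y₁)` and `(x₂, y₂)`, and a mixture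
of the two priority rules has `D(t*) = 0`. Otherwise `s = 0` serves: types of ironed value zero add
nothing to the surplus from the first item, which may therefore be withheld from them, and this
makes `D(t*)` nonpositive; again a mixture balances.

For the implementation each bidder pays a fixed, type-dependent fraction of his realized value,
which makes ex post rationality immediate. Since `B(t*)` is written with `φ'`, an integration by
parts against `φ` is needed; it rests on a right derivative of `φ` at every interior type, and there
the differentiability of `f` is used. -/

noncomputable section

namespace TwoItemAuction

/-! ### Comparison of weighted integrals through superlevel sets -/

/-- If `e` has nonpositive integral over all superlevel sets of the bounded nonnegative function
`g`, then the integral of `g * e` is nonpositive. -/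
lemma integral_mul_nonpos_of_superlevel {α : Type*} [MeasurableSpace α] {μ : Measure α} [SFinite μ]
    {e g : α → ℝ} {C : ℝ} (he : Integrable e μ) (hg : Measurable g) (h0 : ∀ x, 0 ≤ g x)
    (hC : ∀ x, g x ≤ C) (h : ∀ c, 0 ≤ c → ∫ x in {x | c < g x}, e x ∂μ ≤ 0) :
    ∫ x, g x * e x ∂μ ≤ 0 := by
  have hms : MeasurableSet {p : α × ℝ | p.2 < g p.1} :=
    measurableSet_lt measurable_snd (hg.comp measurable_fst)
  have hint : Integrable (fun p : α × ℝ => {p : α × ℝ | p.2 < g p.1}.indicator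
      (fun p => e p.1) p) (μ.prod (volume.restrict (Ioc 0 C))) :=
    (he.comp_fst (volume.restrict (Ioc 0 C))).indicator hms
  -- Layer cake: `g x` is the length of the set of levels `c` in `(0, C]` with `c < g x`.
  have key : ∀ x, g x * e x =
      ∫ c in Ioc 0 C, {p : α × ℝ | p.2 < g p.1}.indicator (fun p => e p.1) (x, c) := by
    intro x
    have : (fun c => {p : α × ℝ | p.2 < g p.1}.indicator (fun p => e p.1) (x, c)) =
        (Iio (g x)).indicator (fun _ => e x) := by
      ext c; simp only [indicator, mem_ofPred_eq, mem_Iio]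
    rw [this, setIntegral_indicator measurableSet_Iio]
    have h2 : (volume.restrict (Ioc 0 C ∩ Iio (g x))) = volume.restrict (Ioo 0 (g x)) := by
      congr 1
      ext c
      simp only [mem_inter_iff, mem_Ioc, mem_Iio, mem_Ioo]
      exact ⟨fun h => ⟨h.1.1, h.2⟩, fun h => ⟨⟨h.1, h.2.le.trans (hC x)⟩, h.2⟩⟩
    rw [h2, setIntegral_const]
    simp [h0 x]
  simp_rw [key]
  rw [integral_integral_swap hint]
  refine setIntegral_nonpos measurableSet_Ioc fun c hc => ?_
  have : (fun x => {p : α × ℝ | p.2 < g p.1}.indicator (fun p => e p.1) (x, c)) =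
        {x | c < g x}.indicator e := by
    ext x; simp only [indicator, mem_ofPred_eq]
  rw [this, integral_indicator (measurableSet_lt measurable_const hg)]
  exact h c hc.1.le

/-- The projection of the real line onto `[0,b]`. -/
def clamp (b t : ℝ) : ℝ := max 0 (min b t)

lemma clamp_of_mem {b t : ℝ} (h : t ∈ Icc (0 : ℝ) b) : clamp b t = t := by
  simp [clamp, h.1, h.2]

lemma clamp_mem {b : ℝ} (hb : 0 ≤ b) (t : ℝ) : clamp b t ∈ Icc (0 : ℝ) b := by
  simp [clamp, hb]

lemma clamp_mono (b : ℝ) : Monotone (clamp b) := by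
  intro x y h; unfold clamp; gcongr

lemma continuous_clamp (b : ℝ) : Continuous (clamp b) := by unfold clamp; fun_prop

lemma monotone_comp_clamp {b : ℝ} (hb : 0 ≤ b) {g : ℝ → ℝ} (hg : MonotoneOn g (Icc 0 b)) :
    Monotone (g ∘ clamp b) := fun _ _ h => hg (clamp_mem hb _) (clamp_mem hb _) (clamp_mono b h)

lemma antitone_comp_clamp {b : ℝ} (hb : 0 ≤ b) {g : ℝ → ℝ} (hg : AntitoneOn g (Icc 0 b)) :
    Antitone (g ∘ clamp b) := fun _ _ h => hg (clamp_mem hb _) (clamp_mem hb _) (clamp_mono b h)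

lemma measurable_comp_clamp {b : ℝ} (hb : 0 ≤ b) {g : ℝ → ℝ}
    (hg : MonotoneOn g (Icc 0 b) ∨ AntitoneOn g (Icc 0 b)) : Measurable (g ∘ clamp b) :=
  hg.elim (fun h => (monotone_comp_clamp hb h).measurable)
    fun h => (antitone_comp_clamp hb h).measurable

lemma measurableSet_superlevel {b : ℝ} (hb : 0 ≤ b) {g : ℝ → ℝ}
    (hg : MonotoneOn g (Icc 0 b) ∨ AntitoneOn g (Icc 0 b)) (c : ℝ) :
    MeasurableSet {t | t ∈ Icc 0 b ∧ c < g t} := by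
  have : {t | t ∈ Icc 0 b ∧ c < g t} = Icc 0 b ∩ {t | c < (g ∘ clamp b) t} := by
    ext t
    simp only [mem_ofPred_eq, mem_inter_iff, Function.comp]
    exact and_congr_right fun h => by rw [clamp_of_mem h]
  rw [this]
  exact measurableSet_Icc.inter (measurableSet_lt measurable_const (measurable_comp_clamp hb hg))

lemma bounds_of_monotone_or_antitone {b : ℝ} (hb : 0 ≤ b) {g : ℝ → ℝ}
    (hg : MonotoneOn g (Icc 0 b) ∨ AntitoneOn g (Icc 0 b)) :
    ∃ C, ∀ t ∈ Icc 0 b, |g t| ≤ C := by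
  have h0 : (0 : ℝ) ∈ Icc 0 b := left_mem_Icc.2 hb
  have h1 : b ∈ Icc 0 b := right_mem_Icc.2 hb
  refine ⟨max |g 0| |g b|, fun t ht => ?_⟩
  rcases hg with h | h
  · exact abs_le_max_abs_abs (h h0 ht ht.1) (h ht h1 ht.2)
  · rw [max_comm]
    exact abs_le_max_abs_abs (h ht h1 ht.2) (h h0 ht ht.1)

lemma integrableOn_mul_of_monotone_or_antitone {b : ℝ} (hb : 0 ≤ b) {g e : ℝ → ℝ}
    (hg : MonotoneOn g (Icc 0 b) ∨ AntitoneOn g (Icc 0 b)) (he : IntegrableOn e (Icc 0 b)) :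
    IntegrableOn (fun t => g t * e t) (Icc 0 b) := by
  obtain ⟨C, hC⟩ := bounds_of_monotone_or_antitone hb hg
  refine (Integrable.bdd_mul (f := g ∘ clamp b) (c := C) he
    (measurable_comp_clamp hb hg).aestronglyMeasurable ?_).congr ?_
  · exact ae_of_all _ fun t => hC _ (clamp_mem hb t)
  · filter_upwards [ae_restrict_mem measurableSet_Icc] with t ht
    simp [clamp_of_mem ht]

/-- Meant for `g = φ` or `g = b - φ` and `e` the difference of two weighted allocation rules:
Border's condition controls exactly the integrals over superlevel sets. -/
lemma setIntegral_mul_nonpos_of_superlevel {b : ℝ} (hb : 0 ≤ b) {g e : ℝ → ℝ}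
    (hg : MonotoneOn g (Icc 0 b) ∨ AntitoneOn g (Icc 0 b)) (he : IntegrableOn e (Icc 0 b))
    (h0 : ∀ t ∈ Icc 0 b, 0 ≤ g t)
    (h : ∀ c, 0 ≤ c → ∫ t in {t | t ∈ Icc 0 b ∧ c < g t}, e t ≤ 0) :
    ∫ t in Icc 0 b, g t * e t ≤ 0 := by
  obtain ⟨C, hC⟩ := bounds_of_monotone_or_antitone hb hg
  have h1 : ∫ t in Icc 0 b, g t * e t = ∫ t in Icc 0 b, (g ∘ clamp b) t * e t :=
    setIntegral_congr_fun measurableSet_Icc fun t ht => by simp [clamp_of_mem ht]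
  rw [h1]
  refine integral_mul_nonpos_of_superlevel (C := C) he (measurable_comp_clamp hb hg)
    (fun t => h0 _ (clamp_mem hb t)) (fun t => (abs_le.1 (hC _ (clamp_mem hb t))).2) fun c hc => ?_
  rw [Measure.restrict_restrict (measurableSet_lt measurable_const (measurable_comp_clamp hb hg))]
  have : {t | t ∈ Icc 0 b ∧ c < g t} = {t | c < (g ∘ clamp b) t} ∩ Icc 0 b := by
    ext t
    simp only [mem_ofPred_eq, mem_inter_iff, Function.comp]
    rw [and_comm]
    exact and_congr_left fun h => by rw [clamp_of_mem h]
  rw [← this]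
  exact h c hc

/-- The version without a sign condition on `g`, for `e` of integral zero. -/
lemma setIntegral_mul_nonpos_of_superlevel' {b : ℝ} (hb : 0 ≤ b) {g e : ℝ → ℝ}
    (hg : MonotoneOn g (Icc 0 b) ∨ AntitoneOn g (Icc 0 b)) (he : IntegrableOn e (Icc 0 b))
    (he0 : ∫ t in Icc 0 b, e t = 0)
    (h : ∀ c, ∫ t in {t | t ∈ Icc 0 b ∧ c < g t}, e t ≤ 0) :
    ∫ t in Icc 0 b, g t * e t ≤ 0 := by
  obtain ⟨C, hC⟩ := bounds_of_monotone_or_antitone hb hg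
  -- Shifting `g` by a bound makes it nonnegative and leaves the integral unchanged, since `e` has
  -- total integral zero.
  have h1 : ∫ t in Icc 0 b, (g t + C) * e t ≤ 0 := by
    refine setIntegral_mul_nonpos_of_superlevel hb ?_ he ?_ fun c _ => ?_
    · exact hg.imp (fun h => h.add_const C) fun h => h.add_const C
    · intro t ht
      linarith [(abs_le.1 (hC t ht)).1]
    · simpa only [sub_lt_iff_lt_add] using h (c - C)
  have h2 : ∫ t in Icc 0 b, (g t + C) * e t = ∫ t in Icc 0 b, g t * e t := by
    simp_rw [add_mul]
    rw [integral_add (integrableOn_mul_of_monotone_or_antitone hb hg he) (he.const_mul C),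
      integral_const_mul, he0]
    simp
  exact h2 ▸ h1

lemma setIntegral_mul_eq_zero_of_superlevel {b : ℝ} (hb : 0 ≤ b) {g e : ℝ → ℝ}
    (hg : MonotoneOn g (Icc 0 b) ∨ AntitoneOn g (Icc 0 b)) (he : IntegrableOn e (Icc 0 b))
    (h : ∀ c, ∫ t in {t | t ∈ Icc 0 b ∧ c < g t}, e t = 0) :
    ∫ t in Icc 0 b, g t * e t = 0 := by
  obtain ⟨C, hC⟩ := bounds_of_monotone_or_antitone hb hg
  -- A level below the minimum of `g` has all of `[0,b]` as its superlevel set.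
  have he0 : ∫ t in Icc 0 b, e t = 0 := by
    have := h (-C - 1)
    rwa [show {t | t ∈ Icc 0 b ∧ -C - 1 < g t} = Icc 0 b from ?_] at this
    ext t
    refine ⟨fun h => h.1, fun h => ⟨h, ?_⟩⟩
    linarith [(abs_le.1 (hC t h)).1]
  refine le_antisymm (setIntegral_mul_nonpos_of_superlevel' hb hg he he0 fun c => (h c).le) ?_
  have h1 := setIntegral_mul_nonpos_of_superlevel' (e := fun t => - e t) hb hg he.neg
    (by rw [integral_neg, he0, neg_zero]) (fun c => by rw [integral_neg, h c, neg_zero])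
  simp only [mul_neg, integral_neg] at h1
  linarith

/-! ### Functions with a selection of subgradients -/

/-- `D` selects subgradients of `u` on `[0,b]`. -/
def IsSubgradient (b : ℝ) (D u : ℝ → ℝ) : Prop :=
  ∀ x ∈ Icc (0 : ℝ) b, ∀ y ∈ Icc (0 : ℝ) b, D x * (y - x) ≤ u y - u x

namespace IsSubgradient

variable {b : ℝ} {D u : ℝ → ℝ}

lemma monotoneOn (h : IsSubgradient b D u) : MonotoneOn D (Icc 0 b) := by
  intro x hx y hy hxy
  rcases hxy.eq_or_lt with rfl | hlt
  · exact le_rfl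
  have h1 := h x hx y hy
  have h2 := h y hy x hx
  by_contra! hc
  nlinarith

lemma convexOn (h : IsSubgradient b D u) : ConvexOn ℝ (Icc 0 b) u := by
  refine ⟨convex_Icc 0 b, fun x hx y hy p q hp hq hpq => ?_⟩
  have hz := convex_Icc 0 b hx hy hp hq hpq
  have h1 := mul_le_mul_of_nonneg_left (h _ hz x hx) hp
  have h2 := mul_le_mul_of_nonneg_left (h _ hz y hy) hq
  simp only [smul_eq_mul] at *
  have hq' : q = 1 - p := by linarith
  subst hq'
  nlinarith

lemma continuousOn (hb : 0 ≤ b) (h : IsSubgradient b D u) : ContinuousOn u (Icc 0 b) := by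
  obtain ⟨C, hC⟩ := bounds_of_monotone_or_antitone hb (Or.inl h.monotoneOn)
  have hC0 : 0 ≤ C := (abs_nonneg _).trans (hC 0 (left_mem_Icc.2 hb))
  have : LipschitzOnWith ⟨C, hC0⟩ u (Icc 0 b) := by
    refine LipschitzOnWith.of_dist_le_mul fun x hx y hy => ?_
    rw [Real.dist_eq, Real.dist_eq]
    have h1 := h x hx y hy
    have h2 := h y hy x hx
    have h3 : |D x * (x - y)| ≤ C * |x - y| := by
      rw [abs_mul]; exact mul_le_mul_of_nonneg_right (hC x hx) (abs_nonneg _)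
    have h4 : |D y * (x - y)| ≤ C * |x - y| := by
      rw [abs_mul]; exact mul_le_mul_of_nonneg_right (hC y hy) (abs_nonneg _)
    change _ ≤ C * |x - y|
    rw [abs_le] at *
    constructor <;> nlinarith
  exact this.continuousOn

/-- The subgradient inequalities at `t` and at `y` squeeze `u y - u t - D t (y - t)` between `0` and
`(D y - D t)(y - t)`. -/
lemma hasDerivAt (h : IsSubgradient b D u) {t : ℝ} (ht : t ∈ Ioo 0 b)
    (hc : ContinuousAt D t) : HasDerivAt u (D t) t := by
  rw [hasDerivAt_iff_isLittleO]
  have h1 : (fun y => (D y - D t) * (y - t)) =o[nhds t] fun y => y - t := by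
    have : (fun y => (D y - D t)) =o[nhds t] fun _ => (1 : ℝ) := by
      rw [Asymptotics.isLittleO_one_iff]
      simpa using hc.tendsto.sub_const (D t)
    simpa using this.mul_isBigO (Asymptotics.isBigO_refl (fun y => y - t) _)
  refine (Asymptotics.IsBigO.of_bound 1 ?_).trans_isLittleO h1
  filter_upwards [Icc_mem_nhds ht.1 ht.2] with y hy
  have h2 := h t (Ioo_subset_Icc_self ht) y hy
  have h3 := h y hy t (Ioo_subset_Icc_self ht)
  rw [one_mul, Real.norm_eq_abs, Real.norm_eq_abs, smul_eq_mul,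
    abs_of_nonneg (by linarith), abs_of_nonneg (by linarith)]
  linarith

/-- A monotone function has countably many discontinuities. Countability, rather than measure zero,
is what the fundamental theorem used in `integral_mul` asks of the exceptional set. -/
lemma exists_countable (h : IsSubgradient b D u) :
    ∃ s : Set ℝ, s.Countable ∧ ∀ t ∈ Ioo 0 b \ s, HasDerivAt u (D t) t := by
  refine ⟨_, h.monotoneOn.countable_not_continuousWithinAt, fun t ht => ?_⟩
  refine h.hasDerivAt ht.1 ?_
  by_contra hc
  refine ht.2 ⟨Ioo_subset_Icc_self ht.1, fun hw => hc ?_⟩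
  exact hw.continuousAt (Icc_mem_nhds ht.1.1 ht.1.2)

lemma ae_hasDerivAt (h : IsSubgradient b D u) :
    ∀ᵐ t ∂volume.restrict (Icc (0 : ℝ) b), HasDerivAt u (D t) t := by
  obtain ⟨s, hs, hd⟩ := h.exists_countable
  rw [← Measure.restrict_congr_set (Ioo_ae_eq_Icc (μ := volume))]
  rw [ae_restrict_iff' measurableSet_Ioo]
  filter_upwards [hs.ae_notMem volume] with t ht ht2
  exact hd t ⟨ht2, ht⟩

lemma intervalIntegrable (h : IsSubgradient b D u) {x y : ℝ} (hx : x ∈ Icc 0 b)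
    (hy : y ∈ Icc 0 b) : IntervalIntegrable D volume x y :=
  (h.monotoneOn.mono (ordConnected_Icc.uIcc_subset hx hy)).intervalIntegrable

/-- Integration by parts against a function with everywhere defined derivative. -/
lemma integral_mul (hb : 0 ≤ b) (h : IsSubgradient b D u) {w w' : ℝ → ℝ} {x y : ℝ}
    (hx : x ∈ Icc 0 b) (hy : y ∈ Icc 0 b) (hw : ContinuousOn w (Icc 0 b))
    (hw' : ContinuousOn w' (Icc 0 b)) (hd : ∀ t ∈ Ioo 0 b, HasDerivAt w (w' t) t) :
    ∫ t in x..y, (D t * w t + u t * w' t) = u y * w y - u x * w x := by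
  obtain ⟨s, hs, hds⟩ := h.exists_countable
  have hsub := ordConnected_Icc.uIcc_subset hx hy
  have hio : Ioo (min x y) (max x y) ⊆ Ioo 0 b :=
    Ioo_subset_Ioo (le_min hx.1 hy.1) (max_le hx.2 hy.2)
  refine integral_eq_of_hasDerivAt_off_countable (fun t => u t * w t) _ hs
    (((h.continuousOn hb).mul hw).mono hsub)
    (fun t ht => (hds t ⟨hio ht.1, ht.2⟩).mul (hd t (hio ht.1))) ?_
  exact ((h.intervalIntegrable hx hy).mul_continuousOn (hw.mono hsub)).add
    ((((h.continuousOn hb).mul hw').mono hsub).intervalIntegrable)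

lemma integral_eq (hb : 0 ≤ b) (h : IsSubgradient b D u) {x y : ℝ}
    (hx : x ∈ Icc 0 b) (hy : y ∈ Icc 0 b) : ∫ t in x..y, D t = u y - u x := by
  have := h.integral_mul hb (w := fun _ => 1) (w' := fun _ => 0) hx hy continuousOn_const
    continuousOn_const (fun t _ => hasDerivAt_const t 1)
  simpa using this

end IsSubgradient

/-- The primitive of a monotone function has this function as a selection of subgradients. -/
lemma isSubgradient_integral {b : ℝ} {D : ℝ → ℝ} (hD : MonotoneOn D (Icc 0 b)) {c : ℝ}
    (hc : c ∈ Icc 0 b) : IsSubgradient b D (fun t => ∫ s in c..t, D s) := by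
  have hi : ∀ x ∈ Icc 0 b, ∀ y ∈ Icc 0 b, IntervalIntegrable D volume x y := fun x hx y hy =>
    (hD.mono (ordConnected_Icc.uIcc_subset hx hy)).intervalIntegrable
  intro x hx y hy
  rw [intervalIntegral.integral_interval_sub_left (hi c hc y hy) (hi c hc x hx)]
  rcases le_total x y with hxy | hxy
  · have := intervalIntegral.integral_mono_on hxy intervalIntegrable_const (hi x hx y hy)
      (f := fun _ => D x) fun t ht => hD hx ⟨hx.1.trans ht.1, ht.2.trans hy.2⟩ ht.1
    simp only [intervalIntegral.integral_const, smul_eq_mul] at this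
    linarith
  · have := intervalIntegral.integral_mono_on hxy (hi y hy x hx) intervalIntegrable_const
      (g := fun _ => D x) fun t ht => hD ⟨hy.1.trans ht.1, ht.2.trans hx.2⟩ hx ht.2
    simp only [intervalIntegral.integral_const, smul_eq_mul] at this
    rw [intervalIntegral.integral_symm]
    linarith

end TwoItemAuction

end

noncomputable section

namespace TwoItemAuction

/-! ### Interim expectations -/

section Interim

variable {n : ℕ} {Ω : Type*} [MeasurableSpace Ω]

lemma measurable_update_pair (i : Fin n) :
    Measurable (fun p : Ω × (Fin n → Ω) => Function.update p.2 i p.1) := by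
  refine measurable_pi_lambda _ fun k => ?_
  by_cases h : k = i
  · subst h; simpa using measurable_fst
  · simp only [Function.update_of_ne h]
    exact (measurable_pi_apply k).comp measurable_snd

variable (μ : Measure Ω) [IsProbabilityMeasure μ]

/-- Redrawing one coordinate independently from the same law does not change the joint law. Through
Fubini this links interim and ex ante expectations. -/
lemma measurePreserving_update (i : Fin n) :
    MeasurePreserving (fun p : Ω × (Fin n → Ω) => Function.update p.2 i p.1)
      (μ.prod (Measure.pi fun _ => μ)) (Measure.pi fun _ => μ) := by
  refine ⟨measurable_update_pair i, ?_⟩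
  refine (Measure.pi_eq (μ := fun _ : Fin n => μ) fun s hs => ?_).symm
  rw [Measure.map_apply (measurable_update_pair i) (MeasurableSet.univ_pi hs)]
  have : (fun p : Ω × (Fin n → Ω) => Function.update p.2 i p.1) ⁻¹' (univ.pi s) =
      s i ×ˢ univ.pi (Function.update s i univ) := by
    ext p
    simp only [mem_preimage, mem_univ_pi, mem_prod]
    constructor
    · intro h
      refine ⟨by simpa using h i, fun k => ?_⟩
      by_cases hk : k = i
      · subst hk; simp
      · simpa [hk] using h k
    · rintro ⟨h1, h2⟩ k
      by_cases hk : k = i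
      · subst hk; simpa using h1
      · simpa [hk] using h2 k
  rw [this, Measure.prod_prod, Measure.pi_pi]
  rw [← Finset.mul_prod_erase _ _ (Finset.mem_univ i),
    ← Finset.mul_prod_erase _ (fun k => μ (s k)) (Finset.mem_univ i)]
  simp only [Function.update_self, measure_univ, one_mul]
  congr 1
  refine Finset.prod_congr rfl fun k hk => ?_
  rw [Function.update_of_ne (Finset.ne_of_mem_erase hk)]

lemma measurePreserving_comp_equiv (σ : Equiv.Perm (Fin n)) :
    MeasurePreserving (fun s : Fin n → Ω => s ∘ σ) (Measure.pi fun _ => μ)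
      (Measure.pi fun _ => μ) := by
  have hm : Measurable (fun s : Fin n → Ω => s ∘ σ) :=
    measurable_pi_lambda _ fun k => measurable_pi_apply _
  refine ⟨hm, ?_⟩
  refine (Measure.pi_eq (μ := fun _ : Fin n => μ) fun s hs => ?_).symm
  rw [Measure.map_apply hm (MeasurableSet.univ_pi hs)]
  have : (fun s : Fin n → Ω => s ∘ σ) ⁻¹' (univ.pi s) = univ.pi (s ∘ σ.symm) := by
    ext x
    simp only [mem_preimage, mem_univ_pi, Function.comp]
    exact ⟨fun h k => by simpa using h (σ.symm k), fun h k => by simpa using h (σ k)⟩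
  rw [this, Measure.pi_pi]
  exact Equiv.prod_comp σ.symm (fun k => μ (s k))

variable {μ}

/-- The interim expectation of `g` for bidder `i` of type `t`. -/
def interim (μ : Measure Ω) (i : Fin n) (g : (Fin n → Ω) → ℝ) (t : Ω) : ℝ :=
  ∫ s, g (Function.update s i t) ∂(Measure.pi fun _ => μ)

lemma integrable_update {g : (Fin n → Ω) → ℝ} (hg : Integrable g (Measure.pi fun _ => μ))
    (i : Fin n) : Integrable (fun p : Ω × (Fin n → Ω) => g (Function.update p.2 i p.1))
      (μ.prod (Measure.pi fun _ => μ)) :=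
  (measurePreserving_update μ i).integrable_comp_of_integrable hg

lemma integrable_interim {g : (Fin n → Ω) → ℝ} (hg : Integrable g (Measure.pi fun _ => μ))
    (i : Fin n) : Integrable (interim μ i g) μ :=
  (integrable_update hg i).integral_prod_left

lemma integral_interim {g : (Fin n → Ω) → ℝ} (hg : Integrable g (Measure.pi fun _ => μ))
    (i : Fin n) : ∫ t, interim μ i g t ∂μ = ∫ s, g s ∂(Measure.pi fun _ => μ) := by
  rw [← (measurePreserving_update μ i).map_eq, integral_map]
  · rw [integral_prod _ (integrable_update hg i)]
    rfl
  · exact (measurable_update_pair i).aemeasurable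
  · rw [(measurePreserving_update μ i).map_eq]
    exact hg.aestronglyMeasurable

lemma setIntegral_interim {g : (Fin n → Ω) → ℝ} (hg : Integrable g (Measure.pi fun _ => μ))
    (i : Fin n) {S : Set Ω} (hS : MeasurableSet S) :
    ∫ t in S, interim μ i g t ∂μ =
      ∫ s, {s : Fin n → Ω | s i ∈ S}.indicator g s ∂(Measure.pi fun _ => μ) := by
  have hS' : MeasurableSet {s : Fin n → Ω | s i ∈ S} := measurable_pi_apply i hS
  rw [← integral_interim (hg.indicator hS') i, ← integral_indicator hS]
  congr 1
  ext t
  by_cases ht : t ∈ S <;> simp [interim, indicator, ht]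

/-- A feasible allocation of one item. -/
structure IsAlloc (x : Fin n → (Fin n → Ω) → ℝ) : Prop where
  measurable : ∀ i, Measurable (x i)
  nonneg : ∀ i s, 0 ≤ x i s
  sum_le : ∀ s, ∑ i, x i s ≤ 1

namespace IsAlloc

variable {x : Fin n → (Fin n → Ω) → ℝ}

lemma le_one (hx : IsAlloc x) (i : Fin n) (s : Fin n → Ω) : x i s ≤ 1 :=
  (Finset.single_le_sum (fun k _ => hx.nonneg k s) (Finset.mem_univ i)).trans (hx.sum_le s)

lemma integrable (hx : IsAlloc x) (i : Fin n) : Integrable (x i) (Measure.pi fun _ => μ) :=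
  Integrable.of_bound (hx.measurable i).aestronglyMeasurable 1
    (ae_of_all _ fun s => by
      rw [Real.norm_eq_abs, abs_of_nonneg (hx.nonneg i s)]; exact hx.le_one i s)

lemma integrable_section (hx : IsAlloc x) (i : Fin n) (t : Ω) :
    Integrable (fun s => x i (Function.update s i t)) (Measure.pi fun _ => μ) :=
  Integrable.of_bound ((hx.measurable i).comp
      ((measurable_update_pair i).comp measurable_prodMk_left)).aestronglyMeasurable 1
    (ae_of_all _ fun s => by
      rw [Real.norm_eq_abs, abs_of_nonneg (hx.nonneg i _)]; exact hx.le_one i _)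

lemma interim_nonneg (hx : IsAlloc x) (i : Fin n) (t : Ω) : 0 ≤ interim μ i (x i) t :=
  integral_nonneg fun _ => hx.nonneg i _

lemma interim_le_one (hx : IsAlloc x) (i : Fin n) (t : Ω) : interim μ i (x i) t ≤ 1 := by
  have := integral_mono (hx.integrable_section i t) (integrable_const (1 : ℝ)) (μ := Measure.pi fun _ => μ)
    (fun _ => hx.le_one i _)
  simpa [interim] using this

lemma measurable_interim (hx : IsAlloc x) (i : Fin n) : Measurable (interim μ i (x i)) :=
  (StronglyMeasurable.integral_prod_right (f := fun t s => x i (Function.update s i t))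
    (((hx.measurable i).comp (measurable_update_pair i)).stronglyMeasurable)).measurable

end IsAlloc

lemma measurableSet_exists_mem {S : Set Ω} (hS : MeasurableSet S) :
    MeasurableSet {s : Fin n → Ω | ∃ i, s i ∈ S} := by
  rw [ofPred_exists]
  exact MeasurableSet.iUnion fun i => measurable_pi_apply i hS

lemma measureReal_exists_mem {S : Set Ω} (hS : MeasurableSet S) :
    (Measure.pi fun _ : Fin n => μ).real {s | ∃ i, s i ∈ S} = 1 - (1 - μ.real S) ^ n := by
  have h1 : {s : Fin n → Ω | ∃ i, s i ∈ S} = (univ.pi fun _ => Sᶜ)ᶜ := by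
    ext s; simp
  rw [h1, probReal_compl_eq_one_sub (MeasurableSet.univ_pi fun _ => hS.compl), measureReal_def,
    Measure.pi_pi]
  simp [← measureReal_def, probReal_compl_eq_one_sub hS]

lemma sum_setIntegral_interim {x : Fin n → (Fin n → Ω) → ℝ} (hx : IsAlloc x) {S : Set Ω}
    (hS : MeasurableSet S) : ∑ i, ∫ t in S, interim μ i (x i) t ∂μ =
      ∫ s, ∑ i, {s : Fin n → Ω | s i ∈ S}.indicator (x i) s ∂(Measure.pi fun _ => μ) := by
  rw [integral_finsetSum]
  · exact Finset.sum_congr rfl fun i _ => setIntegral_interim (hx.integrable i) i hS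
  · exact fun i _ => (hx.integrable i).indicator (measurable_pi_apply i hS)

/-- Border's inequality. -/
lemma sum_setIntegral_interim_le {x : Fin n → (Fin n → Ω) → ℝ} (hx : IsAlloc x) {S : Set Ω}
    (hS : MeasurableSet S) :
    ∑ i, ∫ t in S, interim μ i (x i) t ∂μ ≤ 1 - (1 - μ.real S) ^ n := by
  rw [sum_setIntegral_interim hx hS, ← measureReal_exists_mem hS, ← integral_indicator_one
    (measurableSet_exists_mem hS)]
  refine integral_mono ?_ ?_ fun s => ?_
  · exact integrable_finsetSum _ fun i _ =>
      (hx.integrable i).indicator (measurable_pi_apply i hS)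
  · exact (integrable_const (1 : ℝ)).indicator (measurableSet_exists_mem hS)
  · by_cases h : ∃ i, s i ∈ S
    · rw [indicator_of_mem (show s ∈ {s : Fin n → Ω | ∃ i, s i ∈ S} from h)]
      refine (Finset.sum_le_sum fun i _ => ?_).trans (hx.sum_le s)
      exact indicator_le_self' (fun _ _ => hx.nonneg i _) s
    · rw [indicator_of_notMem (show s ∉ {s : Fin n → Ω | ∃ i, s i ∈ S} from h)]
      push Not at h
      refine le_of_eq (Finset.sum_eq_zero fun i _ => ?_)
      exact indicator_of_notMem (show s ∉ {s : Fin n → Ω | s i ∈ S} from h i) _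

/-! ### Allocation by priority -/

open Classical in
/-- The bidders with the highest value of `ρ`. -/
def maximizers (ρ : Ω → ℝ) (s : Fin n → Ω) : Finset (Fin n) :=
  Finset.univ.filter fun i => ∀ k, ρ (s k) ≤ ρ (s i)

open Classical in
/-- The item is shared uniformly by the bidders with the highest value of `ρ`. -/
def share (ρ : Ω → ℝ) (i : Fin n) (s : Fin n → Ω) : ℝ :=
  if i ∈ maximizers ρ s then 1 / ((maximizers ρ s).card : ℝ) else 0

lemma mem_maximizers {ρ : Ω → ℝ} {s : Fin n → Ω} {i : Fin n} :
    i ∈ maximizers ρ s ↔ ∀ k, ρ (s k) ≤ ρ (s i) := by simp [maximizers]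

lemma maximizers_nonempty (hn : 1 ≤ n) (ρ : Ω → ℝ) (s : Fin n → Ω) :
    (maximizers ρ s).Nonempty := by
  have : Nonempty (Fin n) := ⟨⟨0, hn⟩⟩
  obtain ⟨i, hi⟩ := Finite.exists_max fun k => ρ (s k)
  exact ⟨i, mem_maximizers.2 hi⟩

lemma share_nonneg (ρ : Ω → ℝ) (i : Fin n) (s : Fin n → Ω) : 0 ≤ share ρ i s := by
  unfold share; split_ifs <;> positivity

lemma sum_share (hn : 1 ≤ n) (ρ : Ω → ℝ) (s : Fin n → Ω) : ∑ i, share ρ i s = 1 := by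
  unfold share
  rw [Finset.sum_ite_mem, Finset.univ_inter, Finset.sum_const, nsmul_eq_mul, mul_one_div_cancel]
  exact_mod_cast (Finset.card_pos.2 (maximizers_nonempty hn ρ s)).ne'

lemma measurable_share {ρ : Ω → ℝ} (hρ : Measurable ρ) (i : Fin n) : Measurable (share ρ i) := by
  classical
  have hset : ∀ j : Fin n, MeasurableSet {s : Fin n → Ω | j ∈ maximizers ρ s} := fun j => by
    simp only [mem_maximizers, ofPred_forall]
    exact MeasurableSet.iInter fun k => measurableSet_le (hρ.comp (measurable_pi_apply k))
      (hρ.comp (measurable_pi_apply j))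
  have hcard : Measurable fun s : Fin n → Ω => ((maximizers ρ s).card : ℝ) := by
    have : (fun s : Fin n → Ω => ((maximizers ρ s).card : ℝ)) =
        fun s => ∑ j, if j ∈ maximizers ρ s then (1 : ℝ) else 0 := by
      ext s; simp
    rw [this]
    exact Finset.measurable_sum _ fun j _ =>
      Measurable.ite (hset j) measurable_const measurable_const
  exact Measurable.ite (hset i) (measurable_const.div hcard) measurable_const

lemma isAlloc_share (hn : 1 ≤ n) {ρ : Ω → ℝ} (hρ : Measurable ρ) :
    IsAlloc (share (n := n) ρ) :=
  ⟨measurable_share hρ, share_nonneg ρ, fun s => (sum_share hn ρ s).le⟩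

/-- A bidder who wins and then raises his rank still wins, and the set of those he ties with can
only shrink. -/
lemma share_update_le (ρ : Ω → ℝ) (i : Fin n) (s : Fin n → Ω) {t t' : Ω} (h : ρ t ≤ ρ t') :
    share ρ i (Function.update s i t) ≤ share ρ i (Function.update s i t') := by
  by_cases hi : i ∈ maximizers ρ (Function.update s i t)
  swap
  · rw [share, if_neg hi]; exact share_nonneg _ _ _
  rw [mem_maximizers] at hi
  simp only [Function.update_self] at hi
  have hi' : i ∈ maximizers ρ (Function.update s i t') := by
    rw [mem_maximizers]
    intro k
    rw [Function.update_self]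
    by_cases hk : k = i
    · subst hk; simp
    · have := hi k
      rw [Function.update_of_ne hk] at this ⊢
      exact this.trans h
  have hsub : maximizers ρ (Function.update s i t') ⊆ maximizers ρ (Function.update s i t) := by
    intro j hj
    by_cases hji : j = i
    · subst hji; rw [mem_maximizers]; simpa using hi
    · rw [mem_maximizers] at hj ⊢
      have h1 := hj i
      rw [Function.update_self, Function.update_of_ne hji] at h1
      intro k
      rw [Function.update_of_ne hji]
      exact (hi k).trans (h.trans h1)
  have hmem : i ∈ maximizers ρ (Function.update s i t) := by
    rw [mem_maximizers]; simpa using hi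
  rw [share, share, if_pos hmem, if_pos hi']
  have hpos : 0 < (maximizers ρ (Function.update s i t')).card := Finset.card_pos.2 ⟨i, hi'⟩
  exact one_div_le_one_div_of_le (by exact_mod_cast hpos)
    (by exact_mod_cast Finset.card_le_card hsub)

/-- If some bidder is in the upper set `S`, then so is every bidder of highest rank, and the whole
unit goes to `S`. This is the reason why priority rules attain Border's bound on upper sets. -/
lemma sum_indicator_share (hn : 1 ≤ n) {ρ : Ω → ℝ} {S : Set Ω}
    (hS : ∀ x ∈ S, ∀ y, ρ x ≤ ρ y → y ∈ S) (s : Fin n → Ω) :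
    ∑ i, {s : Fin n → Ω | s i ∈ S}.indicator (share ρ i) s =
      {s : Fin n → Ω | ∃ i, s i ∈ S}.indicator 1 s := by
  by_cases h : ∃ i, s i ∈ S
  · rw [indicator_of_mem (show s ∈ {s : Fin n → Ω | ∃ i, s i ∈ S} from h), Pi.one_apply,
      ← sum_share hn ρ s]
    obtain ⟨k, hk⟩ := h
    refine Finset.sum_congr rfl fun i _ => ?_
    by_cases hi : s i ∈ S
    · exact indicator_of_mem (show s ∈ {s : Fin n → Ω | s i ∈ S} from hi) _
    · rw [indicator_of_notMem (show s ∉ {s : Fin n → Ω | s i ∈ S} from hi), share, if_neg]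
      rw [mem_maximizers]
      exact fun hm => hi (hS _ hk _ (hm k))
  · rw [indicator_of_notMem (show s ∉ {s : Fin n → Ω | ∃ i, s i ∈ S} from h)]
    push Not at h
    refine Finset.sum_eq_zero fun i _ => ?_
    exact indicator_of_notMem (show s ∉ {s : Fin n → Ω | s i ∈ S} from h i) _

/-- The interim probability of winning under the priority `ρ`. -/
def interimShare (n : ℕ) (hn : 1 ≤ n) (μ : Measure Ω) (ρ : Ω → ℝ) : Ω → ℝ :=
  interim μ (⟨0, hn⟩ : Fin n) (share ρ ⟨0, hn⟩)

lemma share_comp_equiv (ρ : Ω → ℝ) (σ : Equiv.Perm (Fin n)) (i : Fin n) (s : Fin n → Ω) :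
    share ρ i (s ∘ σ) = share ρ (σ i) s := by
  have h1 : ∀ j, j ∈ maximizers ρ (s ∘ σ) ↔ σ j ∈ maximizers ρ s := fun j => by
    simp only [mem_maximizers, Function.comp]
    exact ⟨fun h k => by simpa using h (σ.symm k), fun h k => h (σ k)⟩
  have h2 : (maximizers ρ (s ∘ σ)).card = (maximizers ρ s).card := by
    refine Finset.card_bij (fun j _ => σ j) (fun j hj => (h1 j).1 hj)
      (fun _ _ _ _ h => σ.injective h) fun k hk => ⟨σ.symm k, ?_, by simp⟩
    rw [h1]; simpa using hk
  unfold share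
  simp only [h1, h2]

/-- Swapping two bidders preserves the product law and permutes the shares, so all bidders have the
same interim rule. -/
lemma interim_share (hn : 1 ≤ n) (ρ : Ω → ℝ) (hρ : Measurable ρ) (i : Fin n) :
    interim μ i (share ρ i) = interimShare n hn μ ρ := by
  ext t
  unfold interimShare interim
  set j : Fin n := ⟨0, hn⟩
  set σ := Equiv.swap i j
  have hm : AEStronglyMeasurable (fun s : Fin n → Ω => share ρ j (Function.update s j t))
      (Measure.map (fun s : Fin n → Ω => s ∘ σ) (Measure.pi fun _ => μ)) :=
    ((measurable_share hρ j).comp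
      ((measurable_update_pair j).comp measurable_prodMk_left)).aestronglyMeasurable
  conv_rhs => rw [← (measurePreserving_comp_equiv μ σ).map_eq]
  rw [integral_map (measurePreserving_comp_equiv μ σ).measurable.aemeasurable hm]
  congr 1
  ext s
  have : Function.update (s ∘ σ) j t = Function.update s i t ∘ σ := by
    ext k
    by_cases hk : k = j
    · subst hk; simp [σ]
    · have : σ k ≠ i := fun h => hk (σ.injective (h.trans (Equiv.swap_apply_right i j).symm))
      simp [hk, this]
  rw [this, share_comp_equiv]
  simp [σ]

variable {ρ : Ω → ℝ}

lemma interimShare_mono (hn : 1 ≤ n) (hρ : Measurable ρ) {t t' : Ω} (h : ρ t ≤ ρ t') :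
    interimShare n hn μ ρ t ≤ interimShare n hn μ ρ t' :=
  integral_mono ((isAlloc_share hn hρ).integrable_section _ _)
    ((isAlloc_share hn hρ).integrable_section _ _) fun s => share_update_le ρ _ s h

lemma setIntegral_interimShare_of_upper (hn : 1 ≤ n) (hρ : Measurable ρ) {S : Set Ω}
    (hS : MeasurableSet S) (hup : ∀ x ∈ S, ∀ y, ρ x ≤ ρ y → y ∈ S) :
    ∫ t in S, interimShare n hn μ ρ t ∂μ = (1 - (1 - μ.real S) ^ n) / n := by
  have h := sum_setIntegral_interim (μ := μ) (isAlloc_share hn hρ) hS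
  simp_rw [interim_share hn ρ hρ] at h
  rw [Finset.sum_const, Finset.card_univ, Fintype.card_fin, nsmul_eq_mul] at h
  rw [eq_div_iff (by positivity), mul_comm, h, ← measureReal_exists_mem hS,
    ← integral_indicator_one (measurableSet_exists_mem hS)]
  exact integral_congr_ae (ae_of_all _ (sum_indicator_share hn hup))

/-- When every opponent ranks no higher than `t`, the share is at least `1/n`, and this event has
positive probability. -/
lemma interimShare_pos (hn : 1 ≤ n) (hρ : Measurable ρ) {t : Ω}
    (h : 0 < μ.real {x | ρ x ≤ ρ t}) : 0 < interimShare n hn μ ρ t := by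
  set j : Fin n := ⟨0, hn⟩
  have hm : MeasurableSet {x | ρ x ≤ ρ t} := measurableSet_le hρ measurable_const
  have hb : ∫ s, (univ.pi fun _ : Fin n => {x | ρ x ≤ ρ t}).indicator (fun _ => 1 / (n : ℝ)) s
      ∂(Measure.pi fun _ => μ) ≤ interimShare n hn μ ρ t := by
    refine integral_mono ((integrable_const _).indicator (MeasurableSet.univ_pi fun _ => hm))
      ((isAlloc_share hn hρ).integrable_section _ _) fun s => ?_
    by_cases hs : s ∈ univ.pi fun _ : Fin n => {x | ρ x ≤ ρ t}
    · rw [indicator_of_mem hs]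
      have hj : j ∈ maximizers ρ (Function.update s j t) := by
        rw [mem_maximizers]
        intro k
        rw [Function.update_self]
        by_cases hk : k = j
        · subst hk; simp
        · rw [Function.update_of_ne hk]; exact hs k (mem_univ k)
      rw [share, if_pos hj]
      refine one_div_le_one_div_of_le (Nat.cast_pos.2 (Finset.card_pos.2 ⟨j, hj⟩)) ?_
      exact Nat.cast_le.2 ((Finset.card_le_univ _).trans (Fintype.card_fin n).le)
    · rw [indicator_of_notMem hs]; exact share_nonneg _ _ _
  refine lt_of_lt_of_le ?_ hb
  rw [integral_indicator_const _ (MeasurableSet.univ_pi fun _ => hm), measureReal_def,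
    Measure.pi_pi]
  have h' : 0 < (μ {x | ρ x ≤ ρ t}).toReal := h
  simp only [Finset.prod_const, Finset.card_univ, Fintype.card_fin, ENNReal.toReal_pow,
    smul_eq_mul]
  positivity

end Interim

end TwoItemAuction

end

noncomputable section

namespace TwoItemAuction

/-! ### Convex envelopes on the unit interval -/

/-- The largest convex function on `[0,1]` below `H`. -/
def envelope (H : ℝ → ℝ) (z : ℝ) : ℝ :=
  sSup {y | ∃ g : ℝ → ℝ, ConvexOn ℝ (Icc 0 1) g ∧ (∀ x ∈ Icc (0 : ℝ) 1, g x ≤ H x) ∧ y = g z}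

lemma le_envelope {H g : ℝ → ℝ} (hg : ConvexOn ℝ (Icc 0 1) g)
    (hgH : ∀ x ∈ Icc (0 : ℝ) 1, g x ≤ H x) {z : ℝ} (hz : z ∈ Icc (0 : ℝ) 1) :
    g z ≤ envelope H z := by
  refine le_csSup ⟨H z, ?_⟩ ⟨g, hg, hgH, rfl⟩
  rintro y ⟨g', _, h', rfl⟩
  exact h' z hz

lemma convexOn_affine (s : Set ℝ) (hs : Convex ℝ s) (c m : ℝ) :
    ConvexOn ℝ s fun z => c + m * z := by
  refine ⟨hs, fun x _ y _ p q _ _ hpq => le_of_eq ?_⟩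
  simp only [smul_eq_mul]
  linear_combination -c * hpq

section

variable {H : ℝ → ℝ} (hH : ContinuousOn H (Icc 0 1))
include hH

lemma envelope_le {z : ℝ} (hz : z ∈ Icc (0 : ℝ) 1) : envelope H z ≤ H z := by
  -- The least upper bound property needs an admissible minorant to exist; the constant `min H` is
  -- one.
  obtain ⟨w, _, hw⟩ := isCompact_Icc.exists_isMinOn ⟨z, hz⟩ hH
  refine csSup_le ⟨H w, fun _ => H w, convexOn_const _ (convex_Icc 0 1), fun x hx => hw hx, rfl⟩ ?_
  rintro y ⟨g, _, h, rfl⟩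
  exact h z hz

lemma convexOn_envelope : ConvexOn ℝ (Icc 0 1) (envelope H) := by
  refine ⟨convex_Icc 0 1, fun x hx y hy p q hp hq hpq => ?_⟩
  obtain ⟨w, _, hw⟩ := isCompact_Icc.exists_isMinOn ⟨x, hx⟩ hH
  refine csSup_le ⟨H w, fun _ => H w, convexOn_const _ (convex_Icc 0 1), fun x hx => hw hx, rfl⟩ ?_
  rintro _ ⟨g, hg, h, rfl⟩
  refine (hg.2 hx hy hp hq hpq).trans ?_
  simp only [smul_eq_mul]
  gcongr
  · exact le_envelope hg h hx
  · exact le_envelope hg h hy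

/-- With `ε` the smallest gap between `H` and the line on `[w,1]`, the line can be tilted upwards
about `w` by slope `ε` and stays below `H` there, since `x - w ≤ 1`. The maximum of the line and the
tilted line is a convex minorant that is strictly larger to the right of `w`. -/
lemma affine_lt_envelope_right {c m w z : ℝ} (hw : w ∈ Icc (0 : ℝ) 1)
    (hle : ∀ x ∈ Icc (0 : ℝ) 1, c + m * x ≤ H x) (hlt : ∀ x ∈ Icc w 1, c + m * x < H x)
    (hz : z ∈ Ioc w 1) : c + m * z < envelope H z := by
  have hsub : Icc w 1 ⊆ Icc 0 1 := Icc_subset_Icc_left hw.1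
  obtain ⟨v, hv, hmin⟩ := isCompact_Icc.exists_isMinOn (f := fun x => H x - (c + m * x))
    ⟨w, left_mem_Icc.2 hw.2⟩ ((hH.mono hsub).sub (by fun_prop))
  set ε := H v - (c + m * v) with hε
  have hεpos : 0 < ε := sub_pos.2 (hlt v hv)
  have hconv : ConvexOn ℝ (Icc 0 1) ((fun x => c + m * x) ⊔ fun x => (c - ε * w) + (m + ε) * x) :=
    (convexOn_affine _ (convex_Icc 0 1) _ _).sup (convexOn_affine _ (convex_Icc 0 1) _ _)
  have h1 := le_envelope hconv (H := H) (fun x hx => ?_) (hsub (Ioc_subset_Icc_self hz))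
  · refine lt_of_lt_of_le ?_ ((le_sup_right : _ ≤ _).trans h1)
    have := mul_pos hεpos (sub_pos.2 hz.1)
    simp only; linarith
  · refine sup_le (hle x hx) ?_
    rcases le_or_gt w x with h | h
    · have h2 : ε ≤ H x - (c + m * x) := hmin (⟨h, hx.2⟩ : x ∈ Icc w 1)
      have h3 : ε * (x - w) ≤ ε * 1 := by
        apply mul_le_mul_of_nonneg_left _ hεpos.le
        linarith [hw.1, hx.2]
      simp only; linarith
    · have := hle x hx
      have := mul_pos hεpos (sub_pos.2 h)
      simp only; linarith

lemma affine_lt_envelope_left {c m w z : ℝ} (hw : w ∈ Icc (0 : ℝ) 1)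
    (hle : ∀ x ∈ Icc (0 : ℝ) 1, c + m * x ≤ H x) (hlt : ∀ x ∈ Icc 0 w, c + m * x < H x)
    (hz : z ∈ Ico 0 w) : c + m * z < envelope H z := by
  have hsub : Icc 0 w ⊆ Icc 0 1 := Icc_subset_Icc_right hw.2
  obtain ⟨v, hv, hmin⟩ := isCompact_Icc.exists_isMinOn (f := fun x => H x - (c + m * x))
    ⟨w, right_mem_Icc.2 hw.1⟩ ((hH.mono hsub).sub (by fun_prop))
  set ε := H v - (c + m * v) with hε
  have hεpos : 0 < ε := sub_pos.2 (hlt v hv)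
  have hconv : ConvexOn ℝ (Icc 0 1) ((fun x => c + m * x) ⊔ fun x => (c + ε * w) + (m - ε) * x) :=
    (convexOn_affine _ (convex_Icc 0 1) _ _).sup (convexOn_affine _ (convex_Icc 0 1) _ _)
  have h1 := le_envelope hconv (H := H) (fun x hx => ?_) (hsub (Ico_subset_Icc_self hz))
  · refine lt_of_lt_of_le ?_ ((le_sup_right : _ ≤ _).trans h1)
    have := mul_pos hεpos (sub_pos.2 hz.2)
    simp only; linarith
  · refine sup_le (hle x hx) ?_
    rcases le_or_gt x w with h | h
    · have h2 : ε ≤ H x - (c + m * x) := hmin (⟨hx.1, h⟩ : x ∈ Icc 0 w)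
      have h3 : ε * (w - x) ≤ ε * 1 := by
        apply mul_le_mul_of_nonneg_left _ hεpos.le
        linarith [hw.2, hx.1]
      simp only; linarith
    · have := hle x hx
      have := mul_pos hεpos (sub_pos.2 h)
      simp only; linarith

end

/-- A convex function has a supporting line at every interior point. -/
lemma exists_support {K : ℝ → ℝ} (hK : ConvexOn ℝ (Icc 0 1) K) {z : ℝ} (hz : z ∈ Ioo (0 : ℝ) 1) :
    ∃ m, ∀ x ∈ Icc (0 : ℝ) 1, K z + m * (x - z) ≤ K x := by
  have hz' : z ∈ interior (Icc (0 : ℝ) 1) := by rwa [interior_Icc]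
  have hzI := Ioo_subset_Icc_self hz
  refine ⟨derivWithin K (Ioi z) z, fun x hx => ?_⟩
  rcases lt_trichotomy x z with h | rfl | h
  · have h1 := hK.slope_le_leftDeriv_of_mem_interior hx hz' h
    have h2 := h1.trans (hK.leftDeriv_le_rightDeriv_of_mem_interior hz')
    rw [slope_def_field, div_le_iff₀ (by linarith)] at h2
    linarith
  · simp
  · have h1 := hK.rightDeriv_le_slope_of_mem_interior hz' hx h
    rw [slope_def_field, le_div_iff₀ (by linarith)] at h1
    linarith

/-- A convex function that lies below a function differentiable at a point of contact is
differentiable there as well. -/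
lemma hasDerivAt_of_le {K G : ℝ → ℝ} (hK : ConvexOn ℝ (Icc 0 1) K) {z m : ℝ}
    (hz : z ∈ Ioo (0 : ℝ) 1) (hG : HasDerivAt G m z) (hle : ∀ x ∈ Icc (0 : ℝ) 1, K x ≤ G x)
    (heq : K z = G z) : HasDerivAt K m z := by
  obtain ⟨p, hp⟩ := exists_support hK hz
  have hn : Icc (0 : ℝ) 1 ∈ nhds z := Icc_mem_nhds hz.1 hz.2
  -- The supporting line of `K` at `z` also lies below `G` and meets it, so its slope must be the
  -- derivative of `G`. Afterwards `K` is squeezed between the line and `G`.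
  have hmin : IsLocalMin (fun x => G x - p * (x - z)) z := by
    filter_upwards [hn] with x hx
    have := hp x hx
    have := hle x hx
    rw [← heq]
    linarith
  have hd : HasDerivAt (fun x => G x - p * (x - z)) (m - p * 1) z :=
    hG.sub (((hasDerivAt_id z).sub_const z).const_mul p)
  have hpm : p = m := by
    have := hmin.hasDerivAt_eq_zero hd
    linarith
  subst hpm
  rw [hasDerivAt_iff_isLittleO] at hG ⊢
  refine (Asymptotics.IsBigO.of_bound 1 ?_).trans_isLittleO hG
  filter_upwards [hn] with x hx
  have := hp x hx
  have := hle x hx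
  rw [one_mul, Real.norm_eq_abs, Real.norm_eq_abs, smul_eq_mul, ← heq,
    abs_of_nonneg (by linarith), abs_of_nonneg (by linarith)]
  linarith

/-- Every interior point lies between two points where the envelope touches the function and between
which the envelope is affine, possibly equal. -/
lemma exists_contact {H : ℝ → ℝ} (hH : ContinuousOn H (Icc 0 1)) {z : ℝ} (hz : z ∈ Ioo (0 : ℝ) 1) :
    ∃ m, ∃ l ∈ Icc 0 z, ∃ r ∈ Icc z 1, envelope H l = H l ∧ envelope H r = H r ∧
      (∀ x ∈ Icc l r, envelope H x = envelope H z + m * (x - z)) ∧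
      ∀ x ∈ Icc (0 : ℝ) 1, envelope H z + m * (x - z) ≤ envelope H x := by
  have hK := convexOn_envelope hH
  obtain ⟨m, hm⟩ := exists_support hK hz
  have hzI := Ioo_subset_Icc_self hz
  set c := envelope H z - m * z with hc
  have hm' : ∀ x ∈ Icc (0 : ℝ) 1, c + m * x ≤ H x := fun x hx => by
    have := (hm x hx).trans (envelope_le hH hx); linarith
  have hcont : ContinuousAt (fun x => H x - (c + m * x)) z :=
    (hH.continuousAt (Icc_mem_nhds hz.1 hz.2)).sub (by fun_prop)
  -- Without a contact on `[z,1]` the line would be strictly below `H` from some point left of `z`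
  -- up to `1`, and then the envelope would exceed it at `z`, where they agree.
  have hr : ∃ r ∈ Icc z 1, c + m * r = H r := by
    by_contra! hne
    have hpos : 0 < H z - (c + m * z) :=
      sub_pos.2 (lt_of_le_of_ne (hm' z hzI) (hne z (left_mem_Icc.2 hz.2.le)))
    obtain ⟨w, hw, hw2⟩ : ∃ w, w ∈ Ico 0 z ∧ ∀ x ∈ Ioc w z, 0 < H x - (c + m * x) := by
      obtain ⟨l, hl1, hl2⟩ := exists_Ioc_subset_of_mem_nhds
        (hcont.eventually (lt_mem_nhds hpos)) ⟨0, hz.1⟩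
      refine ⟨max l 0, ⟨le_max_right _ _, max_lt hl1 hz.1⟩, fun x hx => ?_⟩
      exact hl2 ⟨(le_max_left _ _).trans_lt hx.1, hx.2⟩
    have hmid : (w + z) / 2 ∈ Ioo w z := ⟨by linarith [hw.2], by linarith [hw.2]⟩
    have := affine_lt_envelope_right hH (c := c) (m := m) (w := (w + z) / 2) (z := z)
      ⟨hw.1.trans hmid.1.le, hmid.2.le.trans hz.2.le⟩ hm' (fun x hx => ?_) ⟨hmid.2, hz.2.le⟩
    · linarith
    · rcases le_total x z with h | h
      · exact sub_pos.1 (hw2 x ⟨hmid.1.trans_le hx.1, h⟩)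
      · exact lt_of_le_of_ne (hm' x ⟨hz.1.le.trans h, hx.2⟩) (hne x ⟨h, hx.2⟩)
  have hl : ∃ l ∈ Icc 0 z, c + m * l = H l := by
    by_contra! hne
    have hpos : 0 < H z - (c + m * z) :=
      sub_pos.2 (lt_of_le_of_ne (hm' z hzI) (hne z (right_mem_Icc.2 hz.1.le)))
    obtain ⟨w, hw, hw2⟩ : ∃ w, w ∈ Ioc z 1 ∧ ∀ x ∈ Ico z w, 0 < H x - (c + m * x) := by
      obtain ⟨l, hl1, hl2⟩ := exists_Ico_subset_of_mem_nhds
        (hcont.eventually (lt_mem_nhds hpos)) ⟨1, hz.2⟩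
      refine ⟨min l 1, ⟨lt_min hl1 hz.2, min_le_right _ _⟩, fun x hx => ?_⟩
      exact hl2 ⟨hx.1, hx.2.trans_le (min_le_left _ _)⟩
    have hmid : (w + z) / 2 ∈ Ioo z w := ⟨by linarith [hw.1], by linarith [hw.1]⟩
    have := affine_lt_envelope_left hH (c := c) (m := m) (w := (w + z) / 2) (z := z)
      ⟨hz.1.le.trans hmid.1.le, hmid.2.le.trans hw.2⟩ hm' (fun x hx => ?_) ⟨hz.1.le, hmid.1⟩
    · linarith
    · rcases le_total z x with h | h
      · exact sub_pos.1 (hw2 x ⟨h, hx.2.trans_lt hmid.2⟩)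
      · exact lt_of_le_of_ne (hm' x ⟨hx.1, h.trans hz.2.le⟩) (hne x ⟨hx.1, h⟩)
  obtain ⟨l, hl, hl2⟩ := hl
  obtain ⟨r, hr, hr2⟩ := hr
  have hl01 : l ∈ Icc (0 : ℝ) 1 := ⟨hl.1, hl.2.trans hz.2.le⟩
  have hr01 : r ∈ Icc (0 : ℝ) 1 := ⟨hz.1.le.trans hr.1, hr.2⟩
  have hKl : envelope H l = c + m * l := le_antisymm ((envelope_le hH hl01).trans hl2.ge)
    (by linarith [hm l hl01])
  have hKr : envelope H r = c + m * r := le_antisymm ((envelope_le hH hr01).trans hr2.ge)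
    (by linarith [hm r hr01])
  refine ⟨m, l, hl, r, hr, hKl.trans hl2, hKr.trans hr2, fun x hx => ?_, hm⟩
  have hx01 : x ∈ Icc (0 : ℝ) 1 := ⟨hl01.1.trans hx.1, hx.2.trans hr01.2⟩
  refine le_antisymm ?_ (hm x hx01)
  -- The envelope minus the line is convex and vanishes at both contacts, hence is nonpositive
  -- between them.
  have := hK.sub (g := fun z => c + m * z) (by
    refine ⟨convex_Icc 0 1, fun x _ y _ p q _ _ hpq => le_of_eq ?_⟩
    simp only [smul_eq_mul]
    linear_combination c * hpq)
  have h3 := this.le_max_of_mem_Icc hl01 hr01 hx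
  simp only [Pi.sub_apply, hKl, hKr, sub_self, max_self] at h3
  linarith

end TwoItemAuction

end

noncomputable section

namespace TwoItemAuction

/-! ### The type distribution -/

lemma hFun_eq (f : ℝ → ℝ) (ts s : ℝ) :
    hFun f ts s = (s * f s + cdf f s) - (Ioi ts).indicator (fun _ => (1 : ℝ)) s := by
  unfold hFun
  split_ifs with h
  · rw [indicator_of_notMem (by simpa using h)]; ring
  · rw [indicator_of_mem (by simpa using h)]

/-- The standing assumptions on the density. -/
structure IsTypeDensity (b : ℝ) (f : ℝ → ℝ) : Prop where
  pos_b : 0 < b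
  differentiableOn : DifferentiableOn ℝ f (Icc 0 b)
  pos : ∀ t ∈ Ioo (0 : ℝ) b, 0 < f t
  integral_eq_one : (∫ t in (0 : ℝ)..b, f t) = 1

namespace IsTypeDensity

variable {b : ℝ} {f : ℝ → ℝ} (hf : IsTypeDensity b f)
include hf

lemma zero_mem : (0 : ℝ) ∈ Icc 0 b := left_mem_Icc.2 hf.pos_b.le

lemma b_mem : b ∈ Icc (0 : ℝ) b := right_mem_Icc.2 hf.pos_b.le

lemma continuousOn : ContinuousOn f (Icc 0 b) := hf.differentiableOn.continuousOn

lemma nonneg {t : ℝ} (ht : t ∈ Icc 0 b) : 0 ≤ f t := by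
  have h1 : closure (Ioo 0 b) = Icc 0 b := closure_Ioo hf.pos_b.ne
  refine ContinuousWithinAt.closure_le (s := Ioo 0 b) (f := fun _ => (0 : ℝ)) (h1 ▸ ht)
    continuousWithinAt_const ((hf.continuousOn t ht).mono Ioo_subset_Icc_self)
    fun x hx => (hf.pos x hx).le

lemma intervalIntegrable {x y : ℝ} (hx : x ∈ Icc 0 b) (hy : y ∈ Icc 0 b) :
    IntervalIntegrable f volume x y :=
  (hf.continuousOn.mono (ordConnected_Icc.uIcc_subset hx hy)).intervalIntegrable

lemma integrableOn : IntegrableOn f (Icc 0 b) := hf.continuousOn.integrableOn_Icc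

lemma cdf_zero : cdf f 0 = 0 := by simp [cdf]

lemma cdf_b : cdf f b = 1 := hf.integral_eq_one

lemma integral_eq_cdf_sub {x y : ℝ} (hx : x ∈ Icc 0 b) (hy : y ∈ Icc 0 b) :
    ∫ t in x..y, f t = cdf f y - cdf f x := by
  rw [cdf, cdf, intervalIntegral.integral_interval_sub_left
    (hf.intervalIntegrable hf.zero_mem hy) (hf.intervalIntegrable hf.zero_mem hx)]

lemma continuousOn_cdf : ContinuousOn (cdf f) (Icc 0 b) := by
  have := intervalIntegral.continuousOn_primitive_interval (f := f) (a := 0) (b := b) (μ := volume)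
    (by rw [uIcc_of_le hf.pos_b.le]; exact hf.integrableOn)
  rwa [uIcc_of_le hf.pos_b.le] at this

lemma hasDerivAt_cdf {t : ℝ} (ht : t ∈ Ioo 0 b) : HasDerivAt (cdf f) (f t) t := by
  have hn : Icc 0 b ∈ nhds t := Icc_mem_nhds ht.1 ht.2
  refine intervalIntegral.integral_hasDerivAt_right
    (hf.intervalIntegrable hf.zero_mem (Ioo_subset_Icc_self ht)) ?_
    (hf.continuousOn.continuousAt hn)
  exact hf.continuousOn.stronglyMeasurableAtFilter_nhdsWithin measurableSet_Icc t |>.filter_mono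
    (by rw [nhdsWithin_eq_nhds.2 hn])

lemma strictMonoOn_cdf : StrictMonoOn (cdf f) (Icc 0 b) := by
  refine strictMonoOn_of_deriv_pos (convex_Icc 0 b) hf.continuousOn_cdf fun t ht => ?_
  rw [interior_Icc] at ht
  rw [(hf.hasDerivAt_cdf ht).deriv]
  exact hf.pos t ht

lemma cdf_mem {t : ℝ} (ht : t ∈ Icc 0 b) : cdf f t ∈ Icc (0 : ℝ) 1 := by
  have h0 := hf.strictMonoOn_cdf.monotoneOn hf.zero_mem ht ht.1
  have h1 := hf.strictMonoOn_cdf.monotoneOn ht hf.b_mem ht.2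
  rw [hf.cdf_zero] at h0
  rw [hf.cdf_b] at h1
  exact ⟨h0, h1⟩

lemma cdf_pos {t : ℝ} (ht : t ∈ Ioc 0 b) : 0 < cdf f t := by
  have := hf.strictMonoOn_cdf hf.zero_mem (Ioc_subset_Icc_self ht) ht.1
  rwa [hf.cdf_zero] at this

lemma cdf_lt_one {t : ℝ} (ht : t ∈ Ico 0 b) : cdf f t < 1 := by
  have := hf.strictMonoOn_cdf (Ico_subset_Icc_self ht) hf.b_mem ht.2
  rwa [hf.cdf_b] at this

lemma cdf_mem_Ioo {t : ℝ} (ht : t ∈ Ioo 0 b) : cdf f t ∈ Ioo (0 : ℝ) 1 :=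
  ⟨hf.cdf_pos (Ioo_subset_Ioc_self ht), hf.cdf_lt_one (Ioo_subset_Ico_self ht)⟩

lemma exists_cdf_eq {z : ℝ} (hz : z ∈ Icc (0 : ℝ) 1) : ∃ t ∈ Icc 0 b, cdf f t = z := by
  have := intermediate_value_Icc hf.pos_b.le hf.continuousOn_cdf
  rw [hf.cdf_zero, hf.cdf_b] at this
  exact this hz

lemma quantile_mem {z : ℝ} (hz : z ∈ Icc (0 : ℝ) 1) : quantile b f z ∈ Icc 0 b :=
  Function.invFunOn_mem (hf.exists_cdf_eq hz)

lemma cdf_quantile {z : ℝ} (hz : z ∈ Icc (0 : ℝ) 1) : cdf f (quantile b f z) = z :=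
  Function.invFunOn_eq (hf.exists_cdf_eq hz)

lemma quantile_cdf {t : ℝ} (ht : t ∈ Icc 0 b) : quantile b f (cdf f t) = t :=
  hf.strictMonoOn_cdf.injOn (hf.quantile_mem (hf.cdf_mem ht)) ht (hf.cdf_quantile (hf.cdf_mem ht))

lemma quantile_strictMonoOn : StrictMonoOn (quantile b f) (Icc 0 1) := by
  intro x hx y hy hxy
  rw [← hf.strictMonoOn_cdf.lt_iff_lt (hf.quantile_mem hx) (hf.quantile_mem hy),
    hf.cdf_quantile hx, hf.cdf_quantile hy]
  exact hxy

lemma quantile_zero : quantile b f 0 = 0 := by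
  have := hf.quantile_cdf hf.zero_mem
  rwa [hf.cdf_zero] at this

lemma quantile_one : quantile b f 1 = b := by
  have := hf.quantile_cdf hf.b_mem
  rwa [hf.cdf_b] at this

lemma continuousOn_quantile : ContinuousOn (quantile b f) (Icc 0 1) := by
  intro z hz
  rw [ContinuousWithinAt, Metric.tendsto_nhdsWithin_nhds]
  by_contra! hne
  obtain ⟨ε, hε, hne⟩ := hne
  have hmono := hf.quantile_strictMonoOn
  -- the two points at distance `ε` from the value delimit a neighbourhood of `z`
  have h1 : ∃ δ > 0, ∀ y ∈ Icc (0 : ℝ) 1, z - δ < y → quantile b f z - ε < quantile b f y := by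
    rcases le_or_gt (quantile b f z - ε) 0 with h | h
    · rcases hz.1.eq_or_lt with h0 | h0
      · refine ⟨1, one_pos, fun y hy _ => ?_⟩
        have := hmono.monotoneOn hz hy (h0 ▸ hy.1)
        linarith
      · refine ⟨z, h0, fun y hy hy2 => ?_⟩
        have : quantile b f 0 < quantile b f y :=
          hmono (left_mem_Icc.2 zero_le_one) hy (by linarith)
        rw [hf.quantile_zero] at this
        linarith
    · have hm : quantile b f z - ε ∈ Icc 0 b := ⟨h.le, by linarith [(hf.quantile_mem hz).2]⟩
      refine ⟨z - cdf f (quantile b f z - ε), ?_, fun y hy hy2 => ?_⟩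
      · have := hf.strictMonoOn_cdf hm (hf.quantile_mem hz) (by linarith)
        rw [hf.cdf_quantile hz] at this
        linarith
      · rw [← hf.strictMonoOn_cdf.lt_iff_lt hm (hf.quantile_mem hy), hf.cdf_quantile hy]
        linarith
  have h2 : ∃ δ > 0, ∀ y ∈ Icc (0 : ℝ) 1, y < z + δ → quantile b f y < quantile b f z + ε := by
    rcases le_or_gt b (quantile b f z + ε) with h | h
    · rcases hz.2.eq_or_lt with h0 | h0
      · refine ⟨1, one_pos, fun y hy _ => ?_⟩
        have := hmono.monotoneOn hy hz (h0 ▸ hy.2)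
        linarith
      · refine ⟨1 - z, by linarith, fun y hy hy2 => ?_⟩
        have : quantile b f y < quantile b f 1 :=
          hmono hy (right_mem_Icc.2 zero_le_one) (by linarith)
        rw [hf.quantile_one] at this
        linarith
    · have hm : quantile b f z + ε ∈ Icc 0 b := ⟨by linarith [(hf.quantile_mem hz).1], h.le⟩
      refine ⟨cdf f (quantile b f z + ε) - z, ?_, fun y hy hy2 => ?_⟩
      · have := hf.strictMonoOn_cdf (hf.quantile_mem hz) hm (by linarith)
        rw [hf.cdf_quantile hz] at this
        linarith
      · rw [← hf.strictMonoOn_cdf.lt_iff_lt (hf.quantile_mem hy) hm, hf.cdf_quantile hy]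
        linarith
  obtain ⟨δ₁, hδ₁, h1⟩ := h1
  obtain ⟨δ₂, hδ₂, h2⟩ := h2
  obtain ⟨y, hy, hy2, hy3⟩ := hne (min δ₁ δ₂) (lt_min hδ₁ hδ₂)
  rw [Real.dist_eq, abs_lt] at hy2
  have h3 := h1 y hy (by linarith [hy2.1, min_le_left δ₁ δ₂])
  have h4 := h2 y hy (by linarith [hy2.2, min_le_right δ₁ δ₂])
  refine absurd hy3 (not_le.2 ?_)
  rw [Real.dist_eq, abs_lt]
  constructor <;> linarith

lemma hasDerivAt_quantile {t : ℝ} (ht : t ∈ Ioo 0 b) :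
    HasDerivAt (quantile b f) (f t)⁻¹ (cdf f t) := by
  have htI := Ioo_subset_Icc_self ht
  have hz := hf.cdf_mem_Ioo ht
  have hn : Icc (0 : ℝ) 1 ∈ nhds (cdf f t) := Icc_mem_nhds hz.1 hz.2
  refine HasDerivAt.of_local_left_inverse (f := cdf f)
    (hf.continuousOn_quantile.continuousAt hn) ?_ (hf.pos t ht).ne' ?_
  · rw [hf.quantile_cdf htI]; exact hf.hasDerivAt_cdf ht
  · filter_upwards [hn] with z hz using hf.cdf_quantile hz

/-! ### The law of a type -/

lemma integral_typeLaw (g : ℝ → ℝ) : ∫ t, g t ∂typeLaw b f = ∫ t in Icc 0 b, g t * f t := by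
  have hae : AEMeasurable f (volume.restrict (Icc 0 b)) := hf.integrableOn.aemeasurable
  rw [typeLaw, integral_withDensity_eq_integral_toReal_smul₀ hae.ennreal_ofReal
    (ae_of_all _ fun _ => ENNReal.ofReal_lt_top)]
  refine setIntegral_congr_fun measurableSet_Icc fun t ht => ?_
  simp only [ENNReal.toReal_ofReal (hf.nonneg ht), smul_eq_mul, mul_comm]

lemma setIntegral_typeLaw (g : ℝ → ℝ) {S : Set ℝ} (hS : MeasurableSet S) (hSb : S ⊆ Icc 0 b) :
    ∫ t in S, g t ∂typeLaw b f = ∫ t in S, g t * f t := by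
  rw [← integral_indicator hS, hf.integral_typeLaw]
  have : (fun t => S.indicator g t * f t) = S.indicator fun t => g t * f t := by
    ext t; by_cases h : t ∈ S <;> simp [h]
  rw [this, setIntegral_indicator hS, inter_eq_right.2 hSb]

lemma isProbabilityMeasure : IsProbabilityMeasure (typeLaw b f) := by
  constructor
  rw [typeLaw, withDensity_apply _ MeasurableSet.univ, Measure.restrict_univ,
    ← ofReal_integral_eq_lintegral_ofReal hf.integrableOn
      ((ae_restrict_iff' measurableSet_Icc).2 (ae_of_all _ fun t ht => hf.nonneg ht)),
    integral_Icc_eq_integral_Ioc, ← intervalIntegral.integral_of_le hf.pos_b.le,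
    hf.integral_eq_one, ENNReal.ofReal_one]

lemma measureReal_typeLaw {S : Set ℝ} (hS : MeasurableSet S) (hSb : S ⊆ Icc 0 b) :
    (typeLaw b f).real S = ∫ t in S, f t := by
  have := hf.isProbabilityMeasure
  have h := hf.setIntegral_typeLaw (fun _ => 1) hS hSb
  simpa using h

lemma ae_mem_Icc : ∀ᵐ t ∂typeLaw b f, t ∈ Icc 0 b :=
  (withDensity_absolutelyContinuous _ _).ae_le (ae_restrict_mem measurableSet_Icc)

/-- Endpoints carry no mass, so it suffices to know an upper or lower set of types up to its
endpoints. -/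
lemma measureReal_eq_of_Ioo {S : Set ℝ} {x y : ℝ} (hxy : x ≤ y) (hx : x ∈ Icc 0 b)
    (hy : y ∈ Icc 0 b) (h1 : Ioo x y ⊆ S) (h2 : S ∩ Icc 0 b ⊆ Icc x y) :
    (typeLaw b f).real S = cdf f y - cdf f x := by
  have := hf.isProbabilityMeasure
  have hsub : Icc x y ⊆ Icc 0 b := Icc_subset_Icc hx.1 hy.2
  have e0 : (typeLaw b f).real S = (typeLaw b f).real (S ∩ Icc 0 b) := by
    refine measureReal_congr ?_
    filter_upwards [hf.ae_mem_Icc] with t ht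
    exact propext ⟨fun h => ⟨h, ht⟩, fun h => h.1⟩
  have e1 : (typeLaw b f).real (Ioo x y) = cdf f y - cdf f x := by
    rw [hf.measureReal_typeLaw measurableSet_Ioo (Ioo_subset_Icc_self.trans hsub),
      ← integral_Ioc_eq_integral_Ioo, ← intervalIntegral.integral_of_le hxy,
      hf.integral_eq_cdf_sub hx hy]
  have e2 : (typeLaw b f).real (Icc x y) = cdf f y - cdf f x := by
    rw [hf.measureReal_typeLaw measurableSet_Icc hsub, integral_Icc_eq_integral_Ioc,
      ← intervalIntegral.integral_of_le hxy, hf.integral_eq_cdf_sub hx hy]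
  refine le_antisymm ?_ ?_
  · rw [e0, ← e2]; exact measureReal_mono h2
  · rw [← e1]; exact measureReal_mono h1

/-! ### The functions `h` and `H` -/

/-- `t F(t)` is a primitive of `t f + F`, and the jump of `h` at `t*` contributes the positive part
of `t - t*`. -/
lemma integral_hFun {ts t : ℝ} (hts : ts ∈ Icc 0 b) (ht : t ∈ Icc 0 b) :
    ∫ s in (0 : ℝ)..t, hFun f ts s = t * cdf f t - max (t - ts) 0 := by
  have hsub : Icc 0 t ⊆ Icc 0 b := Icc_subset_Icc_right ht.2
  have hc : ContinuousOn (fun s => s * f s + cdf f s) (Icc 0 b) :=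
    (continuousOn_id.mul hf.continuousOn).add hf.continuousOn_cdf
  have hi : IntervalIntegrable (fun s => s * f s + cdf f s) volume 0 t :=
    ContinuousOn.intervalIntegrable (by rw [uIcc_of_le ht.1]; exact hc.mono hsub)
  have hi2 : IntervalIntegrable ((Ioi ts).indicator (fun _ => (1 : ℝ))) volume 0 t := by
    rw [intervalIntegrable_iff]
    exact (intervalIntegrable_iff.1 intervalIntegrable_const).indicator measurableSet_Ioi
  simp_rw [hFun_eq]
  rw [intervalIntegral.integral_sub hi hi2]
  congr 1
  · have := intervalIntegral.integral_eq_sub_of_hasDerivAt_of_le ht.1 (f := fun s => s * cdf f s)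
      (f' := fun s => s * f s + cdf f s) ((continuousOn_id.mul hf.continuousOn_cdf).mono hsub)
      (fun s hs => ?_) hi
    · simpa using this
    · have := (hasDerivAt_id s).mul (hf.hasDerivAt_cdf ⟨hs.1, hs.2.trans_le ht.2⟩)
      simp only [id, one_mul] at this
      rw [add_comm]
      exact this
  · rw [intervalIntegral.integral_of_le ht.1, setIntegral_indicator measurableSet_Ioi]
    have : Ioc 0 t ∩ Ioi ts = Ioc ts t := by
      ext s
      simp only [mem_inter_iff, mem_Ioc, mem_Ioi]
      exact ⟨fun h => ⟨h.2, h.1.2⟩, fun h => ⟨⟨hts.1.trans_lt h.1, h.2⟩, h.1⟩⟩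
    rw [this, setIntegral_const]
    simp [measureReal_def, ENNReal.toReal_ofReal']

lemma integrableOn_hFun (ts : ℝ) : IntegrableOn (hFun f ts) (Icc 0 b) := by
  have hc : ContinuousOn (fun s => s * f s + cdf f s) (Icc 0 b) :=
    (continuousOn_id.mul hf.continuousOn).add hf.continuousOn_cdf
  rw [show hFun f ts = fun s => (s * f s + cdf f s) - (Ioi ts).indicator (fun _ => (1 : ℝ)) s from
    funext (hFun_eq f ts)]
  exact hc.integrableOn_Icc.sub ((integrable_const (1 : ℝ)).indicator measurableSet_Ioi)

/-- The form used from here on: two branches, of which only the second depends on `t*`, and only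
through an additive constant. -/
lemma HFun_cdf {ts t : ℝ} (hts : ts ∈ Icc 0 b) (ht : t ∈ Icc 0 b) :
    HFun b f ts (cdf f t) = min (t * cdf f t) (ts - t * (1 - cdf f t)) := by
  rw [HFun, hf.quantile_cdf ht, hf.integral_hFun hts ht]
  rcases le_total t ts with h | h
  · rw [max_eq_right (by linarith), min_eq_left (by linarith), sub_zero]
  · rw [max_eq_left (by linarith), min_eq_right (by linarith)]
    ring

lemma HFun_eq {ts z : ℝ} (hts : ts ∈ Icc 0 b) (hz : z ∈ Icc (0 : ℝ) 1) :
    HFun b f ts z = min (quantile b f z * z) (ts - quantile b f z * (1 - z)) := by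
  have := hf.HFun_cdf hts (hf.quantile_mem hz)
  rwa [hf.cdf_quantile hz] at this

lemma continuousOn_HFun {ts : ℝ} (hts : ts ∈ Icc 0 b) : ContinuousOn (HFun b f ts) (Icc 0 1) := by
  refine ContinuousOn.congr (f := fun z => min (quantile b f z * z)
    (ts - quantile b f z * (1 - z))) ?_ fun z hz => hf.HFun_eq hts hz
  have := hf.continuousOn_quantile
  fun_prop

end IsTypeDensity

end TwoItemAuction

end

noncomputable section

namespace TwoItemAuction

/-! ### The pivotal type of a given ironed value -/

/-- The maximizers of `(s - t) F(t)`. -/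
def leftMax (b : ℝ) (f : ℝ → ℝ) (s : ℝ) : Set ℝ :=
  {x | x ∈ Icc 0 b ∧ ∀ t ∈ Icc 0 b, (s - t) * cdf f t ≤ (s - x) * cdf f x}

/-- The maximizers of `(t - s) (1 - F(t))`. -/
def rightMax (b : ℝ) (f : ℝ → ℝ) (s : ℝ) : Set ℝ :=
  {y | y ∈ Icc 0 b ∧ ∀ t ∈ Icc 0 b, (t - s) * (1 - cdf f t) ≤ (y - s) * (1 - cdf f y)}

lemma isCompact_argmax {g : ℝ → ℝ} {b : ℝ} (hb : 0 ≤ b) (hg : ContinuousOn g (Icc 0 b)) :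
    IsCompact {x | x ∈ Icc 0 b ∧ ∀ t ∈ Icc 0 b, g t ≤ g x} ∧
      {x | x ∈ Icc 0 b ∧ ∀ t ∈ Icc 0 b, g t ≤ g x}.Nonempty := by
  obtain ⟨x₀, hx₀, hmax⟩ := isCompact_Icc.exists_isMaxOn (nonempty_Icc.2 hb) hg
  have : {x | x ∈ Icc 0 b ∧ ∀ t ∈ Icc 0 b, g t ≤ g x} = Icc 0 b ∩ g ⁻¹' Ici (g x₀) := by
    ext x
    exact and_congr_right fun hx => ⟨fun h => h x₀ hx₀, fun h t ht => (hmax ht).trans h⟩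
  refine ⟨?_, x₀, hx₀, fun t ht => hmax ht⟩
  rw [this]
  exact isCompact_Icc.of_isClosed_subset (hg.preimage_isClosed_of_isClosed isClosed_Icc isClosed_Ici)
    inter_subset_left

/-- The type `ts` has ironed value `s`; the maximizers of `(s - t) F(t)` have extreme points `x₁`,
`x₂` and those of `(t - s) (1 - F(t))` have extreme points `y₁`, `y₂`. -/
structure IsPivot (b : ℝ) (f : ℝ → ℝ) (s ts x₁ x₂ y₁ y₂ : ℝ) : Prop where
  density : IsTypeDensity b f
  slope_mem : s ∈ Icc 0 b
  x₁_least : IsLeast (leftMax b f s) x₁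
  x₂_greatest : IsGreatest (leftMax b f s) x₂
  y₁_least : IsLeast (rightMax b f s) y₁
  y₂_greatest : IsGreatest (rightMax b f s) y₂
  eq_type : ts = s + (y₁ - s) * (1 - cdf f y₁) - (s - x₁) * cdf f x₁

namespace IsTypeDensity

variable {b : ℝ} {f : ℝ → ℝ} (hf : IsTypeDensity b f)
include hf

lemma leftMax_compact (s : ℝ) : IsCompact (leftMax b f s) ∧ (leftMax b f s).Nonempty :=
  isCompact_argmax (g := fun t => (s - t) * cdf f t) hf.pos_b.le
    ((continuousOn_const.sub continuousOn_id).mul hf.continuousOn_cdf)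

lemma rightMax_compact (s : ℝ) : IsCompact (rightMax b f s) ∧ (rightMax b f s).Nonempty :=
  isCompact_argmax (g := fun t => (t - s) * (1 - cdf f t)) hf.pos_b.le
    ((continuousOn_id.sub continuousOn_const).mul (continuousOn_const.sub hf.continuousOn_cdf))

lemma exists_isPivot {s : ℝ} (hs : s ∈ Icc 0 b) : ∃ ts x₁ x₂ y₁ y₂, IsPivot b f s ts x₁ x₂ y₁ y₂ := by
  obtain ⟨x₁, hx₁⟩ := (hf.leftMax_compact s).1.exists_isLeast (hf.leftMax_compact s).2
  obtain ⟨x₂, hx₂⟩ := (hf.leftMax_compact s).1.exists_isGreatest (hf.leftMax_compact s).2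
  obtain ⟨y₁, hy₁⟩ := (hf.rightMax_compact s).1.exists_isLeast (hf.rightMax_compact s).2
  obtain ⟨y₂, hy₂⟩ := (hf.rightMax_compact s).1.exists_isGreatest (hf.rightMax_compact s).2
  exact ⟨_, x₁, x₂, y₁, y₂, hf, hs, hx₁, hx₂, hy₁, hy₂, rfl⟩

lemma le_of_mem_leftMax {s x : ℝ} (hs : s ∈ Icc 0 b) (hx : x ∈ leftMax b f s) : x ≤ s := by
  by_contra! h
  have h0 := hx.2 0 hf.zero_mem
  rw [hf.cdf_zero, mul_zero] at h0
  have := hf.cdf_pos ⟨hs.1.trans_lt h, hx.1.2⟩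
  nlinarith

lemma le_of_mem_rightMax {s y : ℝ} (hs : s ∈ Icc 0 b) (hy : y ∈ rightMax b f s) : s ≤ y := by
  by_contra! h
  have h0 := hy.2 b hf.b_mem
  rw [hf.cdf_b, sub_self, mul_zero] at h0
  have := hf.cdf_lt_one ⟨hy.1.1, h.trans_le hs.2⟩
  nlinarith

/-- Here `x ≤ s ≤ y`. If both were `s`, both maxima would be zero; but `b/2` gives a positive value
on the right when `s = 0`, and `s/2` gives one on the left when `s > 0`. -/
lemma leftMax_lt_rightMax {s x y : ℝ} (hs : s ∈ Icc 0 b) (hx : x ∈ leftMax b f s)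
    (hy : y ∈ rightMax b f s) : x < y := by
  have h1 := hf.le_of_mem_leftMax hs hx
  have h2 := hf.le_of_mem_rightMax hs hy
  refine (h1.trans h2).lt_of_ne fun hxy => ?_
  have e1 : x = s := le_antisymm h1 (hxy ▸ h2)
  have e2 : y = s := hxy ▸ e1
  have hb := hf.pos_b
  rcases hs.1.eq_or_lt with h | h
  · have h3 := hy.2 (b / 2) ⟨by linarith, by linarith⟩
    have := hf.cdf_lt_one (t := b / 2) ⟨by linarith, by linarith⟩
    rw [e2, ← h] at h3
    nlinarith
  · have h3 := hx.2 (s / 2) ⟨by linarith, by linarith [hs.2]⟩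
    have := hf.cdf_pos (t := s / 2) ⟨by linarith, by linarith [hs.2]⟩
    rw [e1] at h3
    nlinarith

end IsTypeDensity

namespace IsPivot

variable {b : ℝ} {f : ℝ → ℝ} {s ts x₁ x₂ y₁ y₂ : ℝ} (hp : IsPivot b f s ts x₁ x₂ y₁ y₂)
include hp

lemma x₁_mem : x₁ ∈ Icc 0 b := hp.x₁_least.1.1
lemma x₂_mem : x₂ ∈ Icc 0 b := hp.x₂_greatest.1.1
lemma y₁_mem : y₁ ∈ Icc 0 b := hp.y₁_least.1.1
lemma y₂_mem : y₂ ∈ Icc 0 b := hp.y₂_greatest.1.1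
lemma x₁_le_x₂ : x₁ ≤ x₂ := hp.x₁_least.2 hp.x₂_greatest.1
lemma y₁_le_y₂ : y₁ ≤ y₂ := hp.y₁_least.2 hp.y₂_greatest.1

/-- The value of `t*` depends only on the two maxima, so any pair of maximizers may stand in for
`x₁` and `y₁`. -/
lemma eq_type' {x y : ℝ} (hx : x ∈ leftMax b f s) (hy : y ∈ rightMax b f s) :
    ts = s + (y - s) * (1 - cdf f y) - (s - x) * cdf f x := by
  rw [hp.eq_type]
  have h1 := hx.2 x₁ hp.x₁_mem
  have h2 := hp.x₁_least.1.2 x hx.1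
  have h3 := hy.2 y₁ hp.y₁_mem
  have h4 := hp.y₁_least.1.2 y hy.1
  linarith

/-- By `eq_type'`, `ts - x` is the amount by which `x` falls short of the maximum of `(t - s)(1 -
F(t))`. It is positive since `x` cannot maximize both functions. -/
lemma lt_type {x : ℝ} (hx : x ∈ leftMax b f s) : x < ts := by
  have hts := hp.eq_type' hx hp.y₁_least.1
  have h := hp.y₁_least.1.2 x hx.1
  refine lt_of_le_of_ne (by nlinarith) fun he => ?_
  have hxr : x ∈ rightMax b f s := ⟨hx.1, fun t ht => (hp.y₁_least.1.2 t ht).trans (by nlinarith)⟩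
  exact lt_irrefl x (hp.density.leftMax_lt_rightMax hp.slope_mem hx hxr)

lemma type_lt {y : ℝ} (hy : y ∈ rightMax b f s) : ts < y := by
  have hts := hp.eq_type' hp.x₁_least.1 hy
  have h := hp.x₁_least.1.2 y hy.1
  refine lt_of_le_of_ne (by nlinarith) fun he => ?_
  have hyl : y ∈ leftMax b f s := ⟨hy.1, fun t ht => (hp.x₁_least.1.2 t ht).trans (by nlinarith)⟩
  exact lt_irrefl y (hp.density.leftMax_lt_rightMax hp.slope_mem hyl hy)

lemma x₂_lt : x₂ < ts := hp.lt_type hp.x₂_greatest.1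
lemma lt_y₁ : ts < y₁ := hp.type_lt hp.y₁_least.1
lemma type_mem_Ioo : ts ∈ Ioo 0 b :=
  ⟨hp.x₂_mem.1.trans_lt hp.x₂_lt, hp.lt_y₁.trans_le hp.y₁_mem.2⟩
lemma type_mem : ts ∈ Icc 0 b := Ioo_subset_Icc_self hp.type_mem_Ioo

/-- Keeps the second branch of `H` nonnegative, so that zero is a convex minorant and `φ(0) = 0`.
The maximizer inequality at `t` is used for `t` right of `x₁`, and the one at `x₁` otherwise. -/
lemma mul_one_sub_cdf_le {t : ℝ} (ht : t ∈ Icc 0 b) : t * (1 - cdf f t) ≤ ts := by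
  have hx := hp.x₁_least.1
  rw [hp.eq_type]
  rcases le_total x₁ t with h | h
  · have h1 := hp.density.strictMonoOn_cdf.monotoneOn hx.1 ht h
    have h2 := hp.y₁_least.1.2 t ht
    have h3 := hp.density.le_of_mem_leftMax hp.slope_mem hx
    have h4 := (hp.density.cdf_mem hx.1).1
    nlinarith [mul_nonneg hx.1.1 h4, mul_le_mul_of_nonneg_left h1 hp.slope_mem.1]
  · have h2 := hp.y₁_least.1.2 x₁ hx.1
    have h4 := (hp.density.cdf_mem ht).1
    nlinarith [mul_nonneg ht.1 h4]

/-- The mirror bound: the line of slope `b` through `(1, t*)` stays below the first branch of `H`,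
which yields `φ(b) = b`. -/
lemma mul_cdf_le {t : ℝ} (ht : t ∈ Icc 0 b) : (b - t) * cdf f t ≤ b - ts := by
  have hy := hp.y₁_least.1
  rw [hp.eq_type]
  have hs := hp.slope_mem
  rcases le_total t y₁ with h | h
  · have h1 := hp.density.strictMonoOn_cdf.monotoneOn ht hy.1 h
    have h2 := hp.x₁_least.1.2 t ht
    have h4 := (hp.density.cdf_mem hy.1).2
    nlinarith [mul_nonneg (sub_nonneg.2 hy.1.2) (sub_nonneg.2 h4),
      mul_le_mul_of_nonneg_left h1 (sub_nonneg.2 hs.2)]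
  · have h2 := hp.x₁_least.1.2 y₁ hy.1
    have h4 := (hp.density.cdf_mem ht).2
    nlinarith [mul_nonneg (sub_nonneg.2 ht.2) (sub_nonneg.2 h4)]

/-- The supporting line of slope `s` lies below `H`. -/
lemma line_le {t : ℝ} (ht : t ∈ Icc 0 b) :
    -((s - x₁) * cdf f x₁) + s * cdf f t ≤ HFun b f ts (cdf f t) := by
  rw [hp.density.HFun_cdf hp.type_mem ht, hp.eq_type]
  have h1 := hp.x₁_least.1.2 t ht
  have h2 := hp.y₁_least.1.2 t ht
  refine le_min ?_ ?_ <;> nlinarith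

lemma mem_of_line_eq {t : ℝ} (ht : t ∈ Icc 0 b)
    (h : -((s - x₁) * cdf f x₁) + s * cdf f t = HFun b f ts (cdf f t)) :
    t ∈ leftMax b f s ∨ t ∈ rightMax b f s := by
  rw [hp.density.HFun_cdf hp.type_mem ht] at h
  rcases min_choice (t * cdf f t) (ts - t * (1 - cdf f t)) with hc | hc <;> rw [hc] at h
  · exact Or.inl ⟨ht, fun t' ht' => (hp.x₁_least.1.2 t' ht').trans (by linarith)⟩
  · rw [hp.eq_type] at h
    exact Or.inr ⟨ht, fun t' ht' => (hp.y₁_least.1.2 t' ht').trans (by linarith)⟩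

lemma line_eq_left {x : ℝ} (hx : x ∈ leftMax b f s) :
    -((s - x₁) * cdf f x₁) + s * cdf f x = HFun b f ts (cdf f x) := by
  refine le_antisymm (hp.line_le hx.1) ?_
  rw [hp.density.HFun_cdf hp.type_mem hx.1]
  have h := hx.2 x₁ hp.x₁_mem
  exact (min_le_left _ _).trans (by linarith)

lemma line_eq_right {y : ℝ} (hy : y ∈ rightMax b f s) :
    -((s - x₁) * cdf f x₁) + s * cdf f y = HFun b f ts (cdf f y) := by
  refine le_antisymm (hp.line_le hy.1) ?_
  rw [hp.density.HFun_cdf hp.type_mem hy.1]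
  have h := hp.eq_type' hp.x₁_least.1 hy
  exact (min_le_right _ _).trans (by linarith)

/-! ### The convex hull of `H` -/

lemma continuousOn_HFun : ContinuousOn (HFun b f ts) (Icc 0 1) :=
  hp.density.continuousOn_HFun hp.type_mem

omit hp in
lemma HIr_eq : HIr b f ts = envelope (HFun b f ts) := rfl

lemma convexOn_HIr : ConvexOn ℝ (Icc 0 1) (HIr b f ts) := convexOn_envelope hp.continuousOn_HFun

lemma HIr_le {z : ℝ} (hz : z ∈ Icc (0 : ℝ) 1) : HIr b f ts z ≤ HFun b f ts z :=
  envelope_le hp.continuousOn_HFun hz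

lemma HIr_le_left {z : ℝ} (hz : z ∈ Icc (0 : ℝ) 1) : HIr b f ts z ≤ quantile b f z * z :=
  (hp.HIr_le hz).trans (by
    rw [hp.density.HFun_eq hp.type_mem hz]; exact min_le_left _ _)

lemma HIr_le_right {z : ℝ} (hz : z ∈ Icc (0 : ℝ) 1) :
    HIr b f ts z ≤ ts - quantile b f z * (1 - z) :=
  (hp.HIr_le hz).trans (by
    rw [hp.density.HFun_eq hp.type_mem hz]; exact min_le_right _ _)

lemma line_le' {z : ℝ} (hz : z ∈ Icc (0 : ℝ) 1) :
    -((s - x₁) * cdf f x₁) + s * z ≤ HFun b f ts z := by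
  have := hp.line_le (hp.density.quantile_mem hz)
  rwa [hp.density.cdf_quantile hz] at this

lemma line_le_HIr {z : ℝ} (hz : z ∈ Icc (0 : ℝ) 1) :
    -((s - x₁) * cdf f x₁) + s * z ≤ HIr b f ts z :=
  le_envelope (convexOn_affine _ (convex_Icc 0 1) _ _) (fun _ hx => hp.line_le' hx) hz

lemma HIr_nonneg {z : ℝ} (hz : z ∈ Icc (0 : ℝ) 1) : 0 ≤ HIr b f ts z := by
  refine le_envelope (convexOn_const 0 (convex_Icc 0 1)) (fun x hx => ?_) hz
  rw [hp.density.HFun_eq hp.type_mem hx]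
  have hq := hp.density.quantile_mem hx
  have := hp.mul_one_sub_cdf_le hq
  rw [hp.density.cdf_quantile hx] at this
  exact le_min (mul_nonneg hq.1 hx.1) (by linarith)

lemma le_HIr_right {z : ℝ} (hz : z ∈ Icc (0 : ℝ) 1) : (ts - b) + b * z ≤ HIr b f ts z := by
  refine le_envelope (convexOn_affine _ (convex_Icc 0 1) _ _) (fun x hx => ?_) hz
  rw [hp.density.HFun_eq hp.type_mem hx]
  have hq := hp.density.quantile_mem hx
  have := hp.mul_cdf_le hq
  rw [hp.density.cdf_quantile hx] at this
  refine le_min (by nlinarith) ?_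
  nlinarith [mul_nonneg (sub_nonneg.2 hq.2) (sub_nonneg.2 hx.2)]

lemma HIr_zero : HIr b f ts 0 = 0 := by
  have h0 : (0 : ℝ) ∈ Icc (0 : ℝ) 1 := left_mem_Icc.2 zero_le_one
  refine le_antisymm ?_ (hp.HIr_nonneg h0)
  simpa using hp.HIr_le_left h0

lemma HIr_one : HIr b f ts 1 = ts := by
  have h1 : (1 : ℝ) ∈ Icc (0 : ℝ) 1 := right_mem_Icc.2 zero_le_one
  refine le_antisymm ?_ ?_
  · simpa using hp.HIr_le_right h1
  · simpa using hp.le_HIr_right h1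

/-- The hull lies between `0` and `F⁻¹(z) z`, and `F⁻¹(z)` tends to zero. No lower bound on the
density at the endpoint is needed. -/
lemma hasDerivWithinAt_HIr_zero : HasDerivWithinAt (HIr b f ts) 0 (Icc 0 1) 0 := by
  have h0 : (0 : ℝ) ∈ Icc (0 : ℝ) 1 := left_mem_Icc.2 zero_le_one
  rw [hasDerivWithinAt_iff_isLittleO]
  have hq : (fun z => quantile b f z) =o[nhdsWithin 0 (Icc 0 1)] fun _ => (1 : ℝ) := by
    rw [Asymptotics.isLittleO_one_iff]
    have := hp.density.continuousOn_quantile 0 h0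
    rwa [ContinuousWithinAt, hp.density.quantile_zero] at this
  have h1 : (fun z => quantile b f z * (z - 0)) =o[nhdsWithin 0 (Icc 0 1)] fun z => z - 0 := by
    simpa using hq.mul_isBigO (Asymptotics.isBigO_refl (fun z : ℝ => z - 0) _)
  refine (Asymptotics.IsBigO.of_bound 1 ?_).trans_isLittleO h1
  filter_upwards [self_mem_nhdsWithin] with z hz
  rw [hp.HIr_zero, smul_zero, sub_zero, sub_zero, sub_zero, one_mul, Real.norm_eq_abs,
    Real.norm_eq_abs, abs_of_nonneg (hp.HIr_nonneg hz),
    abs_of_nonneg (mul_nonneg (hp.density.quantile_mem hz).1 hz.1)]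
  exact hp.HIr_le_left hz

lemma hasDerivWithinAt_HIr_one : HasDerivWithinAt (HIr b f ts) b (Icc 0 1) 1 := by
  have h1 : (1 : ℝ) ∈ Icc (0 : ℝ) 1 := right_mem_Icc.2 zero_le_one
  rw [hasDerivWithinAt_iff_isLittleO]
  have hq : (fun z => quantile b f z - b) =o[nhdsWithin 1 (Icc 0 1)] fun _ => (1 : ℝ) := by
    rw [Asymptotics.isLittleO_one_iff]
    have := Filter.Tendsto.sub_const (hp.density.continuousOn_quantile 1 h1) b
    rwa [hp.density.quantile_one, sub_self] at this
  have h2 : (fun z => (quantile b f z - b) * (z - 1)) =o[nhdsWithin 1 (Icc 0 1)] fun z => z - 1 := by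
    simpa using hq.mul_isBigO (Asymptotics.isBigO_refl (fun z : ℝ => z - 1) _)
  refine (Asymptotics.IsBigO.of_bound 1 ?_).trans_isLittleO h2
  filter_upwards [self_mem_nhdsWithin] with z hz
  have hqz := (hp.density.quantile_mem hz).2
  have e1 := hp.le_HIr_right hz
  have e2 := hp.HIr_le_right hz
  rw [hp.HIr_one, smul_eq_mul, one_mul, Real.norm_eq_abs,
    Real.norm_eq_abs, abs_of_nonneg (by linarith),
    abs_of_nonneg (mul_nonneg_of_nonpos_of_nonpos (by linarith) (by linarith [hz.2]))]
  nlinarith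

/-- The hull lies below the whole first branch, not just below `H`, so contact with that smooth
branch determines its derivative and the kink of `H` at `t*` does no harm. -/
lemma hasDerivAt_of_touches_left {t : ℝ} (ht : t ∈ Ioo 0 b) (htouch : Touches b f ts t)
    (hle : t ≤ ts) : HasDerivAt (HIr b f ts) (t + cdf f t / f t) (cdf f t) := by
  have htI := Ioo_subset_Icc_self ht
  have hd : HasDerivAt (fun z => quantile b f z * z) ((f t)⁻¹ * cdf f t + quantile b f (cdf f t) * 1)
      (cdf f t) := (hp.density.hasDerivAt_quantile ht).mul (hasDerivAt_id _)
  rw [hp.density.quantile_cdf htI] at hd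
  have := hasDerivAt_of_le hp.convexOn_HIr (hp.density.cdf_mem_Ioo ht) hd
    (fun z hz => hp.HIr_le_left hz) (by
      rw [htouch, hp.density.HFun_cdf hp.type_mem htI, hp.density.quantile_cdf htI,
        min_eq_left (by linarith)])
  convert this using 1
  ring

lemma hasDerivAt_of_touches_right {t : ℝ} (ht : t ∈ Ioo 0 b) (htouch : Touches b f ts t)
    (hle : ts ≤ t) : HasDerivAt (HIr b f ts) (t - (1 - cdf f t) / f t) (cdf f t) := by
  have htI := Ioo_subset_Icc_self ht
  have hd : HasDerivAt (fun z => ts - quantile b f z * (1 - z))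
      (-((f t)⁻¹ * (1 - cdf f t) + quantile b f (cdf f t) * (-1))) (cdf f t) :=
    ((hp.density.hasDerivAt_quantile ht).mul ((hasDerivAt_id _).const_sub 1)).const_sub ts
  rw [hp.density.quantile_cdf htI] at hd
  have := hasDerivAt_of_le hp.convexOn_HIr (hp.density.cdf_mem_Ioo ht) hd
    (fun z hz => hp.HIr_le_right hz) (by
      rw [htouch, hp.density.HFun_cdf hp.type_mem htI, hp.density.quantile_cdf htI,
        min_eq_right (by linarith)])
  convert this using 1
  ring

lemma touches_zero : Touches b f ts 0 := by
  have h := hp.density.HFun_cdf hp.type_mem hp.density.zero_mem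
  rw [hp.density.cdf_zero] at h
  rw [Touches, hp.density.cdf_zero, hp.HIr_zero, h]
  simp [hp.type_mem.1]

lemma touches_b : Touches b f ts b := by
  have h := hp.density.HFun_cdf hp.type_mem hp.density.b_mem
  rw [hp.density.cdf_b] at h
  rw [Touches, hp.density.cdf_b, hp.HIr_one, h]
  simp [hp.type_mem.2]

/-- The convex hull is affine around a type at which it does not touch `H`. -/
lemma exists_gap {t : ℝ} (ht : t ∈ Icc 0 b) (hn : ¬ Touches b f ts t) :
    ∃ m c, ∃ l ∈ Ico 0 t, ∃ r ∈ Ioc t b, Touches b f ts l ∧ Touches b f ts r ∧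
      ∀ x ∈ Icc (cdf f l) (cdf f r), HIr b f ts x = c + m * x := by
  have h0 : t ≠ 0 := fun h => hn (h ▸ hp.touches_zero)
  have h1 : t ≠ b := fun h => hn (h ▸ hp.touches_b)
  have ht' : t ∈ Ioo 0 b := ⟨ht.1.lt_of_ne' h0, ht.2.lt_of_ne h1⟩
  have hz := hp.density.cdf_mem_Ioo ht'
  obtain ⟨m, l, hl, r, hr, hKl, hKr, haff, -⟩ := exists_contact hp.continuousOn_HFun hz
  have hl01 : l ∈ Icc (0 : ℝ) 1 := ⟨hl.1, hl.2.trans hz.2.le⟩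
  have hr01 : r ∈ Icc (0 : ℝ) 1 := ⟨hz.1.le.trans hr.1, hr.2⟩
  have el := hp.density.cdf_quantile hl01
  have er := hp.density.cdf_quantile hr01
  have hlt : l < cdf f t := lt_of_le_of_ne hl.2 fun h => hn (by
    rw [Touches, ← h]; exact hKl)
  have htr : cdf f t < r := lt_of_le_of_ne hr.1 fun h => hn (by
    rw [Touches, h]; exact hKr)
  refine ⟨m, HIr b f ts (cdf f t) - m * cdf f t, quantile b f l,
    ⟨(hp.density.quantile_mem hl01).1, ?_⟩, quantile b f r,
    ⟨?_, (hp.density.quantile_mem hr01).2⟩, ?_, ?_, fun x hx => ?_⟩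
  · rwa [← hp.density.strictMonoOn_cdf.lt_iff_lt (hp.density.quantile_mem hl01) ht, el]
  · rwa [← hp.density.strictMonoOn_cdf.lt_iff_lt ht (hp.density.quantile_mem hr01), er]
  · rw [Touches, el]; exact hKl
  · rw [Touches, er]; exact hKr
  · rw [el, er] at hx
    rw [HIr_eq, haff x hx]
    ring

/-- At touching types the hull inherits the derivative of a branch; around all other types it is
affine. -/
lemma differentiableAt_HIr {t : ℝ} (ht : t ∈ Ioo 0 b) :
    DifferentiableAt ℝ (HIr b f ts) (cdf f t) := by
  by_cases hn : Touches b f ts t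
  · rcases le_total t ts with h | h
    · exact (hp.hasDerivAt_of_touches_left ht hn h).differentiableAt
    · exact (hp.hasDerivAt_of_touches_right ht hn h).differentiableAt
  · have htI := Ioo_subset_Icc_self ht
    obtain ⟨m, c, l, hl, r, hr, -, -, haff⟩ := hp.exists_gap htI hn
    have h1 := hp.density.strictMonoOn_cdf ⟨hl.1, hl.2.le.trans htI.2⟩ htI hl.2
    have h2 := hp.density.strictMonoOn_cdf htI ⟨htI.1.trans hr.1.le, hr.2⟩ hr.1
    have hd : DifferentiableAt ℝ (fun x => c + m * x) (cdf f t) := by fun_prop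
    refine hd.congr_of_eventuallyEq ?_
    filter_upwards [Icc_mem_nhds h1 h2] with x hx using haff x hx

lemma differentiableOn_HIr : DifferentiableOn ℝ (HIr b f ts) (Icc 0 1) := by
  intro z hz
  rcases hz.1.eq_or_lt with rfl | h0
  · exact hp.hasDerivWithinAt_HIr_zero.differentiableWithinAt
  rcases hz.2.eq_or_lt with rfl | h1
  · exact hp.hasDerivWithinAt_HIr_one.differentiableWithinAt
  obtain ⟨t, ht, rfl⟩ := hp.density.exists_cdf_eq hz
  refine (hp.differentiableAt_HIr ⟨ht.1.lt_of_ne ?_, ht.2.lt_of_ne ?_⟩).differentiableWithinAt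
  · rintro rfl; exact h0.ne' hp.density.cdf_zero
  · rintro rfl; exact h1.ne hp.density.cdf_b

end IsPivot

end TwoItemAuction

end

/-! ### The ironed virtual value: regularity and level sets -/

noncomputable section

namespace TwoItemAuction

/-- A monotone function that follows a differentiable function on a set and is constant on the gaps
of this set has a right derivative. -/
lemma hasDerivWithinAt_of_gaps {φ ψ : ℝ → ℝ} {t b m : ℝ} {T : Set ℝ} (htb : t < b)
    (hcont : ContinuousWithinAt φ (Ioi t) t) (hlt : ∀ x ∈ Ioc t b, φ t < φ x)
    (hψ : HasDerivAt ψ m t) (heq : φ t = ψ t)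
    (hT : ∀ᶠ x in nhdsWithin t (Ioi t), x ∈ T → φ x = ψ x)
    (hgap : ∀ x ∈ Ioo t b, x ∉ T →
      ∃ l < x, ∃ r > x, l ∈ T ∧ r ∈ T ∧ ∀ y ∈ Icc l r, φ y = φ x) :
    HasDerivWithinAt φ m (Ioi t) t := by
  rw [hasDerivWithinAt_iff_isLittleO, Asymptotics.isLittleO_iff]
  rw [hasDerivAt_iff_isLittleO, Asymptotics.isLittleO_iff] at hψ
  intro ε hε
  have h1 : ∀ᶠ x in nhdsWithin t (Ioi t), (x ∈ T → φ x = ψ x) ∧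
      ‖ψ x - ψ t - (x - t) • m‖ ≤ ε * ‖x - t‖ := hT.and ((hψ hε).filter_mono nhdsWithin_le_nhds)
  obtain ⟨w, hw, hw2⟩ := (mem_nhdsGT_iff_exists_Ioo_subset' htb).1 h1
  obtain ⟨p, hp1, hp2⟩ := exists_between (lt_min hw htb)
  have hpw := hp2.trans_le (min_le_left _ _)
  have hpb := hp2.trans_le (min_le_right _ _)
  have hφp : ∀ᶠ x in nhdsWithin t (Ioi t), φ x < φ p :=
    hcont.eventually (gt_mem_nhds (hlt p ⟨hp1, hpb.le⟩))
  have key : ∀ x ∈ Ioo t p, x ∈ T → φ t < ψ x ∧ φ x = ψ x ∧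
      -(ε * (x - t)) ≤ ψ x - ψ t - (x - t) * m ∧ ψ x - ψ t - (x - t) * m ≤ ε * (x - t) := by
    intro x hx hxT
    obtain ⟨h2, h3⟩ := hw2 (⟨hx.1, hx.2.trans hpw⟩ : x ∈ Ioo t w)
    rw [Real.norm_eq_abs, Real.norm_eq_abs, smul_eq_mul, abs_of_pos (sub_pos.2 hx.1), abs_le] at h3
    exact ⟨h2 hxT ▸ hlt x ⟨hx.1, (hx.2.trans hpb).le⟩, h2 hxT, h3⟩
  filter_upwards [hφp, Ioo_mem_nhdsGT hp1] with x hx1 hx2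
  rw [Real.norm_eq_abs, Real.norm_eq_abs, smul_eq_mul, abs_of_pos (sub_pos.2 hx2.1), abs_le]
  by_cases hxT : x ∈ T
  · obtain ⟨-, h2, h3⟩ := key x hx2 hxT
    rw [h2, heq]
    exact h3
  have hxt := hlt x ⟨hx2.1, (hx2.2.trans hpb).le⟩
  obtain ⟨l, hl, r, hr, hlT, hrT, hconst⟩ := hgap x ⟨hx2.1, hx2.2.trans hpb⟩ hxT
  -- If the gap reached `t` or `p`, then `φ x` would equal `φ t` or `φ p`, against `φ t < φ x < φ
  -- p`. So the gap lies inside the region controlled by `ψ`.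
  have htl : t < l := by
    by_contra! h
    exact hxt.ne (hconst t ⟨h, (hx2.1.trans hr).le⟩)
  have hrp : r < p := by
    by_contra! h
    exact hx1.ne' (hconst p ⟨(hl.trans hx2.2).le, h⟩)
  obtain ⟨l1, l2, -, l3⟩ := key l ⟨htl, hl.trans hx2.2⟩ hlT
  obtain ⟨r1, r2, r3, -⟩ := key r ⟨hx2.1.trans hr, hrp⟩ hrT
  have hlr := hl.trans hr
  have el : φ x = ψ l := by rw [← l2, hconst l ⟨le_rfl, hlr.le⟩]
  have er : φ x = ψ r := by rw [← r2, hconst r ⟨hlr.le, le_rfl⟩]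
  rw [heq] at l1 r1 hxt
  rw [heq]
  -- On the gap `φ x = ψ l = ψ r`. The right end gives the lower estimate and the left end the upper
  -- one; the signs needed to compare `r - t` and `l - t` with `x - t` come from `ψ` exceeding `ψ t`
  -- at both ends.
  constructor
  · rw [er]
    rcases le_total 0 (m - ε) with h | h
    · have := mul_le_mul_of_nonneg_left (sub_le_sub_right hr.le t) h
      nlinarith
    · have := mul_nonneg_of_nonpos_of_nonpos h (sub_nonpos.2 hx2.1.le)
      nlinarith
  · rw [el]
    have hm : 0 ≤ m + ε := by
      by_contra! hm
      have := mul_neg_of_neg_of_pos hm (sub_pos.2 htl)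
      nlinarith
    have := mul_le_mul_of_nonneg_left (sub_le_sub_right hl.le t) hm
    nlinarith

namespace IsPivot

variable {b : ℝ} {f : ℝ → ℝ} {s ts x₁ x₂ y₁ y₂ : ℝ} (hp : IsPivot b f s ts x₁ x₂ y₁ y₂)
include hp

/-! ### The ironed virtual value -/

lemma ironed_zero : ironedValue b f ts 0 = 0 := by
  rw [ironedValue, hp.density.cdf_zero]
  exact hp.hasDerivWithinAt_HIr_zero.derivWithin
    (uniqueDiffOn_Icc zero_lt_one 0 (left_mem_Icc.2 zero_le_one))

lemma ironed_b : ironedValue b f ts b = b := by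
  rw [ironedValue, hp.density.cdf_b]
  exact hp.hasDerivWithinAt_HIr_one.derivWithin
    (uniqueDiffOn_Icc zero_lt_one 1 (right_mem_Icc.2 zero_le_one))

lemma monotoneOn_ironed : MonotoneOn (ironedValue b f ts) (Icc 0 b) := fun _ hx _ hy hxy =>
  hp.convexOn_HIr.monotoneOn_derivWithin hp.differentiableOn_HIr (hp.density.cdf_mem hx)
    (hp.density.cdf_mem hy) (hp.density.strictMonoOn_cdf.monotoneOn hx hy hxy)

lemma ironed_mem {t : ℝ} (ht : t ∈ Icc 0 b) : ironedValue b f ts t ∈ Icc 0 b := by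
  have h0 := hp.monotoneOn_ironed hp.density.zero_mem ht ht.1
  have h1 := hp.monotoneOn_ironed ht hp.density.b_mem ht.2
  rw [hp.ironed_zero] at h0
  rw [hp.ironed_b] at h1
  exact ⟨h0, h1⟩

/-- A derivative has the intermediate value property (Darboux), and a monotone function without
jumps is continuous. The extension of slope one outside `[0,b]` makes the function onto the real
line, so that surjectivity can replace the absence of jumps. -/
lemma continuousOn_ironed : ContinuousOn (ironedValue b f ts) (Icc 0 b) := by
  set φ := ironedValue b f ts with hφ
  have hb := hp.density.pos_b
  have hmono : Monotone fun t => φ (clamp b t) + (t - clamp b t) := by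
    refine (monotone_comp_clamp hb.le hp.monotoneOn_ironed).add fun x y hxy => ?_
    simp only [clamp]
    rcases le_total b x with h1 | h1 <;> rcases le_total b y with h2 | h2 <;>
      rcases le_total 0 x with h3 | h3 <;> rcases le_total 0 y with h4 | h4 <;>
      simp [*, hb.le] <;> linarith
  have hsurj : Function.Surjective fun t => φ (clamp b t) + (t - clamp b t) := by
    intro y
    rcases lt_or_ge y 0 with h | h
    · refine ⟨y, ?_⟩
      have : clamp b y = 0 := by simp [clamp, h.le]
      simp only [this, hφ, hp.ironed_zero]; ring
    rcases lt_or_ge b y with h' | h'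
    · refine ⟨y, ?_⟩
      have : clamp b y = b := by simp [clamp, h'.le, hb.le]
      simp only [this, hφ, hp.ironed_b]; ring
    have hord := (ordConnected_Icc (a := (0 : ℝ)) (b := 1)).image_derivWithin
      hp.differentiableOn_HIr
    have hy : y ∈ derivWithin (HIr b f ts) (Icc 0 1) '' Icc 0 1 := by
      refine hord.out ⟨0, left_mem_Icc.2 zero_le_one, ?_⟩ ⟨1, right_mem_Icc.2 zero_le_one, ?_⟩ ⟨h, h'⟩
      · have := hp.ironed_zero
        rwa [ironedValue, hp.density.cdf_zero] at this
      · have := hp.ironed_b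
        rwa [ironedValue, hp.density.cdf_b] at this
    obtain ⟨z, hz, hzy⟩ := hy
    refine ⟨quantile b f z, ?_⟩
    simp only [clamp_of_mem (hp.density.quantile_mem hz), sub_self, add_zero, hφ, ironedValue,
      hp.density.cdf_quantile hz, hzy]
  refine (hmono.continuous_of_surjective hsurj).continuousOn.congr fun t ht => ?_
  simp [clamp_of_mem ht]

lemma ironed_eq_of_affine {l r m c t : ℝ} (hl : 0 ≤ l) (hr : r ≤ b) (hlr : l < r)
    (haff : ∀ x ∈ Icc (cdf f l) (cdf f r), HIr b f ts x = c + m * x) (ht : t ∈ Icc l r) :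
    ironedValue b f ts t = m := by
  have htI : t ∈ Icc 0 b := ⟨hl.trans ht.1, ht.2.trans hr⟩
  have hlI : l ∈ Icc 0 b := ⟨hl, hlr.le.trans hr⟩
  have hrI : r ∈ Icc 0 b := ⟨hl.trans hlr.le, hr⟩
  have hmono := hp.density.strictMonoOn_cdf
  have hz : cdf f t ∈ Icc (cdf f l) (cdf f r) :=
    ⟨hmono.monotoneOn hlI htI ht.1, hmono.monotoneOn htI hrI ht.2⟩
  have h1 := ((hp.differentiableOn_HIr _ (hp.density.cdf_mem htI)).hasDerivWithinAt).mono
    (Icc_subset_Icc (hp.density.cdf_mem hlI).1 (hp.density.cdf_mem hrI).2)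
  have h2 : HasDerivWithinAt (HIr b f ts) m (Icc (cdf f l) (cdf f r)) (cdf f t) := by
    refine HasDerivWithinAt.congr ?_ haff (haff _ hz)
    simpa using (((hasDerivAt_id (cdf f t)).const_mul m).const_add c).hasDerivWithinAt
  exact (uniqueDiffOn_Icc (hmono hlI hrI hlr) _ hz).eq_deriv _ h1 h2

lemma exists_gap' {t : ℝ} (ht : t ∈ Icc 0 b) (hn : ¬ Touches b f ts t) :
    ∃ l ∈ Ico 0 t, ∃ r ∈ Ioc t b, Touches b f ts l ∧ Touches b f ts r ∧
      ∀ x ∈ Icc l r, ironedValue b f ts x = ironedValue b f ts t := by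
  obtain ⟨m, c, l, hl, r, hr, h1, h2, haff⟩ := hp.exists_gap ht hn
  refine ⟨l, hl, r, hr, h1, h2, fun x hx => ?_⟩
  have hlr := hl.2.trans hr.1
  rw [hp.ironed_eq_of_affine hl.1 hr.2 hlr haff hx,
    hp.ironed_eq_of_affine hl.1 hr.2 hlr haff ⟨hl.2.le, hr.1.le⟩]

lemma ironed_eq_deriv {t : ℝ} (ht : t ∈ Ioo 0 b) :
    ironedValue b f ts t = deriv (HIr b f ts) (cdf f t) := by
  have hz := hp.density.cdf_mem_Ioo ht
  exact derivWithin_of_mem_nhds (Icc_mem_nhds hz.1 hz.2)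

lemma ironed_of_touches_left {t : ℝ} (ht : t ∈ Ioo 0 b) (htouch : Touches b f ts t)
    (hle : t ≤ ts) : ironedValue b f ts t = t + cdf f t / f t := by
  rw [hp.ironed_eq_deriv ht, (hp.hasDerivAt_of_touches_left ht htouch hle).deriv]

lemma ironed_of_touches_right {t : ℝ} (ht : t ∈ Ioo 0 b) (htouch : Touches b f ts t)
    (hle : ts ≤ t) : ironedValue b f ts t = t - (1 - cdf f t) / f t := by
  rw [hp.ironed_eq_deriv ht, (hp.hasDerivAt_of_touches_right ht htouch hle).deriv]

/-! ### The level set of the pivotal type -/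

lemma x₁_lt_y₂ : x₁ < y₂ := (hp.lt_type hp.x₁_least.1).trans (hp.type_lt hp.y₂_greatest.1)

/-- The supporting line bounds the hull from below; convexity between the contacts `x₁` and `y₂`
bounds it from above. -/
lemma HIr_eq_line {z : ℝ} (hz : z ∈ Icc (cdf f x₁) (cdf f y₂)) :
    HIr b f ts z = -((s - x₁) * cdf f x₁) + s * z := by
  have hx := hp.density.cdf_mem hp.x₁_mem
  have hy := hp.density.cdf_mem hp.y₂_mem
  refine le_antisymm ?_ (hp.line_le_HIr ⟨hx.1.trans hz.1, hz.2.trans hy.2⟩)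
  have h1 := hp.HIr_le hx
  have h2 := hp.HIr_le hy
  rw [← hp.line_eq_left hp.x₁_least.1] at h1
  rw [← hp.line_eq_right hp.y₂_greatest.1] at h2
  have hc := hp.convexOn_HIr.sub (g := fun z => -((s - x₁) * cdf f x₁) + s * z) (by
    refine ⟨convex_Icc 0 1, fun x _ y _ p q _ _ hpq => le_of_eq ?_⟩
    simp only [smul_eq_mul]
    linear_combination -((s - x₁) * cdf f x₁) * hpq)
  have h3 := hc.le_max_of_mem_Icc hx hy hz
  simp only [Pi.sub_apply] at h3
  have := h3.trans (max_le (sub_nonpos.2 h1) (sub_nonpos.2 h2))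
  linarith

lemma ironed_eq {t : ℝ} (ht : t ∈ Icc x₁ y₂) : ironedValue b f ts t = s :=
  hp.ironed_eq_of_affine hp.x₁_mem.1 hp.y₂_mem.2 hp.x₁_lt_y₂ (fun _ hx => hp.HIr_eq_line hx) ht

lemma type_mem_level : ts ∈ Icc x₁ y₂ :=
  ⟨(hp.lt_type hp.x₁_least.1).le, (hp.type_lt hp.y₂_greatest.1).le⟩

lemma ironed_type : ironedValue b f ts ts = s := hp.ironed_eq hp.type_mem_level

lemma mem_of_touches {t : ℝ} (ht : t ∈ Icc x₁ y₂) (htouch : Touches b f ts t) :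
    t ∈ leftMax b f s ∨ t ∈ rightMax b f s := by
  have htI : t ∈ Icc 0 b := ⟨hp.x₁_mem.1.trans ht.1, ht.2.trans hp.y₂_mem.2⟩
  have hmono := hp.density.strictMonoOn_cdf.monotoneOn
  refine hp.mem_of_line_eq htI ?_
  rw [← htouch, hp.HIr_eq_line ⟨hmono hp.x₁_mem htI ht.1, hmono htI hp.y₂_mem ht.2⟩]

lemma not_touches_type : ¬ Touches b f ts ts := fun h =>
  (hp.mem_of_touches hp.type_mem_level h).elim (fun h => lt_irrefl _ (hp.lt_type h))
    fun h => lt_irrefl _ (hp.type_lt h)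

lemma touches_left {x : ℝ} (hx : x ∈ leftMax b f s) : Touches b f ts x :=
  le_antisymm (hp.HIr_le (hp.density.cdf_mem hx.1))
    ((hp.line_eq_left hx).symm.trans_le (hp.line_le_HIr (hp.density.cdf_mem hx.1)))

lemma touches_right {y : ℝ} (hy : y ∈ rightMax b f s) : Touches b f ts y :=
  le_antisymm (hp.HIr_le (hp.density.cdf_mem hy.1))
    ((hp.line_eq_right hy).symm.trans_le (hp.line_le_HIr (hp.density.cdf_mem hy.1)))

lemma rightSplit_eq : rightSplit b f ts = y₁ := by
  refine IsLeast.csInf_eq ⟨⟨⟨hp.lt_y₁.le, hp.y₁_mem.2⟩, hp.touches_right hp.y₁_least.1⟩, ?_⟩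
  rintro t ⟨ht, htouch⟩
  by_contra! h
  rcases hp.mem_of_touches ⟨hp.type_mem_level.1.trans ht.1, h.le.trans hp.y₁_le_y₂⟩ htouch with h' | h'
  · exact absurd (hp.lt_type h') (not_lt.2 ht.1)
  · exact absurd (hp.y₁_least.2 h') (not_le.2 h)

lemma leftSplit_eq : leftSplit b f ts = x₂ := by
  refine IsGreatest.csSup_eq ⟨⟨⟨hp.x₂_mem.1, hp.x₂_lt.le⟩, hp.touches_left hp.x₂_greatest.1⟩, ?_⟩
  rintro t ⟨ht, htouch⟩
  by_contra! h
  rcases hp.mem_of_touches ⟨hp.x₁_le_x₂.trans h.le, ht.2.trans hp.type_mem_level.2⟩ htouch with h' | h'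
  · exact absurd (hp.x₂_greatest.2 h') (not_le.2 h)
  · exact absurd (hp.type_lt h') (not_lt.2 ht.2)

/-- No contact with the line lies beyond `y₂`, so by `affine_lt_envelope_right` the hull is strictly
above the line there. The chord from `y₂` then has slope above `s`, and the derivative at its right
end is at least as large. -/
lemma lt_ironed {t : ℝ} (ht : t ∈ Ioc y₂ b) : s < ironedValue b f ts t := by
  have hmono := hp.density.strictMonoOn_cdf
  have hy := hp.y₂_mem
  have htI : t ∈ Icc 0 b := ⟨hy.1.trans ht.1.le, ht.2⟩
  obtain ⟨w, hw1, hw2⟩ := exists_between ht.1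
  have hwI : w ∈ Icc 0 b := ⟨hy.1.trans hw1.le, hw2.le.trans ht.2⟩
  have h1 := affine_lt_envelope_right hp.continuousOn_HFun (w := cdf f w) (z := cdf f t)
    (hp.density.cdf_mem hwI) (fun x hx => hp.line_le' hx) (fun x hx => ?_)
    ⟨hmono hwI htI hw2, (hp.density.cdf_mem htI).2⟩
  · have hyF := hp.density.cdf_mem hy
    have htF := hp.density.cdf_mem htI
    have hlt := hmono hy htI ht.1
    have h2 := hp.convexOn_HIr.slope_le_derivWithin hyF htF hlt (hp.differentiableOn_HIr _ htF)
    refine lt_of_lt_of_le ?_ h2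
    rw [slope_def_field, lt_div_iff₀ (sub_pos.2 hlt),
      hp.HIr_eq_line (right_mem_Icc.2 (hmono.monotoneOn hp.x₁_mem hy hp.x₁_lt_y₂.le)), HIr_eq]
    linarith
  · obtain ⟨x', hx', rfl⟩ := hp.density.exists_cdf_eq
      (z := x) ⟨(hp.density.cdf_mem hwI).1.trans hx.1, hx.2⟩
    have hwx : w ≤ x' := (hmono.le_iff_le hwI hx').1 hx.1
    refine lt_of_le_of_ne (hp.line_le hx') fun he => ?_
    rcases hp.mem_of_line_eq hx' he with h | h
    · exact absurd ((hp.lt_type h).trans (hp.type_lt hp.y₂_greatest.1))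
        (not_lt.2 (hw1.le.trans hwx))
    · exact absurd (hp.y₂_greatest.2 h) (not_le.2 (hw1.trans_le hwx))

lemma ironed_lt {t : ℝ} (ht : t ∈ Ico 0 x₁) : ironedValue b f ts t < s := by
  have hmono := hp.density.strictMonoOn_cdf
  have hy := hp.x₁_mem
  have htI : t ∈ Icc 0 b := ⟨ht.1, ht.2.le.trans hy.2⟩
  obtain ⟨w, hw1, hw2⟩ := exists_between ht.2
  have hwI : w ∈ Icc 0 b := ⟨ht.1.trans hw1.le, hw2.le.trans hy.2⟩
  have h1 := affine_lt_envelope_left hp.continuousOn_HFun (w := cdf f w) (z := cdf f t)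
    (hp.density.cdf_mem hwI) (fun x hx => hp.line_le' hx) (fun x hx => ?_)
    ⟨(hp.density.cdf_mem htI).1, hmono htI hwI hw1⟩
  · have hyF := hp.density.cdf_mem hy
    have htF := hp.density.cdf_mem htI
    have hlt := hmono htI hy ht.2
    have h2 := hp.convexOn_HIr.derivWithin_le_slope htF hyF hlt (hp.differentiableOn_HIr _ htF)
    refine lt_of_le_of_lt h2 ?_
    rw [slope_def_field, div_lt_iff₀ (sub_pos.2 hlt),
      hp.HIr_eq_line (left_mem_Icc.2 (hmono.monotoneOn hy hp.y₂_mem hp.x₁_lt_y₂.le)), HIr_eq]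
    linarith
  · obtain ⟨x', hx', rfl⟩ := hp.density.exists_cdf_eq
      (z := x) ⟨hx.1, hx.2.trans (hp.density.cdf_mem hwI).2⟩
    have hwx : x' ≤ w := (hmono.le_iff_le hx' hwI).1 hx.2
    refine lt_of_le_of_ne (hp.line_le hx') fun he => ?_
    rcases hp.mem_of_line_eq hx' he with h | h
    · exact absurd (hp.x₁_least.2 h) (not_le.2 (hwx.trans_lt hw2))
    · exact absurd ((hp.lt_type hp.x₁_least.1).trans (hp.type_lt h))
        (not_lt.2 (hwx.trans hw2.le))

/-! ### Integrals of the ironed virtual value -/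

lemma integrableOn_hIr : IntegrableOn (hIr b f ts) (Icc 0 b) :=
  integrableOn_mul_of_monotone_or_antitone hp.density.pos_b.le (Or.inl hp.monotoneOn_ironed)
    hp.density.integrableOn

lemma integral_hIr {t : ℝ} (ht : t ∈ Icc 0 b) :
    ∫ x in (0 : ℝ)..t, hIr b f ts x = HIr b f ts (cdf f t) := by
  have hsub : Icc 0 t ⊆ Icc 0 b := Icc_subset_Icc_right ht.2
  have h := intervalIntegral.integral_eq_sub_of_hasDerivAt_of_le ht.1
    (f := fun x => HIr b f ts (cdf f x)) (f' := hIr b f ts)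
    (hp.differentiableOn_HIr.continuousOn.comp (hp.density.continuousOn_cdf.mono hsub)
      fun x hx => hp.density.cdf_mem (hsub hx)) (fun x hx => ?_) ?_
  · rw [h, hp.density.cdf_zero, hp.HIr_zero, sub_zero]
  · have hx' : x ∈ Ioo 0 b := ⟨hx.1, hx.2.trans_le ht.2⟩
    rw [hIr, hp.ironed_eq_deriv hx']
    exact (hp.differentiableAt_HIr hx').hasDerivAt.comp x (hp.density.hasDerivAt_cdf hx')
  · rw [intervalIntegrable_iff_integrableOn_Icc_of_le ht.1]
    exact hp.integrableOn_hIr.mono_set hsub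

lemma integral_sub_hIr {t : ℝ} (ht : t ∈ Icc 0 b) :
    ∫ x in (0 : ℝ)..t, (hFun f ts x - hIr b f ts x) =
      HFun b f ts (cdf f t) - HIr b f ts (cdf f t) := by
  have hsub : Icc 0 t ⊆ Icc 0 b := Icc_subset_Icc_right ht.2
  rw [intervalIntegral.integral_sub, hp.integral_hIr ht, HFun, hp.density.quantile_cdf ht]
  · rw [intervalIntegrable_iff_integrableOn_Icc_of_le ht.1]
    exact (hp.density.integrableOn_hFun ts).mono_set hsub
  · rw [intervalIntegrable_iff_integrableOn_Icc_of_le ht.1]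
    exact hp.integrableOn_hIr.mono_set hsub

/-! ### Absolute continuity of the ironed virtual value -/

/-- If `φ` is constant just right of `t`, the derivative is zero. Otherwise `t` is a touching point,
hence not `t*`; to its right `φ` follows one differentiable formula on touching points and is
constant on the gaps, so `hasDerivWithinAt_of_gaps` applies. -/
lemma exists_hasDerivWithinAt_ironed {t : ℝ} (ht : t ∈ Ioo 0 b) :
    ∃ d, HasDerivWithinAt (ironedValue b f ts) d (Ioi t) t := by
  set φ := ironedValue b f ts with hφ
  have htI := Ioo_subset_Icc_self ht
  by_cases hA : ∃ t₁ ∈ Ioc t b, φ t₁ = φ t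
  · obtain ⟨t₁, ht₁, he⟩ := hA
    refine ⟨0, (hasDerivWithinAt_const t _ (φ t)).congr_of_eventuallyEq ?_ rfl⟩
    filter_upwards [Ioo_mem_nhdsGT ht₁.1] with x hx
    have hxI : x ∈ Icc 0 b := ⟨htI.1.trans hx.1.le, hx.2.le.trans ht₁.2⟩
    refine le_antisymm ?_ (hp.monotoneOn_ironed htI hxI hx.1.le)
    exact (hp.monotoneOn_ironed hxI ⟨htI.1.trans ht₁.1.le, ht₁.2⟩ hx.2.le).trans he.le
  have hlt : ∀ x ∈ Ioc t b, φ t < φ x := fun x hx =>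
    lt_of_le_of_ne (hp.monotoneOn_ironed htI ⟨htI.1.trans hx.1.le, hx.2⟩ hx.1.le)
      fun h => hA ⟨x, hx, h.symm⟩
  have htouch : Touches b f ts t := by
    by_contra hn
    obtain ⟨l, hl, r, hr, -, -, hc⟩ := hp.exists_gap' htI hn
    exact (hlt r hr).ne' (hc r ⟨(hl.2.trans hr.1).le, le_rfl⟩)
  have hne : t ≠ ts := fun h => hp.not_touches_type (h ▸ htouch)
  have hcont : ContinuousWithinAt φ (Ioi t) t :=
    (hp.continuousOn_ironed.continuousAt (Icc_mem_nhds ht.1 ht.2)).continuousWithinAt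
  have hgap : ∀ x ∈ Ioo t b, x ∉ {x | Touches b f ts x} → ∃ l < x, ∃ r > x,
      l ∈ {x | Touches b f ts x} ∧ r ∈ {x | Touches b f ts x} ∧ ∀ y ∈ Icc l r, φ y = φ x := by
    intro x hx hn
    obtain ⟨l, hl, r, hr, h1, h2, hc⟩ := hp.exists_gap' ⟨htI.1.trans hx.1.le, hx.2.le⟩ hn
    exact ⟨l, hl.2, r, hr.1, h1, h2, hc⟩
  have hfd : DifferentiableAt ℝ f t :=
    (hp.density.differentiableOn t htI).differentiableAt (Icc_mem_nhds ht.1 ht.2)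
  have hFd : DifferentiableAt ℝ (cdf f) t := (hp.density.hasDerivAt_cdf ht).differentiableAt
  have hf0 := (hp.density.pos t ht).ne'
  rcases hne.lt_or_gt with h | h
  · have hd : DifferentiableAt ℝ (fun x => x + cdf f x / f x) t :=
      differentiableAt_id.add (hFd.div hfd hf0)
    refine ⟨_, hasDerivWithinAt_of_gaps ht.2 hcont hlt hd.hasDerivAt
      (hp.ironed_of_touches_left ht htouch h.le) ?_ hgap⟩
    filter_upwards [Ioo_mem_nhdsGT h] with x hx hxT
    exact hp.ironed_of_touches_left ⟨ht.1.trans hx.1, hx.2.trans hp.type_mem_Ioo.2⟩ hxT hx.2.le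
  · have hd : DifferentiableAt ℝ (fun x => x - (1 - cdf f x) / f x) t :=
      differentiableAt_id.sub ((hFd.const_sub 1).div hfd hf0)
    refine ⟨_, hasDerivWithinAt_of_gaps ht.2 hcont hlt hd.hasDerivAt
      (hp.ironed_of_touches_right ht htouch h.le) ?_ hgap⟩
    filter_upwards [Ioo_mem_nhdsGT ht.2] with x hx hxT
    exact hp.ironed_of_touches_right ⟨ht.1.trans hx.1, hx.2⟩ hxT (h.trans hx.1).le

lemma intervalIntegrable_deriv_ironed :
    IntervalIntegrable (deriv (ironedValue b f ts)) volume 0 b :=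
  MonotoneOn.intervalIntegrable_deriv (by
    rw [uIcc_of_le hp.density.pos_b.le]; exact hp.monotoneOn_ironed)

/-- Integration by parts against the ironed virtual value. -/
lemma integral_mul_deriv_ironed {w w' : ℝ → ℝ} (hw : ContinuousOn w (Icc 0 b))
    (hw' : ContinuousOn w' (Icc 0 b)) (hd : ∀ t ∈ Ioo 0 b, HasDerivAt w (w' t) t) :
    ∫ t in (0 : ℝ)..b, w t * deriv (ironedValue b f ts) t =
      w b * b - ∫ t in (0 : ℝ)..b, w' t * ironedValue b f ts t := by
  set φ := ironedValue b f ts with hφ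
  have hb := hp.density.pos_b.le
  have hae : ∀ᵐ t, t ∈ Ioo 0 b → DifferentiableAt ℝ φ t := by
    filter_upwards [hp.monotoneOn_ironed.ae_differentiableWithinAt_of_mem] with t ht hmem
    exact (ht (Ioo_subset_Icc_self hmem)).differentiableAt (Icc_mem_nhds hmem.1 hmem.2)
  -- Continuity and monotonicity alone would not exclude a singular part of `φ`. A right derivative
  -- at every interior point, integrable because it agrees almost everywhere with `deriv φ`, permits
  -- the integration by parts.
  have hr : ∀ t ∈ Ioo 0 b, HasDerivWithinAt φ (derivWithin φ (Ioi t) t) (Ioi t) t := fun t ht => by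
    obtain ⟨d, hd⟩ := hp.exists_hasDerivWithinAt_ironed ht
    exact hd.differentiableWithinAt.hasDerivWithinAt
  have heq : ∀ᵐ t, t ∈ Ioo 0 b → deriv φ t = derivWithin φ (Ioi t) t := by
    filter_upwards [hae] with t ht hmem
    exact ((ht hmem).derivWithin (uniqueDiffWithinAt_Ioi t)).symm
  have heq' : ∀ᵐ t, t ∈ uIoc 0 b → deriv φ t = derivWithin φ (Ioi t) t := by
    have hbne : ∀ᵐ t : ℝ, t ≠ b := by simp [ae_iff]
    filter_upwards [heq, hbne] with t ht hne hmem
    rw [uIoc_of_le hb] at hmem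
    exact ht ⟨hmem.1, hmem.2.lt_of_ne hne⟩
  have hint : IntervalIntegrable (fun t => derivWithin φ (Ioi t) t) volume 0 b := by
    refine hp.intervalIntegrable_deriv_ironed.congr_ae ?_
    exact (ae_restrict_iff' measurableSet_uIoc).2 heq'
  have h1 : ∫ t in (0 : ℝ)..b, w t * deriv φ t =
      ∫ t in (0 : ℝ)..b, w t * derivWithin φ (Ioi t) t := by
    refine intervalIntegral.integral_congr_ae ?_
    filter_upwards [heq'] with t ht hmem
    rw [ht hmem]
  rw [h1]
  have huIcc : uIcc 0 b = Icc 0 b := uIcc_of_le hb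
  have hIoo : ∀ x ∈ Ioo (min 0 b) (max 0 b), x ∈ Ioo 0 b := fun x hx => by
    rwa [min_eq_left hb, max_eq_right hb] at hx
  rw [intervalIntegral.integral_mul_deriv_eq_deriv_mul_of_hasDeriv_right (u' := w') (huIcc ▸ hw)
    (huIcc ▸ hp.continuousOn_ironed) (fun x hx => (hd x (hIoo x hx)).hasDerivWithinAt)
    (fun x hx => hr x (hIoo x hx)) (ContinuousOn.intervalIntegrable (huIcc ▸ hw')) hint]
  rw [hφ, hp.ironed_zero, hp.ironed_b, mul_zero, sub_zero]

end IsPivot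

end TwoItemAuction

end

noncomputable section

namespace TwoItemAuction

/-! ### Upper and lower sets of types -/

/-- An upper set of types is an interval ending at `b`, up to its endpoints, which are null. -/
lemma exists_cut_of_upper {b : ℝ} (hb : 0 ≤ b) {U : Set ℝ} (hU : U ⊆ Icc 0 b)
    (hup : ∀ x ∈ U, ∀ y ∈ Icc 0 b, x ≤ y → y ∈ U) :
    ∃ x ∈ Icc 0 b, Ioo x b ⊆ U ∧ U ⊆ Icc x b := by
  rcases U.eq_empty_or_nonempty with rfl | hne
  · exact ⟨b, right_mem_Icc.2 hb, by simp, by simp⟩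
  have hbdd : BddBelow U := ⟨0, fun t ht => (hU ht).1⟩
  have h0 : 0 ≤ sInf U := le_csInf hne fun t ht => (hU ht).1
  refine ⟨sInf U, ⟨h0, ?_⟩, fun y hy => ?_, fun t ht => ⟨csInf_le hbdd ht, (hU ht).2⟩⟩
  · obtain ⟨t, ht⟩ := hne
    exact (csInf_le hbdd ht).trans (hU ht).2
  · obtain ⟨t, ht, hty⟩ := exists_lt_of_csInf_lt hne hy.1
    exact hup t ht y ⟨h0.trans hy.1.le, hy.2.le⟩ hty.le

lemma exists_cut_of_lower {b : ℝ} (hb : 0 ≤ b) {U : Set ℝ} (hU : U ⊆ Icc 0 b)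
    (hlow : ∀ x ∈ U, ∀ y ∈ Icc 0 b, y ≤ x → y ∈ U) :
    ∃ x ∈ Icc 0 b, Ioo 0 x ⊆ U ∧ U ⊆ Icc 0 x := by
  rcases U.eq_empty_or_nonempty with rfl | hne
  · exact ⟨0, left_mem_Icc.2 hb, by simp, by simp⟩
  have hbdd : BddAbove U := ⟨b, fun t ht => (hU ht).2⟩
  have h0 : sSup U ≤ b := csSup_le hne fun t ht => (hU ht).2
  refine ⟨sSup U, ⟨?_, h0⟩, fun y hy => ?_, fun t ht => ⟨(hU ht).1, le_csSup hbdd ht⟩⟩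
  · obtain ⟨t, ht⟩ := hne
    exact (hU ht).1.trans (le_csSup hbdd ht)
  · obtain ⟨t, ht, hty⟩ := exists_lt_of_lt_csSup hne hy.2
    exact hlow t ht y ⟨hy.1.le, hy.2.le.trans h0⟩ hty.le

lemma setIntegral_eq_of_Ioo {U : Set ℝ} {x y : ℝ} (hxy : x ≤ y) (h1 : Ioo x y ⊆ U)
    (h2 : U ⊆ Icc x y) (e : ℝ → ℝ) : ∫ t in U, e t = ∫ t in x..y, e t := by
  rw [intervalIntegral.integral_of_le hxy]
  refine setIntegral_congr_set ?_
  have hab : (Ioo x y : Set ℝ) =ᵐ[volume] Icc x y := Ioo_ae_eq_Icc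
  have h3 : U =ᵐ[volume] Icc x y :=
    Filter.EventuallyLE.antisymm h2.eventuallyLE (hab.symm.le.trans h1.eventuallyLE)
  exact h3.trans Ioc_ae_eq_Icc.symm

lemma IsBorderFeasible.integrableOn {n : ℕ} {b : ℝ} {f q : ℝ → ℝ} (hf : IsTypeDensity b f)
    (hq : IsBorderFeasible n b f q) : IntegrableOn (fun t => q t * f t) (Icc 0 b) := by
  refine Integrable.bdd_mul (c := 1) hf.integrableOn
    (aemeasurable_restrict_of_measurable_subtype measurableSet_Icc hq.measurable).aestronglyMeasurable ?_
  refine (ae_restrict_iff' measurableSet_Icc).2 (ae_of_all _ fun t ht => ?_)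
  rw [Real.norm_eq_abs, abs_of_nonneg (hq.mem_Icc t ht).1]
  exact (hq.mem_Icc t ht).2

namespace IsTypeDensity

variable {b : ℝ} {f : ℝ → ℝ} (hf : IsTypeDensity b f)
include hf

lemma integral_pow_cdf {n : ℕ} (hn : 1 ≤ n) {x : ℝ} (hx : x ∈ Icc 0 b) :
    ∫ t in x..b, cdf f t ^ (n - 1) * f t = (1 - cdf f x ^ n) / n := by
  have hsub : Icc x b ⊆ Icc 0 b := Icc_subset_Icc_left hx.1
  have hn0 : (n : ℝ) ≠ 0 := by positivity
  have h := intervalIntegral.integral_eq_sub_of_hasDerivAt_of_le hx.2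
    (f := fun t => cdf f t ^ n / n) (f' := fun t => cdf f t ^ (n - 1) * f t)
    ((hf.continuousOn_cdf.mono hsub).pow n |>.div_const _) (fun t ht => ?_) ?_
  · rw [h, hf.cdf_b]; ring
  · have := ((hf.hasDerivAt_cdf ⟨hx.1.trans_lt ht.1, ht.2⟩).pow n).div_const (n : ℝ)
    refine HasDerivAt.congr_deriv this ?_
    field_simp
  · rw [intervalIntegrable_iff_integrableOn_Icc_of_le hx.2]
    exact (((hf.continuousOn_cdf.pow _).mul hf.continuousOn).mono hsub).integrableOn_Icc

lemma integral_pow_one_sub_cdf {n : ℕ} (hn : 1 ≤ n) {x : ℝ} (hx : x ∈ Icc 0 b) :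
    ∫ t in (0 : ℝ)..x, (1 - cdf f t) ^ (n - 1) * f t = (1 - (1 - cdf f x) ^ n) / n := by
  have hsub : Icc 0 x ⊆ Icc 0 b := Icc_subset_Icc_right hx.2
  have hn0 : (n : ℝ) ≠ 0 := by positivity
  have hc : ContinuousOn (fun t => 1 - cdf f t) (Icc 0 b) := continuousOn_const.sub hf.continuousOn_cdf
  have h := intervalIntegral.integral_eq_sub_of_hasDerivAt_of_le hx.1
    (f := fun t => -((1 - cdf f t) ^ n / n)) (f' := fun t => (1 - cdf f t) ^ (n - 1) * f t)
    ((hc.mono hsub).pow n |>.div_const _ |>.neg) (fun t ht => ?_) ?_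
  · rw [h, hf.cdf_zero]; ring
  · have := ((((hf.hasDerivAt_cdf ⟨ht.1, ht.2.trans_le hx.2⟩).const_sub 1).pow n).div_const
      (n : ℝ)).neg
    refine HasDerivAt.congr_deriv this ?_
    field_simp
  · rw [intervalIntegrable_iff_integrableOn_Icc_of_le hx.1]
    exact (((hc.pow _).mul hf.continuousOn).mono hsub).integrableOn_Icc

lemma integrableOn_pow_cdf (m : ℕ) : IntegrableOn (fun t => cdf f t ^ m * f t) (Icc 0 b) :=
  ((hf.continuousOn_cdf.pow _).mul hf.continuousOn).integrableOn_Icc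

lemma integrableOn_pow_one_sub_cdf (m : ℕ) :
    IntegrableOn (fun t => (1 - cdf f t) ^ m * f t) (Icc 0 b) :=
  (((continuousOn_const.sub hf.continuousOn_cdf).pow _).mul hf.continuousOn).integrableOn_Icc

/-- `F^(n-1)` is the probability of having the highest type. As a benchmark it attains Border's
bound on all upper sets at once. -/
lemma setIntegral_pow_cdf_of_upper {n : ℕ} (hn : 1 ≤ n) {U : Set ℝ} (hU : U ⊆ Icc 0 b)
    (hup : ∀ x ∈ U, ∀ y ∈ Icc 0 b, x ≤ y → y ∈ U) :
    ∫ t in U, cdf f t ^ (n - 1) * f t = (1 - (1 - ∫ t in U, f t) ^ n) / n := by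
  obtain ⟨x, hx, h1, h2⟩ := exists_cut_of_upper hf.pos_b.le hU hup
  rw [setIntegral_eq_of_Ioo hx.2 h1 h2, setIntegral_eq_of_Ioo hx.2 h1 h2,
    hf.integral_pow_cdf hn hx, hf.integral_eq_cdf_sub hx hf.b_mem, hf.cdf_b, sub_sub_cancel]

lemma setIntegral_pow_one_sub_cdf_of_lower {n : ℕ} (hn : 1 ≤ n) {U : Set ℝ} (hU : U ⊆ Icc 0 b)
    (hlow : ∀ x ∈ U, ∀ y ∈ Icc 0 b, y ≤ x → y ∈ U) :
    ∫ t in U, (1 - cdf f t) ^ (n - 1) * f t = (1 - (1 - ∫ t in U, f t) ^ n) / n := by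
  obtain ⟨x, hx, h1, h2⟩ := exists_cut_of_lower hf.pos_b.le hU hlow
  rw [setIntegral_eq_of_Ioo hx.1 h1 h2, setIntegral_eq_of_Ioo hx.1 h1 h2,
    hf.integral_pow_one_sub_cdf hn hx, hf.integral_eq_cdf_sub hf.zero_mem hx, hf.cdf_zero, sub_zero]

end IsTypeDensity

namespace IsPivot

variable {b : ℝ} {f : ℝ → ℝ} {s ts x₁ x₂ y₁ y₂ : ℝ} (hp : IsPivot b f s ts x₁ x₂ y₁ y₂)
include hp

/-! ### The bound on the revenue -/

lemma antitoneOn_sub_ironed : AntitoneOn (fun t => b - ironedValue b f ts t) (Icc 0 b) :=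
  fun _ hx _ hy hxy => sub_le_sub_left (hp.monotoneOn_ironed hx hy hxy) b

/-- Reads the bound as the ironed surplus of the rules "highest type wins" and "lowest type wins".
The first boundary term vanishes; the second, `b / n`, is the integral of `b (1 - F)^(n-1) f`. -/
lemma revenueBound_eq {n : ℕ} (hn : 1 ≤ n) (a : ℝ) :
    revenueBound n a b f ts =
      (∫ t in Icc 0 b, ironedValue b f ts t * (cdf f t ^ (n - 1) * f t)) +
      1 / a * ∫ t in Icc 0 b, (b - ironedValue b f ts t) * ((1 - cdf f t) ^ (n - 1) * f t) := by
  have hf := hp.density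
  have hn0 : (n : ℝ) ≠ 0 := by positivity
  have hc : ContinuousOn (fun t => 1 - cdf f t) (Icc 0 b) := continuousOn_const.sub hf.continuousOn_cdf
  have hIcc : ∀ g : ℝ → ℝ, ∫ t in Icc 0 b, g t = ∫ t in (0 : ℝ)..b, g t := fun g => by
    rw [intervalIntegral.integral_of_le hf.pos_b.le, integral_Icc_eq_integral_Ioc]
  rw [revenueBound, hp.integral_mul_deriv_ironed (w := fun t => (1 - cdf f t ^ n) / n)
    (w' := fun t => -(cdf f t ^ (n - 1) * f t)),
    hp.integral_mul_deriv_ironed (w := fun t => (1 - (1 - cdf f t) ^ n) / n)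
    (w' := fun t => (1 - cdf f t) ^ (n - 1) * f t)]
  · congr 1
    · rw [hf.cdf_b, hIcc, ← sub_eq_zero]
      simp only [one_pow, sub_self, zero_div, zero_mul, neg_mul, intervalIntegral.integral_neg,
        sub_neg_eq_add, zero_add]
      rw [sub_eq_zero]
      exact intervalIntegral.integral_congr fun t _ => mul_comm _ _
    · congr 1
      simp_rw [sub_mul]
      have h1 := hf.integrableOn_pow_one_sub_cdf (n - 1)
      rw [integral_sub (h1.const_mul b) (integrableOn_mul_of_monotone_or_antitone hf.pos_b.le
        (Or.inl hp.monotoneOn_ironed) h1), integral_const_mul, hIcc, hIcc,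
        hf.integral_pow_one_sub_cdf hn hf.b_mem, mul_comm b]
      congr 1
      exact intervalIntegral.integral_congr fun t _ => mul_comm _ _
  · exact (continuousOn_const.sub (hc.pow n)).div_const _
  · exact (hc.pow _).mul hf.continuousOn
  · intro t ht
    have := ((((hf.hasDerivAt_cdf ht).const_sub 1).pow n).const_sub 1).div_const (n : ℝ)
    refine HasDerivAt.congr_deriv this ?_
    field_simp
  · exact (continuousOn_const.sub (hf.continuousOn_cdf.pow n)).div_const _
  · exact ((hf.continuousOn_cdf.pow _).mul hf.continuousOn).neg
  · intro t ht
    have := (((hf.hasDerivAt_cdf ht).pow n).const_sub 1).div_const (n : ℝ)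
    refine HasDerivAt.congr_deriv this ?_
    field_simp

lemma ironedSurplus_eq {a : ℝ} {p₁ p₂ : ℝ → ℝ}
    (h₁ : IntegrableOn (fun t => p₁ t * f t) (Icc 0 b))
    (h₂ : IntegrableOn (fun t => p₂ t * f t) (Icc 0 b)) :
    ironedSurplus a b f ts p₁ p₂ = (∫ t in Icc 0 b, ironedValue b f ts t * (p₁ t * f t)) +
      1 / a * ∫ t in Icc 0 b, (b - ironedValue b f ts t) * (p₂ t * f t) := by
  have hb := hp.density.pos_b.le
  rw [ironedSurplus, intervalIntegral.integral_of_le hb, ← integral_Icc_eq_integral_Ioc,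
    ← integral_const_mul, ← integral_add]
  · refine setIntegral_congr_fun measurableSet_Icc fun t _ => ?_
    simp only [hIr]; ring
  · exact integrableOn_mul_of_monotone_or_antitone hb (Or.inl hp.monotoneOn_ironed) h₁
  · exact (integrableOn_mul_of_monotone_or_antitone hb (Or.inr hp.antitoneOn_sub_ironed)
      h₂).const_mul _

/-- Superlevel sets of `φ` are upper sets and those of `b - φ` lower sets, where the benchmark rules
attain Border's bound. Both weights are nonnegative, as `0 ≤ φ ≤ b`. -/
lemma ironedSurplus_le {n : ℕ} (hn : 1 ≤ n) {a : ℝ} (ha : 0 < a) {p₁ p₂ : ℝ → ℝ}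
    (h₁ : IsBorderFeasible n b f p₁) (h₂ : IsBorderFeasible n b f p₂) :
    ironedSurplus a b f ts p₁ p₂ ≤ revenueBound n a b f ts := by
  have hb := hp.density.pos_b.le
  have i₁ := h₁.integrableOn hp.density
  have i₂ := h₂.integrableOn hp.density
  have j₁ := hp.density.integrableOn_pow_cdf (n - 1)
  have j₂ := hp.density.integrableOn_pow_one_sub_cdf (n - 1)
  rw [hp.ironedSurplus_eq i₁ i₂, hp.revenueBound_eq hn]
  have m₁ : MonotoneOn (ironedValue b f ts) (Icc 0 b) ∨ AntitoneOn (ironedValue b f ts) (Icc 0 b) :=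
    Or.inl hp.monotoneOn_ironed
  have m₂ : MonotoneOn (fun t => b - ironedValue b f ts t) (Icc 0 b) ∨
      AntitoneOn (fun t => b - ironedValue b f ts t) (Icc 0 b) := Or.inr hp.antitoneOn_sub_ironed
  have e₁ := setIntegral_mul_nonpos_of_superlevel hb m₁ (i₁.sub j₁)
    (fun t ht => (hp.ironed_mem ht).1) (fun c _ => ?_)
  have e₂ := setIntegral_mul_nonpos_of_superlevel hb m₂ (i₂.sub j₂)
    (fun t ht => sub_nonneg.2 (hp.ironed_mem ht).2) (fun c _ => ?_)
  · simp only [Pi.sub_apply, mul_sub] at e₁ e₂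
    rw [integral_sub (integrableOn_mul_of_monotone_or_antitone hb m₁ i₁)
      (integrableOn_mul_of_monotone_or_antitone hb m₁ j₁)] at e₁
    rw [integral_sub (integrableOn_mul_of_monotone_or_antitone hb m₂ i₂)
      (integrableOn_mul_of_monotone_or_antitone hb m₂ j₂)] at e₂
    have := mul_le_mul_of_nonneg_left (sub_nonpos.1 e₂) (one_div_pos.2 ha).le
    linarith
  · have hsub : {t | t ∈ Icc 0 b ∧ c < b - ironedValue b f ts t} ⊆ Icc 0 b := fun t h => h.1
    have hm := measurableSet_superlevel hb m₂ c
    simp only [Pi.sub_apply]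
    rw [integral_sub (i₂.mono_set hsub) (j₂.mono_set hsub),
      hp.density.setIntegral_pow_one_sub_cdf_of_lower hn hsub]
    · exact sub_nonpos.2 (h₂.border _ hm hsub)
    · exact fun x hx y hy hyx => ⟨hy, hx.2.trans_le (hp.antitoneOn_sub_ironed hy hx.1 hyx)⟩
  · have hsub : {t | t ∈ Icc 0 b ∧ c < ironedValue b f ts t} ⊆ Icc 0 b := fun t h => h.1
    have hm := measurableSet_superlevel hb m₁ c
    simp only [Pi.sub_apply]
    rw [integral_sub (i₁.mono_set hsub) (j₁.mono_set hsub),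
      hp.density.setIntegral_pow_cdf_of_upper hn hsub]
    · exact sub_nonpos.2 (h₁.border _ hm hsub)
    · exact fun x hx y hy hxy => ⟨hy, hx.2.trans_le (hp.monotoneOn_ironed hx.1 hy hxy)⟩

/-- The weighted integral of the ironed value for a rule that is extremal on its superlevel sets. -/
lemma integral_ironed_mul_eq {n : ℕ} (hn : 1 ≤ n) {q : ℝ → ℝ}
    (hq : IntegrableOn (fun t => q t * f t) (Icc 0 b))
    (h : ∀ c, ∫ t in {t | t ∈ Icc 0 b ∧ c < ironedValue b f ts t}, q t * f t =
      (1 - (1 - ∫ t in {t | t ∈ Icc 0 b ∧ c < ironedValue b f ts t}, f t) ^ n) / n) :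
    ∫ t in Icc 0 b, ironedValue b f ts t * (q t * f t) =
      ∫ t in Icc 0 b, ironedValue b f ts t * (cdf f t ^ (n - 1) * f t) := by
  have hb := hp.density.pos_b.le
  have j := hp.density.integrableOn_pow_cdf (n - 1)
  have m : MonotoneOn (ironedValue b f ts) (Icc 0 b) ∨ AntitoneOn (ironedValue b f ts) (Icc 0 b) :=
    Or.inl hp.monotoneOn_ironed
  have e := setIntegral_mul_eq_zero_of_superlevel hb m (hq.sub j) (fun c => ?_)
  · simp only [Pi.sub_apply, mul_sub] at e
    rw [integral_sub (integrableOn_mul_of_monotone_or_antitone hb m hq)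
      (integrableOn_mul_of_monotone_or_antitone hb m j)] at e
    linarith
  · have hsub : {t | t ∈ Icc 0 b ∧ c < ironedValue b f ts t} ⊆ Icc 0 b := fun t h => h.1
    simp only [Pi.sub_apply]
    rw [integral_sub (hq.mono_set hsub) (j.mono_set hsub), h,
      hp.density.setIntegral_pow_cdf_of_upper hn hsub, sub_self]
    exact fun x hx y hy hxy => ⟨hy, hx.2.trans_le (hp.monotoneOn_ironed hx.1 hy hxy)⟩

lemma integral_sub_ironed_mul_eq {n : ℕ} (hn : 1 ≤ n) {q : ℝ → ℝ}
    (hq : IntegrableOn (fun t => q t * f t) (Icc 0 b))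
    (h : ∀ c, ∫ t in {t | t ∈ Icc 0 b ∧ c < b - ironedValue b f ts t}, q t * f t =
      (1 - (1 - ∫ t in {t | t ∈ Icc 0 b ∧ c < b - ironedValue b f ts t}, f t) ^ n) / n) :
    ∫ t in Icc 0 b, (b - ironedValue b f ts t) * (q t * f t) =
      ∫ t in Icc 0 b, (b - ironedValue b f ts t) * ((1 - cdf f t) ^ (n - 1) * f t) := by
  have hb := hp.density.pos_b.le
  have j := hp.density.integrableOn_pow_one_sub_cdf (n - 1)
  have m : MonotoneOn (fun t => b - ironedValue b f ts t) (Icc 0 b) ∨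
      AntitoneOn (fun t => b - ironedValue b f ts t) (Icc 0 b) := Or.inr hp.antitoneOn_sub_ironed
  have e := setIntegral_mul_eq_zero_of_superlevel hb m (hq.sub j) (fun c => ?_)
  · simp only [Pi.sub_apply, mul_sub] at e
    rw [integral_sub (integrableOn_mul_of_monotone_or_antitone hb m hq)
      (integrableOn_mul_of_monotone_or_antitone hb m j)] at e
    linarith
  · have hsub : {t | t ∈ Icc 0 b ∧ c < b - ironedValue b f ts t} ⊆ Icc 0 b := fun t h => h.1
    simp only [Pi.sub_apply]
    rw [integral_sub (hq.mono_set hsub) (j.mono_set hsub), h,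
      hp.density.setIntegral_pow_one_sub_cdf_of_lower hn hsub, sub_self]
    exact fun x hx y hy hyx => ⟨hy, hx.2.trans_le (hp.antitoneOn_sub_ironed hy hx.1 hyx)⟩

/-! ### The loss from ironing -/

lemma integrableOn_sub_hIr : IntegrableOn (fun t => hFun f ts t - hIr b f ts t) (Icc 0 b) :=
  (hp.density.integrableOn_hFun ts).sub hp.integrableOn_hIr

lemma setIntegral_sub_hIr {U : Set ℝ} {x : ℝ} (hx : x ∈ Icc 0 b) (h1 : Ioo x b ⊆ U)
    (h2 : U ⊆ Icc x b) : ∫ t in U, (hFun f ts t - hIr b f ts t) =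
      -(HFun b f ts (cdf f x) - HIr b f ts (cdf f x)) := by
  have hi : ∀ y ∈ Icc 0 b, IntervalIntegrable (fun t => hFun f ts t - hIr b f ts t) volume 0 y :=
    fun y hy => by
      rw [intervalIntegrable_iff_integrableOn_Icc_of_le hy.1]
      exact hp.integrableOn_sub_hIr.mono_set (Icc_subset_Icc_right hy.2)
  rw [setIntegral_eq_of_Ioo hx.2 h1 h2, ← intervalIntegral.integral_interval_sub_left
    (hi b hp.density.b_mem) (hi x hx), hp.integral_sub_hIr hp.density.b_mem, hp.integral_sub_hIr hx,
    ← hp.touches_b, sub_self, zero_sub]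

/-- A superlevel set of `D` is an upper interval from some `x`, over which `h - h^ir` integrates to
`-(H - H^ir)(F(x)) ≤ 0`. -/
lemma integral_mul_sub_hIr_nonpos {D : ℝ → ℝ} (hD : MonotoneOn D (Icc 0 b)) :
    ∫ t in Icc 0 b, D t * (hFun f ts t - hIr b f ts t) ≤ 0 := by
  refine setIntegral_mul_nonpos_of_superlevel' hp.density.pos_b.le (Or.inl hD)
    hp.integrableOn_sub_hIr ?_ fun c => ?_
  · rw [hp.setIntegral_sub_hIr hp.density.zero_mem Ioo_subset_Icc_self subset_rfl,
      ← hp.touches_zero, sub_self, neg_zero]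
  · obtain ⟨x, hx, h1, h2⟩ := exists_cut_of_upper hp.density.pos_b.le
      (U := {t | t ∈ Icc 0 b ∧ c < D t}) (fun t h => h.1)
      fun x hx y hy hxy => ⟨hy, hx.2.trans_le (hD hx.1 hy hxy)⟩
    rw [hp.setIntegral_sub_hIr hx h1 h2]
    linarith [hp.HIr_le (hp.density.cdf_mem hx)]

/-- The cut `x` of a superlevel set of `D` must be a touching point, because `D` is constant around
all others; there `H = H^ir`. -/
lemma integral_mul_sub_hIr_eq_zero {D : ℝ → ℝ} (hD : MonotoneOn D (Icc 0 b))
    (hgap : ∀ t ∈ Icc 0 b, ¬ Touches b f ts t →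
      ∃ l ∈ Ico 0 t, ∃ r ∈ Ioc t b, ∀ x ∈ Ioo l r, D x = D t) :
    ∫ t in Icc 0 b, D t * (hFun f ts t - hIr b f ts t) = 0 := by
  refine setIntegral_mul_eq_zero_of_superlevel hp.density.pos_b.le (Or.inl hD)
    hp.integrableOn_sub_hIr fun c => ?_
  obtain ⟨x, hx, h1, h2⟩ := exists_cut_of_upper hp.density.pos_b.le
    (U := {t | t ∈ Icc 0 b ∧ c < D t}) (fun t h => h.1)
    fun x hx y hy hxy => ⟨hy, hx.2.trans_le (hD hx.1 hy hxy)⟩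
  rw [hp.setIntegral_sub_hIr hx h1 h2]
  have ht : Touches b f ts x := by
    by_contra hn
    obtain ⟨l, hl, r, hr, hc⟩ := hgap x hx hn
    obtain ⟨y, hy1, hy2⟩ := exists_between hl.2
    obtain ⟨z, hz1, hz2⟩ := exists_between hr.1
    have hzU := h1 ⟨hz1, hz2.trans_le hr.2⟩
    have hyU : y ∈ {t | t ∈ Icc 0 b ∧ c < D t} := by
      refine ⟨⟨hl.1.trans hy1.le, hy2.le.trans hx.2⟩, ?_⟩
      rw [hc y ⟨hy1, hy2.trans hr.1⟩, ← hc z ⟨hl.2.trans hz1, hz2⟩]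
      exact hzU.2
    exact absurd (h2 hyU).1 (not_le.2 hy2)
  rw [← ht, sub_self, neg_zero]

/-! ### Revenue in terms of virtual values -/

/-- Integrate by parts with weight `F` left of `t*` and `1 - F` right of it. These weights vanish at
`0` and `b` and add up to one at `t*`, so the only boundary term is `-u(t*)`. The two cases in
`hFun` correspond to this choice. -/
lemma integral_subgradient {D u : ℝ → ℝ} (hu : IsSubgradient b D u) :
    ∫ t in Icc 0 b, (t * D t - u t) * f t = (∫ t in Icc 0 b, D t * hFun f ts t) - u ts := by
  have hf := hp.density
  have hb := hf.pos_b.le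
  have hts := hp.type_mem
  have iDh := integrableOn_mul_of_monotone_or_antitone hb (Or.inl hu.monotoneOn)
    (hf.integrableOn_hFun ts)
  have hcont : ContinuousOn (fun t => t * f t) (Icc 0 b) := continuousOn_id.mul hf.continuousOn
  have iDf : IntegrableOn (fun t => (t * D t - u t) * f t) (Icc 0 b) := by
    have h1 := integrableOn_mul_of_monotone_or_antitone hb (Or.inl hu.monotoneOn)
      hcont.integrableOn_Icc
    have h2 := ((hu.continuousOn hb).mul hf.continuousOn).integrableOn_Icc (μ := volume)
    refine (h1.sub h2).congr (ae_of_all _ fun t => ?_)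
    simp only [Pi.sub_apply, Pi.mul_apply]; ring
  have i : IntegrableOn (fun t => (t * D t - u t) * f t - D t * hFun f ts t) (Icc 0 b) :=
    iDf.sub iDh
  have e : ∫ t in Icc 0 b, ((t * D t - u t) * f t - D t * hFun f ts t) = -u ts := by
    have i' := (intervalIntegrable_iff_integrableOn_Icc_of_le hb).2 i
    rw [integral_Icc_eq_integral_Ioc, ← intervalIntegral.integral_of_le hb,
      ← intervalIntegral.integral_add_adjacent_intervals (b := ts)
        (i'.mono_set (by rw [uIcc_of_le hts.1, uIcc_of_le hb]; exact Icc_subset_Icc_right hts.2))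
        (i'.mono_set (by rw [uIcc_of_le hts.2, uIcc_of_le hb]; exact Icc_subset_Icc_left hts.1))]
    have e1 : ∫ t in (0 : ℝ)..ts, ((t * D t - u t) * f t - D t * hFun f ts t) =
        ∫ t in (0 : ℝ)..ts, -(D t * cdf f t + u t * f t) := by
      refine intervalIntegral.integral_congr fun t ht => ?_
      rw [uIcc_of_le hts.1] at ht
      simp only [hFun, if_pos ht.2]
      ring
    have e2 : ∫ t in ts..b, ((t * D t - u t) * f t - D t * hFun f ts t) =
        ∫ t in ts..b, (D t * (1 - cdf f t) + u t * (-f t)) := by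
      -- The integrands are compared on the open interval only: at `t*` itself `hFun` takes its left
      -- value.
      refine intervalIntegral.integral_congr_uIoo fun t ht => ?_
      rw [uIoo_of_le hts.2] at ht
      simp only [hFun, if_neg (not_le.2 ht.1)]
      ring
    rw [e1, e2, intervalIntegral.integral_neg,
      hu.integral_mul hb hf.zero_mem hts hf.continuousOn_cdf hf.continuousOn
        (fun t ht => hf.hasDerivAt_cdf ht),
      hu.integral_mul hb (w := fun t => 1 - cdf f t) (w' := fun t => -f t) hts hf.b_mem (continuousOn_const.sub hf.continuousOn_cdf)
        hf.continuousOn.neg (fun t ht => (hf.hasDerivAt_cdf ht).const_sub 1), hf.cdf_zero, hf.cdf_b]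
    ring
  rw [integral_sub iDf iDh] at e
  linarith

/-- The central identity, used for the bound as well as for its attainment: the loss from ironing,
the ironed surplus and the rent of the pivotal type are separated. It follows from
`integral_subgradient` and `q¹ = D + q²/a`. -/
lemma reducedRevenue_eq {a : ℝ} {D u q₁ q₂ : ℝ → ℝ} (hu : IsSubgradient b D u)
    (hD : ∀ t ∈ Icc 0 b, D t = q₁ t - q₂ t / a)
    (h₂ : IntegrableOn (fun t => q₂ t * f t) (Icc 0 b)) :
    reducedRevenue a b f q₁ q₂ u = (∫ t in Icc 0 b, D t * (hFun f ts t - hIr b f ts t)) +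
      ironedSurplus a b f ts q₁ q₂ - u ts := by
  have hf := hp.density
  have hb := hf.pos_b.le
  have mφ : MonotoneOn (ironedValue b f ts) (Icc 0 b) ∨ AntitoneOn (ironedValue b f ts) (Icc 0 b) :=
    Or.inl hp.monotoneOn_ironed
  have mD : MonotoneOn D (Icc 0 b) ∨ AntitoneOn D (Icc 0 b) := Or.inl hu.monotoneOn
  have i1 := integrableOn_mul_of_monotone_or_antitone hb mD (hf.integrableOn_hFun ts)
  have i2 := integrableOn_mul_of_monotone_or_antitone hb mD hp.integrableOn_hIr
  have i3 : IntegrableOn (fun t => b / a * (q₂ t * f t)) (Icc 0 b) := h₂.const_mul (b / a)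
  have hcont : ContinuousOn (fun t => t * f t) (Icc 0 b) := continuousOn_id.mul hf.continuousOn
  have iDf : IntegrableOn (fun t => (t * D t - u t) * f t) (Icc 0 b) := by
    have h1 := integrableOn_mul_of_monotone_or_antitone hb mD hcont.integrableOn_Icc
    have h2 := ((hu.continuousOn hb).mul hf.continuousOn).integrableOn_Icc (μ := volume)
    refine (h1.sub h2).congr (ae_of_all _ fun t => ?_)
    simp only [Pi.sub_apply, Pi.mul_apply]; ring
  have e1 : reducedRevenue a b f q₁ q₂ u =
      ∫ t in Icc 0 b, ((t * D t - u t) * f t + b / a * (q₂ t * f t)) := by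
    rw [reducedRevenue, intervalIntegral.integral_of_le hb, ← integral_Icc_eq_integral_Ioc]
    refine setIntegral_congr_fun measurableSet_Icc fun t ht => ?_
    simp only [hD t ht]
    ring
  have e2 : ironedSurplus a b f ts q₁ q₂ =
      ∫ t in Icc 0 b, (D t * hIr b f ts t + b / a * (q₂ t * f t)) := by
    rw [ironedSurplus, intervalIntegral.integral_of_le hb, ← integral_Icc_eq_integral_Ioc]
    refine setIntegral_congr_fun measurableSet_Icc fun t ht => ?_
    simp only [hD t ht]
    ring
  rw [e1, e2, integral_add iDf i3, integral_add i2 i3, hp.integral_subgradient hu]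
  simp_rw [mul_sub]
  rw [integral_sub i1 i2]
  ring

end IsPivot

end TwoItemAuction

end

/-! ### Incentive compatible mechanisms: revenue bound and implementation -/

noncomputable section

namespace TwoItemAuction

variable {n : ℕ} {b : ℝ} {f : ℝ → ℝ}

lemma measurableSet_profiles : MeasurableSet (profiles n b) := by
  rw [profiles, ofPred_forall]
  exact MeasurableSet.iInter fun i => measurable_pi_apply i measurableSet_Icc

lemma measurable_indicator_of_domRestrict {α : Type*} [MeasurableSpace α] {s : Set α}
    (hs : MeasurableSet s) {g : α → ℝ} (hg : Measurable (s.domRestrict g)) :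
    Measurable (s.indicator g) := by
  refine measurable_of_restrict_of_restrict_compl hs ?_ ?_
  · have h : s.domRestrict (s.indicator g) = s.domRestrict g := by
      ext ⟨x, hx⟩; simp [hx]
    rwa [h]
  · have h : sᶜ.domRestrict (s.indicator g) = fun _ => 0 := by
      ext ⟨x, hx⟩; simp [show x ∉ s from hx]
    rw [h]
    exact measurable_const

lemma update_mem_profiles {s : Fin n → ℝ} (hs : s ∈ profiles n b) (i : Fin n) {t : ℝ}
    (ht : t ∈ Icc 0 b) : Function.update s i t ∈ profiles n b := by
  intro k
  by_cases h : k = i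
  · subst h; simpa using ht
  · rw [Function.update_of_ne h]; exact hs k

namespace IsTypeDensity

variable (hf : IsTypeDensity b f)
include hf

lemma ae_mem_profiles : ∀ᵐ s ∂profileLaw n b f, s ∈ profiles n b := by
  have := hf.isProbabilityMeasure
  refine ae_all_iff.2 fun i => ?_
  exact (Measure.quasiMeasurePreserving_eval (fun _ : Fin n => typeLaw b f) i).ae hf.ae_mem_Icc

/-- The average interim rule of a feasible allocation satisfies Border's condition. -/
lemma isBorderFeasible_average {x : Fin n → (Fin n → ℝ) → ℝ} (hn : 1 ≤ n) (hx : IsAlloc x) :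
    IsBorderFeasible n b f fun t => (∑ i, interim (typeLaw b f) i (x i) t) / n := by
  have := hf.isProbabilityMeasure
  have hn0 : (0 : ℝ) < n := by positivity
  have hm : Measurable fun t => (∑ i, interim (typeLaw b f) i (x i) t) / (n : ℝ) :=
    (Finset.measurable_sum _ fun i _ => hx.measurable_interim i).div_const _
  refine ⟨hm.comp measurable_subtype_coe, fun t _ => ⟨?_, ?_⟩, fun S hS hSb => ?_⟩
  · exact div_nonneg (Finset.sum_nonneg fun i _ => hx.interim_nonneg i t) hn0.le
  · rw [div_le_one hn0]
    refine (Finset.sum_le_sum fun i _ => hx.interim_le_one i t).trans ?_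
    simp
  · rw [← hf.setIntegral_typeLaw _ hS hSb, ← hf.measureReal_typeLaw hS hSb, integral_div,
      integral_finsetSum]
    · exact div_le_div_of_nonneg_right (sum_setIntegral_interim_le hx hS) hn0.le
    · exact fun i _ => (integrable_interim (hx.integrable i) i).integrableOn

lemma integrableOn_interim {x : Fin n → (Fin n → ℝ) → ℝ} (hx : IsAlloc x) (i : Fin n) :
    IntegrableOn (fun t => interim (typeLaw b f) i (x i) t * f t) (Icc 0 b) := by
  have := hf.isProbabilityMeasure
  refine Integrable.bdd_mul (c := 1) hf.integrableOn
    (hx.measurable_interim i).aestronglyMeasurable (ae_of_all _ fun t => ?_)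
  rw [Real.norm_eq_abs, abs_of_nonneg (hx.interim_nonneg i t)]
  exact hx.interim_le_one i t

lemma interim_congr {g g' : (Fin n → ℝ) → ℝ} (h : ∀ s ∈ profiles n b, g s = g' s) (i : Fin n)
    {t : ℝ} (ht : t ∈ Icc 0 b) : interim (typeLaw b f) i g t = interim (typeLaw b f) i g' t := by
  have := hf.isProbabilityMeasure
  refine integral_congr_ae ?_
  filter_upwards [hf.ae_mem_profiles] with s hs using h _ (update_mem_profiles hs i ht)

end IsTypeDensity

/-! ### Incentive compatible mechanisms -/

namespace Mechanism

variable (M : Mechanism n b f)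

/-- The allocation, extended by zero outside the type space. -/
def alloc' (j : Fin 2) (i : Fin n) : (Fin n → ℝ) → ℝ := (profiles n b).indicator (M.alloc j i)

lemma alloc'_eq (j : Fin 2) (i : Fin n) {s : Fin n → ℝ} (hs : s ∈ profiles n b) :
    M.alloc' j i s = M.alloc j i s := indicator_of_mem hs _

lemma isAlloc_alloc' (j : Fin 2) : IsAlloc (M.alloc' j) where
  measurable i := measurable_indicator_of_domRestrict measurableSet_profiles (M.alloc_measurable j i)
  nonneg i s := indicator_nonneg (fun s hs => M.alloc_nonneg j i s hs) s
  sum_le s := by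
    by_cases hs : s ∈ profiles n b
    · simp only [M.alloc'_eq j _ hs]
      exact M.alloc_sum_le_one j s hs
    · simp [alloc', indicator_of_notMem hs]

variable {M} (hf : IsTypeDensity b f)
include hf

lemma interimAlloc_eq (j : Fin 2) (i : Fin n) {t : ℝ} (ht : t ∈ Icc 0 b) :
    M.interimAlloc j i t = interim (typeLaw b f) i (M.alloc' j i) t :=
  (hf.interim_congr (fun _ hs => M.alloc'_eq j i hs) i ht).symm

lemma interimUtility_eq (a : ℝ) (i : Fin n) (t : ℝ) {t' : ℝ} (ht' : t' ∈ Icc 0 b) :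
    M.interimUtility a i t t' = interim (typeLaw b f) i (M.alloc' 0 i) t' * t +
      interim (typeLaw b f) i (M.alloc' 1 i) t' * ((b - t) / a) -
        interim (typeLaw b f) i (M.pay i) t' := by
  have := hf.isProbabilityMeasure
  have h0 := (M.isAlloc_alloc' 0).integrable_section (μ := typeLaw b f) i t'
  have h1 := (M.isAlloc_alloc' 1).integrable_section (μ := typeLaw b f) i t'
  have hpay := M.pay_interim_integrable i t' ht'
  have hadd : Integrable (fun s => M.alloc' 0 i (Function.update s i t') * t +
      M.alloc' 1 i (Function.update s i t') * ((b - t) / a)) (Measure.pi fun _ => typeLaw b f) :=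
    (h0.mul_const _).add (h1.mul_const _)
  simp only [interim]
  rw [← integral_mul_const, ← integral_mul_const, ← integral_add (h0.mul_const _) (h1.mul_const _),
    ← integral_sub hadd hpay]
  refine integral_congr_ae ?_
  filter_upwards [hf.ae_mem_profiles] with s hs
  have hs' := update_mem_profiles hs i ht'
  simp only [utility, M.alloc'_eq _ i hs']

/-- Utility from a fixed report `x` is affine in the true type, with slope `D x`. That type `y` does
not gain by reporting `x` is the subgradient inequality. -/
lemma isSubgradient {a : ℝ} (hM : M.IsBIC a) (i : Fin n) :
    IsSubgradient b (fun t => interim (typeLaw b f) i (M.alloc' 0 i) t -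
      interim (typeLaw b f) i (M.alloc' 1 i) t / a) (fun t => M.interimUtility a i t t) := by
  intro x hx y hy
  have h := hM i y hy x hx
  rw [interimUtility_eq hf a i y hx] at h
  simp only
  rw [interimUtility_eq hf a i x hx]
  refine le_trans (le_of_eq ?_) (sub_le_sub_right h _)
  ring

lemma revenue_eq (a : ℝ) : M.revenue = ∑ i, reducedRevenue a b f
    (interim (typeLaw b f) i (M.alloc' 0 i)) (interim (typeLaw b f) i (M.alloc' 1 i))
    (fun t => M.interimUtility a i t t) := by
  have := hf.isProbabilityMeasure
  rw [revenue, integral_finsetSum _ fun i _ => M.pay_integrable i]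
  refine Finset.sum_congr rfl fun i _ => ?_
  have h : ∫ s, M.pay i s ∂profileLaw n b f = ∫ t, interim (typeLaw b f) i (M.pay i) t ∂typeLaw b f :=
    (integral_interim (M.pay_integrable i) i).symm
  rw [h, hf.integral_typeLaw, reducedRevenue, intervalIntegral.integral_of_le hf.pos_b.le,
    ← integral_Icc_eq_integral_Ioc]
  refine setIntegral_congr_fun measurableSet_Icc fun t ht => ?_
  simp only [interimUtility_eq hf a i t ht]
  ring

end Mechanism

namespace IsPivot

variable {s ts x₁ x₂ y₁ y₂ : ℝ} (hp : IsPivot b f s ts x₁ x₂ y₁ y₂)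
include hp

/-- The revenue bound holds for all incentive compatible, individually rational mechanisms. -/
lemma revenue_le (hn : 1 ≤ n) {a : ℝ} (ha : 0 < a) (M : Mechanism n b f) (hM : M.IsBIC a)
    (hM' : M.IsInterimIR a) : M.revenue ≤ n * revenueBound n a b f ts := by
  have hf := hp.density
  have hb := hf.pos_b.le
  have hn0 : (n : ℝ) ≠ 0 := by positivity
  set q : Fin 2 → Fin n → ℝ → ℝ := fun j i => interim (typeLaw b f) i (M.alloc' j i) with hq
  have hi : ∀ j i, IntegrableOn (fun t => q j i t * f t) (Icc 0 b) := fun j i =>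
    hf.integrableOn_interim (M.isAlloc_alloc' j) i
  have hB : ∀ j, IsBorderFeasible n b f fun t => (∑ i, q j i t) / n := fun j =>
    hf.isBorderFeasible_average hn (M.isAlloc_alloc' j)
  have h1 : ∀ i, reducedRevenue a b f (q 0 i) (q 1 i) (fun t => M.interimUtility a i t t) ≤
      ironedSurplus a b f ts (q 0 i) (q 1 i) := fun i => by
    have hs := Mechanism.isSubgradient hf hM i
    rw [hp.reducedRevenue_eq hs (fun t _ => rfl) (hi 1 i)]
    have := hp.integral_mul_sub_hIr_nonpos hs.monotoneOn
    have h3 : 0 ≤ M.interimUtility a i ts ts := hM' i ts hp.type_mem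
    linarith
  -- In an asymmetric mechanism the symmetric Border condition holds only for the average rule over
  -- bidders. This is enough, because the surplus is linear in the rules.
  have h2 : ∑ i, ironedSurplus a b f ts (q 0 i) (q 1 i) = n * ironedSurplus a b f ts
      (fun t => (∑ i, q 0 i t) / n) (fun t => (∑ i, q 1 i t) / n) := by
    rw [hp.ironedSurplus_eq ((hB 0).integrableOn hf) ((hB 1).integrableOn hf)]
    simp_rw [fun i => hp.ironedSurplus_eq (a := a) (hi 0 i) (hi 1 i)]
    have havg : ∀ (φ : ℝ → ℝ) j, (∀ i, IntegrableOn (fun t => φ t * (q j i t * f t)) (Icc 0 b)) →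
        ∑ i, ∫ t in Icc 0 b, φ t * (q j i t * f t) =
          n * ∫ t in Icc 0 b, φ t * ((∑ i, q j i t) / n * f t) := fun φ j h => by
      rw [← integral_finsetSum _ fun i _ => h i, ← integral_const_mul]
      refine integral_congr_ae (ae_of_all _ fun t => ?_)
      simp only
      rw [← Finset.mul_sum, ← Finset.sum_mul]
      field_simp
    rw [Finset.sum_add_distrib, ← Finset.mul_sum, havg _ 0 ?_, havg _ 1 ?_]
    · ring
    · exact fun i => integrableOn_mul_of_monotone_or_antitone hb (Or.inr hp.antitoneOn_sub_ironed)
        (hi 1 i)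
    · exact fun i => integrableOn_mul_of_monotone_or_antitone hb (Or.inl hp.monotoneOn_ironed)
        (hi 0 i)
  rw [Mechanism.revenue_eq hf a]
  refine (Finset.sum_le_sum fun i _ => h1 i).trans ?_
  rw [h2]
  exact mul_le_mul_of_nonneg_left (hp.ironedSurplus_le hn ha (hB 0) (hB 1)) (by positivity)

end IsPivot

/-! ### Implementation of interim rules -/

section Implementation

variable (hf : IsTypeDensity b f)
include hf

/-- Slope zero at `ts` makes `0` a subgradient there, so the primitive of `D` from `ts` is
nonnegative. A bidder keeps the fraction `u / den` of his realized value: its interim expectation is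
`u`, and it is never negative ex post. -/
lemma IsTypeDensity.exists_mechanism (hn : 1 ≤ n) {a ts : ℝ} (ha : 0 < a) {x : Fin 2 → Fin n → (Fin n → ℝ) → ℝ}
    (hx : ∀ j, IsAlloc (x j)) {q : Fin 2 → ℝ → ℝ}
    (hq : ∀ j i, interim (typeLaw b f) i (x j i) = q j) (hqm : ∀ j, Measurable (q j))
    (h0 : MonotoneOn (q 0) (Icc 0 b)) (h1 : AntitoneOn (q 1) (Icc 0 b)) (hts : ts ∈ Ioo 0 b)
    (hD : q 0 ts - q 1 ts / a = 0) (hpos : 0 < q 1 ts) :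
    ∃ u : ℝ → ℝ, IsSubgradient b (fun t => q 0 t - q 1 t / a) u ∧ u ts = 0 ∧
      (∀ t ∈ Icc 0 b, 0 ≤ u t) ∧ (∀ t ∈ Icc 0 b, 0 < t * q 0 t + (b - t) / a * q 1 t) ∧
      ∃ M : Mechanism n b f, M.alloc = x ∧
        (∀ i, ∀ t ∈ Icc 0 b, M.interimAlloc 0 i t = q 0 t ∧ M.interimAlloc 1 i t = q 1 t ∧
          M.interimUtility a i t t = u t) ∧
        M.IsBIC a ∧ M.IsInterimIR a ∧ M.IsExPostIR a ∧
        M.revenue = n * reducedRevenue a b f (q 0) (q 1) u ∧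
        ∀ i, ∀ s ∈ profiles n b, M.pay i s =
          (1 - u (s i) / (s i * q 0 (s i) + (b - s i) / a * q 1 (s i))) *
            (s i * M.alloc 0 i s + (b - s i) / a * M.alloc 1 i s) := by
  have hprob := hf.isProbabilityMeasure
  have hb := hf.pos_b.le
  have htsI := Ioo_subset_Icc_self hts
  set D : ℝ → ℝ := fun t => q 0 t - q 1 t / a with hDdef
  have hDm : MonotoneOn D (Icc 0 b) := fun y hy z hz hyz =>
    sub_le_sub (h0 hy hz hyz) (div_le_div_of_nonneg_right (h1 hy hz hyz) ha.le)
  set u : ℝ → ℝ := fun t => ∫ r in ts..t, D r with hu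
  have hsub : IsSubgradient b D u := isSubgradient_integral hDm htsI
  have huts : u ts = 0 := intervalIntegral.integral_same
  have hu0 : ∀ t ∈ Icc 0 b, 0 ≤ u t := fun t ht => by
    have h := hsub ts htsI t ht
    have hDts : D ts = 0 := hD
    rw [hDts, huts] at h
    linarith
  set den : ℝ → ℝ := fun t => t * q 0 t + (b - t) / a * q 1 t with hden
  have hq0 : ∀ (i : Fin n) j t, 0 ≤ q j t := fun i j t => hq j i ▸ (hx j).interim_nonneg i t
  have hq0ts : 0 < q 0 ts := by
    have : q 0 ts = q 1 ts / a := by linarith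
    rw [this]; positivity
  -- A uniform lower bound for the denominators: right of `ts` the monotone first term suffices,
  -- left of `ts` the antitone second one. It keeps the payments bounded and hence integrable.
  set δ := min (ts * q 0 ts) ((b - ts) / a * q 1 ts) with hδ
  have hδpos : 0 < δ := lt_min (mul_pos hts.1 hq0ts)
    (mul_pos (div_pos (sub_pos.2 hts.2) ha) hpos)
  have hdenδ : ∀ t ∈ Icc 0 b, δ ≤ den t := fun t ht => by
    have e0 := mul_nonneg ht.1 (hq0 ⟨0, hn⟩ 0 t)
    have e1 := mul_nonneg (div_nonneg (sub_nonneg.2 ht.2) ha.le) (hq0 ⟨0, hn⟩ 1 t)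
    rcases le_total ts t with h | h
    · refine (min_le_left _ _).trans (le_trans ?_ (le_add_of_nonneg_right e1))
      exact mul_le_mul h (h0 htsI ht h) hq0ts.le ht.1
    · refine (min_le_right _ _).trans (le_trans ?_ (le_add_of_nonneg_left e0))
      refine mul_le_mul ?_ (h1 ht htsI h) hpos.le (div_nonneg (sub_nonneg.2 ht.2) ha.le)
      exact div_le_div_of_nonneg_right (by linarith) ha.le
  have hdenpos : ∀ t ∈ Icc 0 b, 0 < den t := fun t ht => hδpos.trans_le (hdenδ t ht)
  obtain ⟨C, hC⟩ : ∃ C, ∀ t ∈ Icc 0 b, |u t| ≤ C := by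
    obtain ⟨C, hC⟩ := isCompact_Icc.exists_bound_of_continuousOn (hsub.continuousOn hb)
    exact ⟨C, fun t ht => hC t ht⟩
  set w : ℝ → ℝ := fun t => 1 - u (clamp b t) / den (clamp b t) with hw
  have hclm : Measurable (clamp b) := (continuous_clamp b).measurable
  have hwm : Measurable w := by
    have hum : Measurable fun t => u (clamp b t) :=
      ((hsub.continuousOn hb).comp_continuous (continuous_clamp b) (clamp_mem hb)).measurable
    have hdm : Measurable den := by
      have := hqm 0
      have := hqm 1
      fun_prop
    exact measurable_const.sub (hum.div (hdm.comp hclm))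
  have hwb : ∀ t, |w t| ≤ 1 + C / δ := fun t => by
    have ht := clamp_mem hb t
    refine (abs_sub _ _).trans ?_
    rw [abs_one, abs_div, abs_of_pos (hdenpos _ ht)]
    have := div_le_div₀ ((abs_nonneg _).trans (hC _ ht)) (hC _ ht) hδpos (hdenδ _ ht)
    linarith
  set X : Fin n → (Fin n → ℝ) → ℝ := fun i s =>
    clamp b (s i) * x 0 i s + (b - clamp b (s i)) / a * x 1 i s with hX
  have hXm : ∀ i, Measurable (X i) := fun i => by
    have := (hx 0).measurable i
    have := (hx 1).measurable i
    have : Measurable fun s : Fin n → ℝ => clamp b (s i) := hclm.comp (measurable_pi_apply i)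
    simp only [hX]
    fun_prop
  have hXb : ∀ i s, |X i s| ≤ b + b / a := fun i s => by
    have hc := clamp_mem hb (s i)
    have e0 := (hx 0).nonneg i s
    have e1 := (hx 1).nonneg i s
    have e2 : 0 ≤ (b - clamp b (s i)) / a := div_nonneg (sub_nonneg.2 hc.2) ha.le
    rw [abs_of_nonneg (add_nonneg (mul_nonneg hc.1 e0) (mul_nonneg e2 e1))]
    refine add_le_add ?_ ?_
    · exact (mul_le_of_le_one_right hc.1 ((hx 0).le_one i s)).trans hc.2
    · exact (mul_le_of_le_one_right e2 ((hx 1).le_one i s)).trans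
        (div_le_div_of_nonneg_right (by linarith [hc.1]) ha.le)
  set pay : Fin n → (Fin n → ℝ) → ℝ := fun i s => w (s i) * X i s with hpay
  have hpm : ∀ i, Measurable (pay i) := fun i =>
    (hwm.comp (measurable_pi_apply i)).mul (hXm i)
  have hpb : ∀ i s, ‖pay i s‖ ≤ (1 + C / δ) * (b + b / a) := fun i s => by
    rw [Real.norm_eq_abs, abs_mul]
    exact mul_le_mul (hwb _) (hXb i s) (abs_nonneg _) ((abs_nonneg _).trans (hwb (s i)))
  have hprofile : IsProbabilityMeasure (profileLaw n b f) := by unfold profileLaw; infer_instance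
  let M : Mechanism n b f :=
    { alloc := x
      pay := pay
      alloc_measurable := fun j i => ((hx j).measurable i).comp measurable_subtype_coe
      alloc_nonneg := fun j i s _ => (hx j).nonneg i s
      alloc_sum_le_one := fun j s _ => (hx j).sum_le s
      pay_measurable := fun i => (hpm i).comp measurable_subtype_coe
      pay_integrable := fun i => Integrable.of_bound (hpm i).aestronglyMeasurable _
        (ae_of_all _ (hpb i))
      pay_interim_integrable := fun i t _ => Integrable.of_bound ((hpm i).comp
        ((measurable_update_pair i).comp measurable_prodMk_left)).aestronglyMeasurable _
        (ae_of_all _ fun s => hpb i _) }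
  have hMalloc : ∀ j i, ∀ t ∈ Icc 0 b, interim (typeLaw b f) i (M.alloc' j i) t = q j t :=
    fun j i t ht => by
      rw [hf.interim_congr (fun s hs => M.alloc'_eq j i hs) i ht]
      exact congrFun (hq j i) t
  have hMpay : ∀ i, ∀ t ∈ Icc 0 b, interim (typeLaw b f) i (M.pay i) t = den t - u t :=
    fun i t ht => by
      have e : interim (typeLaw b f) i (M.pay i) t =
          w t * (t * interim (typeLaw b f) i (x 0 i) t +
            (b - t) / a * interim (typeLaw b f) i (x 1 i) t) := by
        have i0 := ((hx 0).integrable_section (μ := typeLaw b f) i t)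
        have i1 := ((hx 1).integrable_section (μ := typeLaw b f) i t)
        simp only [interim]
        rw [← integral_const_mul, ← integral_const_mul,
          ← integral_add (i0.const_mul _) (i1.const_mul _), ← integral_const_mul]
        refine integral_congr_ae (ae_of_all _ fun s => ?_)
        simp [M, hpay, hX, clamp_of_mem ht]
      rw [e, hq, hq]
      have := (hdenpos t ht).ne'
      simp only [hw, clamp_of_mem ht]
      change (1 - u t / den t) * den t = _
      field_simp
  -- The utility from reporting `t'` is the tangent of `u` at `t'` evaluated at the true type, so
  -- BIC is the subgradient inequality read backwards.
  have hMU : ∀ i t, ∀ t' ∈ Icc 0 b, M.interimUtility a i t t' = u t' + D t' * (t - t') :=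
    fun i t t' ht' => by
      rw [Mechanism.interimUtility_eq hf a i t ht', hMalloc 0 i t' ht', hMalloc 1 i t' ht',
        hMpay i t' ht']
      simp only [hden, hDdef]
      ring
  have hMU' : ∀ i, ∀ t ∈ Icc 0 b, M.interimUtility a i t t = u t := fun i t ht => by
    rw [hMU i t t ht, sub_self, mul_zero, add_zero]
  have hpayeq : ∀ i, ∀ s ∈ profiles n b, M.pay i s =
      (1 - u (s i) / den (s i)) * (s i * M.alloc 0 i s + (b - s i) / a * M.alloc 1 i s) :=
    fun i s hs => by
      simp only [M, hpay, hw, hX, clamp_of_mem (hs i)]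
  refine ⟨u, hsub, huts, hu0, hdenpos, M, rfl, fun i t ht => ⟨?_, ?_, hMU' i t ht⟩, ?_, ?_, ?_, ?_,
    hpayeq⟩
  · rw [Mechanism.interimAlloc_eq hf 0 i ht, hMalloc 0 i t ht]
  · rw [Mechanism.interimAlloc_eq hf 1 i ht, hMalloc 1 i t ht]
  · intro i t ht t' ht'
    rw [hMU i t t' ht', hMU' i t ht]
    linarith [hsub t' ht' t ht]
  · intro i t ht
    rw [hMU' i t ht]
    exact hu0 t ht
  · intro i s hs
    rw [Mechanism.utility, hpayeq i s hs]
    have e0 := mul_nonneg ((hx 0).nonneg i s) (hs i).1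
    have e1 := mul_nonneg ((hx 1).nonneg i s) (div_nonneg (sub_nonneg.2 (hs i).2) ha.le)
    have e2 := mul_nonneg (div_nonneg (hu0 _ (hs i)) (hdenpos _ (hs i)).le) (add_nonneg e0 e1)
    refine e2.trans (le_of_eq ?_)
    simp only [M]
    ring
  · rw [Mechanism.revenue_eq hf a]
    have e : ∀ i, reducedRevenue a b f (interim (typeLaw b f) i (M.alloc' 0 i))
        (interim (typeLaw b f) i (M.alloc' 1 i)) (fun t => M.interimUtility a i t t) =
        reducedRevenue a b f (q 0) (q 1) u := fun i => by
      refine intervalIntegral.integral_congr fun t ht => ?_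
      rw [uIcc_of_le hb] at ht
      simp only [hMalloc 0 i t ht, hMalloc 1 i t ht, hMU' i t ht]
    simp_rw [e]
    simp

end Implementation

end TwoItemAuction

end

/-! ### Interim shares on tie classes and the ranking function -/

noncomputable section

namespace TwoItemAuction

section GroupFormula

variable {Ω : Type*} [MeasurableSpace Ω] {μ : Measure Ω} [IsProbabilityMeasure μ] {n : ℕ}

/-- The interim probability on a level set of the ranking, in terms of the mass at most as high and
the mass strictly below. -/
lemma interimShare_mul (hn : 1 ≤ n) {ρ : Ω → ℝ} (hρ : Measurable ρ) (t : Ω) :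
    interimShare n hn μ ρ t * (n * (μ.real {x | ρ x ≤ ρ t} - μ.real {x | ρ x < ρ t})) =
      μ.real {x | ρ x ≤ ρ t} ^ n - μ.real {x | ρ x < ρ t} ^ n := by
  have hn0 : (n : ℝ) ≠ 0 := by positivity
  have m1 : MeasurableSet {x | ρ x ≤ ρ t} := measurableSet_le hρ measurable_const
  have m2 : MeasurableSet {x | ρ x < ρ t} := measurableSet_lt hρ measurable_const
  have m3 : MeasurableSet {x | ρ x = ρ t} := measurableSet_eq_fun hρ measurable_const
  have hi : Integrable (interimShare n hn μ ρ) μ :=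
    integrable_interim ((isAlloc_share hn hρ).integrable _) _
  -- Border's condition is tight on the types ranked above `t` and on those ranked at least as high.
  -- The difference of the two equations is the integral over the tie class of `t`, where the
  -- interim share is constant.
  have e1 := setIntegral_interimShare_of_upper (μ := μ) hn hρ m1.compl fun x hx y hxy => by
    simp only [mem_compl_iff, mem_ofPred_eq, not_le] at hx ⊢; exact hx.trans_le hxy
  have e2 := setIntegral_interimShare_of_upper (μ := μ) hn hρ m2.compl fun x hx y hxy => by
    simp only [mem_compl_iff, mem_ofPred_eq, not_lt] at hx ⊢; exact hx.trans hxy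
  have hunion : {x | ρ x < ρ t}ᶜ = {x | ρ x ≤ ρ t}ᶜ ∪ {x | ρ x = ρ t} := by
    ext x; simp only [mem_compl_iff, mem_ofPred_eq, mem_union, not_le, not_lt]
    rw [le_iff_lt_or_eq, eq_comm]
  have hdisj : Disjoint {x | ρ x ≤ ρ t}ᶜ {x | ρ x = ρ t} := by
    rw [Set.disjoint_left]; intro x hx hx'; exact hx (le_of_eq hx')
  have e3 := setIntegral_union hdisj m3 hi.integrableOn hi.integrableOn
  have e4 : ∫ x in {x | ρ x = ρ t}, interimShare n hn μ ρ x ∂μ =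
      μ.real {x | ρ x = ρ t} * interimShare n hn μ ρ t := by
    rw [setIntegral_congr_fun (g := fun _ => interimShare n hn μ ρ t) m3 fun x hx =>
      le_antisymm (interimShare_mono hn hρ (le_of_eq hx)) (interimShare_mono hn hρ (ge_of_eq hx))]
    simp
  have e5 : μ.real {x | ρ x ≤ ρ t} = μ.real {x | ρ x < ρ t} + μ.real {x | ρ x = ρ t} := by
    have h : Disjoint {x | ρ x < ρ t} {x | ρ x = ρ t} := Set.disjoint_left.2 fun x hx hx' => hx.ne hx'
    rw [← measureReal_union h m3]
    congr 1; ext x; exact le_iff_lt_or_eq (a := ρ x)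
  rw [← hunion, e1, e2, e4, probReal_compl_eq_one_sub m1, probReal_compl_eq_one_sub m2] at e3
  simp only [sub_sub_cancel] at e3
  field_simp at e3
  rw [e5] at e3 ⊢
  linarith

end GroupFormula

variable {n : ℕ} {b : ℝ} {f : ℝ → ℝ}

/-! ### The priority order as a ranking function -/

open Classical in
/-- A numerical ranking that represents the priority order. -/
def rank (b : ℝ) (f : ℝ → ℝ) (ts τ t : ℝ) : ℝ :=
  ironedValue b f ts t + if ironedValue b f ts ts < ironedValue b f ts t ∨
    (ironedValue b f ts t = ironedValue b f ts ts ∧ τ ≤ t) then 1 else 0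

lemma rank_lt_rank {ts τ x y : ℝ} (h : ironedValue b f ts x < ironedValue b f ts y) :
    rank b f ts τ x < rank b f ts τ y := by
  unfold rank
  split_ifs with h1 h2 h2
  · linarith
  · exact absurd (Or.inl (h1.elim (fun h1 => h1.trans h) fun h1 => h1.1 ▸ h)) h2
  · linarith
  · linarith

lemma ironedValue_le_of_rank_le {ts τ x y : ℝ} (h : rank b f ts τ x ≤ rank b f ts τ y) :
    ironedValue b f ts x ≤ ironedValue b f ts y := not_lt.1 fun h' => not_lt.2 h (rank_lt_rank h')

lemma rank_eq_rank {ts τ x y : ℝ} (h : ironedValue b f ts x = ironedValue b f ts y)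
    (h' : τ ≤ x ↔ τ ≤ y) : rank b f ts τ x = rank b f ts τ y := by
  simp only [rank, h, h']

lemma rank_of_lt {ts τ t : ℝ} (h : ironedValue b f ts t = ironedValue b f ts ts) (ht : t < τ) :
    rank b f ts τ t = ironedValue b f ts ts := by
  rw [rank, if_neg, h, add_zero]
  rw [h]
  exact fun h' => h'.elim (lt_irrefl _) fun h' => not_le.2 ht h'.2

lemma rank_of_le {ts τ t : ℝ} (h : ironedValue b f ts t = ironedValue b f ts ts) (ht : τ ≤ t) :
    rank b f ts τ t = ironedValue b f ts ts + 1 := by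
  rw [rank, if_pos (Or.inr ⟨h, ht⟩), h]

lemma rank_of_gt {ts τ t : ℝ} (h : ironedValue b f ts ts < ironedValue b f ts t) :
    rank b f ts τ t = ironedValue b f ts t + 1 := by
  rw [rank, if_pos (Or.inl h)]

lemma rank_of_value_lt {ts τ t : ℝ} (h : ironedValue b f ts t < ironedValue b f ts ts) :
    rank b f ts τ t = ironedValue b f ts t := by
  rw [rank, if_neg, add_zero]
  exact fun h' => h'.elim (fun h' => lt_asymm h h') fun h' => h.ne h'.1

lemma ranksBelow_iff {ts τ x y : ℝ} :
    RanksBelow b f ts τ x y ↔ rank b f ts τ x < rank b f ts τ y := by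
  refine ⟨fun h => ?_, fun h => ?_⟩
  · rcases h with h | ⟨h1, h2, h3, h4⟩
    · exact rank_lt_rank h
    · rw [rank_of_lt h1 h3, rank_of_le h2 h4]; linarith
  · rcases (ironedValue_le_of_rank_le h.le).lt_or_eq with h1 | h1
    · exact Or.inl h1
    · by_cases h2 : ironedValue b f ts x = ironedValue b f ts ts
      · have h3 := h1 ▸ h2
        rcases lt_or_ge x τ with hx | hx
        · refine Or.inr ⟨h2, h3, hx, not_lt.1 fun hy => ?_⟩
          rw [rank_of_lt h2 hx, rank_of_lt h3 hy] at h
          exact lt_irrefl _ h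
        · rw [rank_of_le h2 hx] at h
          rcases lt_or_ge y τ with hy | hy
          · rw [rank_of_lt h3 hy] at h; linarith
          · rw [rank_of_le h3 hy] at h; exact absurd h (lt_irrefl _)
      · exfalso
        unfold rank at h
        simp [← h1, h2] at h

/-- The ranking, extended to all real numbers. -/
def extRank (b : ℝ) (f : ℝ → ℝ) (ts τ : ℝ) : ℝ → ℝ := rank b f ts τ ∘ clamp b

lemma extRank_eq {ts τ t : ℝ} (ht : t ∈ Icc 0 b) : extRank b f ts τ t = rank b f ts τ t := by
  rw [extRank, Function.comp, clamp_of_mem ht]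

/-- The priority rule as a pair of uniform sharing rules. -/
def priorityShare (b : ℝ) (f : ℝ → ℝ) (ts τ : ℝ) (j : Fin 2) : Fin n → (Fin n → ℝ) → ℝ :=
  share (if j = 0 then extRank b f ts τ else -extRank b f ts τ)

lemma priorityAlloc_eq {ts τ : ℝ} (j : Fin 2) (i : Fin n) {s : Fin n → ℝ} (hs : s ∈ profiles n b) :
    priorityAlloc b f ts τ j i s = priorityShare b f ts τ j i s := by
  have h1 : topBidders b f ts τ s = maximizers (extRank b f ts τ) s := by
    ext k
    simp only [topBidders, Finset.mem_filter, Finset.mem_univ, true_and, mem_maximizers,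
      ranksBelow_iff, not_lt, extRank_eq (hs _)]
  have h2 : bottomBidders b f ts τ s = maximizers (-extRank b f ts τ) s := by
    ext k
    simp only [bottomBidders, Finset.mem_filter, Finset.mem_univ, true_and, mem_maximizers,
      ranksBelow_iff, not_lt, extRank_eq (hs _), Pi.neg_apply, neg_le_neg_iff]
  unfold priorityAlloc priorityShare share
  split_ifs <;> simp_all

/-- The first item is only shared by types above the pivotal value. -/
def reserveShare (b : ℝ) (f : ℝ → ℝ) (ts τ : ℝ) (j : Fin 2) (i : Fin n) : (Fin n → ℝ) → ℝ :=
  if j = 0 then {s | ironedValue b f ts ts < extRank b f ts τ (s i)}.indicator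
    (priorityShare b f ts τ 0 i) else priorityShare b f ts τ j i

end TwoItemAuction

end

/-! ### Allocation rules that attain the bound on the ironed surplus -/

noncomputable section

namespace TwoItemAuction

variable {n : ℕ} {b : ℝ} {f : ℝ → ℝ}

/-- A symmetric allocation rule `x` with interim rules `q` that maximizes the ironed virtual surplus,
and whose interim rules are monotone and constant where ironing takes place. -/
structure IsOptimalRule (n : ℕ) (b : ℝ) (f : ℝ → ℝ) (ts : ℝ) (x : Fin 2 → Fin n → (Fin n → ℝ) → ℝ)
    (q : Fin 2 → ℝ → ℝ) : Prop where
  alloc : ∀ j, IsAlloc (x j)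
  interim_eq : ∀ j i, interim (typeLaw b f) i (x j i) = q j
  monotone : MonotoneOn (q 0) (Icc 0 b)
  antitone : AntitoneOn (q 1) (Icc 0 b)
  pos : 0 < q 1 ts
  gap : ∀ t ∈ Icc 0 b, ¬ Touches b f ts t →
    ∃ l ∈ Ico 0 t, ∃ r ∈ Ioc t b, ∀ y ∈ Ioo l r, ∀ j, q j y = q j t
  surplus_one : ∫ t in Icc 0 b, ironedValue b f ts t * (q 0 t * f t) =
    ∫ t in Icc 0 b, ironedValue b f ts t * (cdf f t ^ (n - 1) * f t)
  surplus_two : ∫ t in Icc 0 b, (b - ironedValue b f ts t) * (q 1 t * f t) =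
    ∫ t in Icc 0 b, (b - ironedValue b f ts t) * ((1 - cdf f t) ^ (n - 1) * f t)

namespace IsOptimalRule

variable {ts : ℝ} {x x' : Fin 2 → Fin n → (Fin n → ℝ) → ℝ} {q q' : Fin 2 → ℝ → ℝ}

lemma measurable (hn : 1 ≤ n) (h : IsOptimalRule n b f ts x q) (hf : IsTypeDensity b f) (j : Fin 2) :
    Measurable (q j) := by
  have := hf.isProbabilityMeasure
  rw [← h.interim_eq j ⟨0, hn⟩]
  exact (h.alloc j).measurable_interim _

lemma integrableOn (hn : 1 ≤ n) (h : IsOptimalRule n b f ts x q) (hf : IsTypeDensity b f)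
    (j : Fin 2) : IntegrableOn (fun t => q j t * f t) (Icc 0 b) := by
  have := hf.integrableOn_interim (h.alloc j) ⟨0, hn⟩
  rwa [h.interim_eq j] at this

lemma isBorderFeasible (hn : 1 ≤ n) (h : IsOptimalRule n b f ts x q) (hf : IsTypeDensity b f)
    (j : Fin 2) : IsBorderFeasible n b f (q j) := by
  have h1 := hf.isBorderFeasible_average hn (h.alloc j)
  have hn0 : (n : ℝ) ≠ 0 := by positivity
  have h2 : (fun t => (∑ i, interim (typeLaw b f) i (x j i) t) / (n : ℝ)) = q j := by
    ext t
    simp only [h.interim_eq j, Finset.sum_const, Finset.card_univ, Fintype.card_fin, nsmul_eq_mul]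
    field_simp
  rwa [h2] at h1

/-- Randomizations of optimal rules are optimal. -/
lemma mix (hn : 1 ≤ n) {s x₁ x₂ y₁ y₂ : ℝ} (hp : IsPivot b f s ts x₁ x₂ y₁ y₂)
    (h : IsOptimalRule n b f ts x q) (h' : IsOptimalRule n b f ts x' q')
    {α : ℝ} (hα : α ∈ Icc (0 : ℝ) 1) :
    IsOptimalRule n b f ts (fun j i s => α * x j i s + (1 - α) * x' j i s)
      (fun j t => α * q j t + (1 - α) * q' j t) := by
  have hf := hp.density
  have hprob := hf.isProbabilityMeasure
  have hb := hf.pos_b.le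
  have h0 := hα.1
  have h1 : 0 ≤ 1 - α := sub_nonneg.2 hα.2
  have hmix : ∀ (φ : ℝ → ℝ), (MonotoneOn φ (Icc 0 b) ∨ AntitoneOn φ (Icc 0 b)) → ∀ j,
      ∫ t in Icc 0 b, φ t * ((α * q j t + (1 - α) * q' j t) * f t) =
        α * (∫ t in Icc 0 b, φ t * (q j t * f t)) +
          (1 - α) * ∫ t in Icc 0 b, φ t * (q' j t * f t) := fun φ hφ j => by
    rw [← integral_const_mul, ← integral_const_mul, ← integral_add]
    · exact integral_congr_ae (ae_of_all _ fun t => by simp only; ring)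
    · exact (integrableOn_mul_of_monotone_or_antitone hb hφ (h.integrableOn hn hf j)).const_mul _
    · exact (integrableOn_mul_of_monotone_or_antitone hb hφ (h'.integrableOn hn hf j)).const_mul _
  constructor
  · refine fun j => ⟨fun i => ?_, fun i s => ?_, fun s => ?_⟩
    · exact (((h.alloc j).measurable i).const_mul _).add (((h'.alloc j).measurable i).const_mul _)
    · exact add_nonneg (mul_nonneg h0 ((h.alloc j).nonneg i s))
        (mul_nonneg h1 ((h'.alloc j).nonneg i s))
    · rw [Finset.sum_add_distrib, ← Finset.mul_sum, ← Finset.mul_sum]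
      have e := mul_le_mul_of_nonneg_left ((h.alloc j).sum_le s) h0
      have e' := mul_le_mul_of_nonneg_left ((h'.alloc j).sum_le s) h1
      linarith
  · intro j i
    ext t
    rw [← h.interim_eq j i, ← h'.interim_eq j i]
    simp only [interim]
    rw [← integral_const_mul, ← integral_const_mul, ← integral_add]
    · exact ((h.alloc j).integrable_section i t).const_mul _
    · exact ((h'.alloc j).integrable_section i t).const_mul _
  · exact fun y hy z hz hyz => add_le_add (mul_le_mul_of_nonneg_left (h.monotone hy hz hyz) h0)
      (mul_le_mul_of_nonneg_left (h'.monotone hy hz hyz) h1)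
  · exact fun y hy z hz hyz => add_le_add (mul_le_mul_of_nonneg_left (h.antitone hy hz hyz) h0)
      (mul_le_mul_of_nonneg_left (h'.antitone hy hz hyz) h1)
  · rcases h0.eq_or_lt with rfl | h2
    · simpa using h'.pos
    · exact add_pos_of_pos_of_nonneg (mul_pos h2 h.pos) (mul_nonneg h1 h'.pos.le)
  · intro t ht hnt
    obtain ⟨l, hl, r, hr, e⟩ := h.gap t ht hnt
    obtain ⟨l', hl', r', hr', e'⟩ := h'.gap t ht hnt
    refine ⟨max l l', ⟨le_max_of_le_left hl.1, max_lt hl.2 hl'.2⟩, min r r',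
      ⟨lt_min hr.1 hr'.1, min_le_of_left_le hr.2⟩, fun y hy j => ?_⟩
    rw [e y ⟨(le_max_left _ _).trans_lt hy.1, hy.2.trans_le (min_le_left _ _)⟩,
      e' y ⟨(le_max_right _ _).trans_lt hy.1, hy.2.trans_le (min_le_right _ _)⟩]
  · rw [hmix _ (Or.inl hp.monotoneOn_ironed), h.surplus_one, h'.surplus_one]; ring
  · rw [hmix _ (Or.inr hp.antitoneOn_sub_ironed), h.surplus_two, h'.surplus_two]; ring

/-- The ironed virtual surplus of an optimal rule attains the revenue bound. -/
lemma ironedSurplus_eq (hn : 1 ≤ n) {s x₁ x₂ y₁ y₂ : ℝ} (hp : IsPivot b f s ts x₁ x₂ y₁ y₂)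
    (h : IsOptimalRule n b f ts x q) (a : ℝ) :
    ironedSurplus a b f ts (q 0) (q 1) = revenueBound n a b f ts := by
  rw [hp.ironedSurplus_eq (h.integrableOn hn hp.density 0) (h.integrableOn hn hp.density 1),
    hp.revenueBound_eq hn, h.surplus_one, h.surplus_two]

end IsOptimalRule

/-- Uniform sharing according to a ranking that refines `ψ` is tight in Border's condition on the
superlevel sets of `ψ`. -/
lemma IsTypeDensity.setIntegral_interimShare (hf : IsTypeDensity b f) (hn : 1 ≤ n) {ρ ψ : ℝ → ℝ}
    (hρ : Measurable ρ) (hψm : Measurable (ψ ∘ clamp b))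
    (hψ : ∀ x y, ρ x ≤ ρ y → ψ (clamp b x) ≤ ψ (clamp b y)) (c : ℝ) :
    ∫ t in {t | t ∈ Icc 0 b ∧ c < ψ t}, interimShare n hn (typeLaw b f) ρ t * f t =
      (1 - (1 - ∫ t in {t | t ∈ Icc 0 b ∧ c < ψ t}, f t) ^ n) / n := by
  have := hf.isProbabilityMeasure
  have hS : MeasurableSet {t | c < ψ (clamp b t)} := measurableSet_lt measurable_const hψm
  have he : {t | t ∈ Icc 0 b ∧ c < ψ t} = Icc 0 b ∩ {t | c < ψ (clamp b t)} := by
    ext t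
    refine and_congr_right fun ht => ?_
    rw [mem_ofPred_eq, clamp_of_mem ht]
  have hm : MeasurableSet {t | t ∈ Icc 0 b ∧ c < ψ t} := he ▸ measurableSet_Icc.inter hS
  have hsub : {t | t ∈ Icc 0 b ∧ c < ψ t} ⊆ Icc 0 b := fun t ht => ht.1
  have hae : ({t | t ∈ Icc 0 b ∧ c < ψ t} : Set ℝ) =ᵐ[typeLaw b f] {t | c < ψ (clamp b t)} := by
    filter_upwards [hf.ae_mem_Icc] with t ht
    rw [he]
    exact propext ⟨fun h => h.2, fun h => ⟨ht, h⟩⟩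
  rw [← hf.setIntegral_typeLaw _ hm hsub, ← hf.measureReal_typeLaw hm hsub, setIntegral_congr_set hae,
    measureReal_congr hae]
  exact setIntegral_interimShare_of_upper hn hρ hS fun x hx y hxy => hx.trans_le (hψ x y hxy)

namespace IsPivot

variable {s ts x₁ x₂ y₁ y₂ : ℝ} (hp : IsPivot b f s ts x₁ x₂ y₁ y₂)
include hp

lemma monotoneOn_rank (τ : ℝ) : MonotoneOn (rank b f ts τ) (Icc 0 b) := by
  intro x hx y hy hxy
  rcases (hp.monotoneOn_ironed hx hy hxy).lt_or_eq with h | h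
  · exact (rank_lt_rank h).le
  · rw [← not_lt, ← ranksBelow_iff]
    rintro (h' | ⟨-, -, h1, h2⟩)
    · exact h'.ne h.symm
    · exact not_le.2 h1 (h2.trans hxy)

lemma measurable_extRank (τ : ℝ) : Measurable (extRank b f ts τ) :=
  measurable_comp_clamp hp.density.pos_b.le (Or.inl (hp.monotoneOn_rank τ))

/-- The ironed value is constant around `t`, and the split `τ`, being a touching point, differs from
`t`. Shrinking the gap to one side of `τ` makes the rank constant too. -/
lemma extRank_gap {τ : ℝ} (hτt : Touches b f ts τ) {t : ℝ} (ht : t ∈ Icc 0 b)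
    (hnt : ¬ Touches b f ts t) :
    ∃ l ∈ Ico 0 t, ∃ r ∈ Ioc t b, ∀ y ∈ Ioo l r, extRank b f ts τ y = extRank b f ts τ t := by
  obtain ⟨l, hl, r, hr, -, -, e⟩ := hp.exists_gap' ht hnt
  have hI : ∀ y ∈ Icc l r, y ∈ Icc 0 b := fun y hy => ⟨hl.1.trans hy.1, hy.2.trans hr.2⟩
  rcases lt_trichotomy τ t with h | rfl | h
  · refine ⟨max l τ, ⟨le_max_of_le_left hl.1, max_lt hl.2 h⟩, r, hr, fun y hy => ?_⟩
    have hy' : y ∈ Icc l r := ⟨(le_max_left _ _).trans hy.1.le, hy.2.le⟩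
    rw [extRank_eq (hI y hy'), extRank_eq ht]
    exact rank_eq_rank (e y hy') (iff_of_true ((le_max_right _ _).trans hy.1.le) h.le)
  · exact absurd hτt hnt
  · refine ⟨l, hl, min r τ, ⟨lt_min hr.1 h, min_le_of_left_le hr.2⟩, fun y hy => ?_⟩
    have hy' : y ∈ Icc l r := ⟨hy.1.le, hy.2.le.trans (min_le_left _ _)⟩
    rw [extRank_eq (hI y hy'), extRank_eq ht]
    exact rank_eq_rank (e y hy') (iff_of_false (not_le.2 (hy.2.trans_le (min_le_right _ _)))
      (not_le.2 h))

end IsPivot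

/-- The interim rules of the priority rule. -/
def priorityInterim (n : ℕ) (hn : 1 ≤ n) (b : ℝ) (f : ℝ → ℝ) (ts τ : ℝ) (j : Fin 2) : ℝ → ℝ :=
  interimShare n hn (typeLaw b f) (if j = 0 then extRank b f ts τ else -extRank b f ts τ)

/-- The interim rules of the rule with withholding. -/
def reserveInterim (n : ℕ) (hn : 1 ≤ n) (b : ℝ) (f : ℝ → ℝ) (ts τ : ℝ) (j : Fin 2) : ℝ → ℝ :=
  if j = 0 then {t | ironedValue b f ts ts < extRank b f ts τ t}.indicator
    (priorityInterim n hn b f ts τ 0) else priorityInterim n hn b f ts τ j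

namespace IsPivot

variable {s ts x₁ x₂ y₁ y₂ : ℝ} (hp : IsPivot b f s ts x₁ x₂ y₁ y₂)
include hp

lemma priorityInterim_congr (hn : 1 ≤ n) {τ y t : ℝ} (h : extRank b f ts τ y = extRank b f ts τ t)
    (j : Fin 2) : priorityInterim n hn b f ts τ j y = priorityInterim n hn b f ts τ j t := by
  have := hp.density.isProbabilityMeasure
  have hm := hp.measurable_extRank τ
  unfold priorityInterim
  split_ifs
  · exact le_antisymm (interimShare_mono hn hm h.le) (interimShare_mono hn hm h.ge)
  · exact le_antisymm (interimShare_mono hn hm.neg (neg_le_neg h.ge))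
      (interimShare_mono hn hm.neg (neg_le_neg h.le))

/-- The ranking refines the order of `φ`, so superlevel sets of `φ` are upper for it and those of `b
- φ` are upper for its reverse. Sharing by rank is thus tight in Border's condition wherever the
surplus bound uses it. -/
lemma isOptimalRule_priority (hn : 1 ≤ n) {τ : ℝ} (hτt : Touches b f ts τ) :
    IsOptimalRule n b f ts (priorityShare b f ts τ) (priorityInterim n hn b f ts τ) := by
  have hf := hp.density
  have hprob := hf.isProbabilityMeasure
  have hb := hf.pos_b.le
  have hm := hp.measurable_extRank τ
  have hmj : ∀ j : Fin 2, Measurable (if j = 0 then extRank b f ts τ else -extRank b f ts τ) :=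
    fun j => by split_ifs; exacts [hm, hm.neg]
  have hle : ∀ y z, extRank b f ts τ y ≤ extRank b f ts τ z →
      ironedValue b f ts (clamp b y) ≤ ironedValue b f ts (clamp b z) := fun y z h =>
    ironedValue_le_of_rank_le h
  have hint : ∀ j, IntegrableOn (fun t => priorityInterim n hn b f ts τ j t * f t) (Icc 0 b) :=
    fun j => by
      have := hf.integrableOn_interim (isAlloc_share hn (hmj j)) ⟨0, hn⟩
      rwa [interim_share hn _ (hmj j)] at this
  constructor
  · exact fun j => isAlloc_share hn (hmj j)
  · exact fun j i => interim_share hn _ (hmj j) i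
  · intro y hy z hz hyz
    refine interimShare_mono hn (hmj 0) ?_
    rw [if_pos rfl, extRank_eq hy, extRank_eq hz]
    exact hp.monotoneOn_rank τ hy hz hyz
  · intro y hy z hz hyz
    refine interimShare_mono hn (hmj 1) ?_
    rw [if_neg (by decide), Pi.neg_apply, Pi.neg_apply, extRank_eq hy, extRank_eq hz]
    exact neg_le_neg (hp.monotoneOn_rank τ hy hz hyz)
  · refine interimShare_pos hn (hmj 1) ?_
    have htI := hp.type_mem_Ioo
    refine (sub_pos.2 (hf.cdf_lt_one ⟨htI.1.le, htI.2⟩)).trans_le ?_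
    rw [← hf.cdf_b, ← hf.measureReal_eq_of_Ioo htI.2.le hp.type_mem hf.b_mem Ioo_subset_Icc_self
      inter_subset_left]
    refine measureReal_mono fun t ht => ?_
    have htb : t ∈ Icc 0 b := ⟨htI.1.le.trans ht.1, ht.2⟩
    simp only [mem_ofPred_eq, if_neg (show (1 : Fin 2) ≠ 0 by decide), Pi.neg_apply]
    rw [extRank_eq htb, extRank_eq hp.type_mem]
    exact neg_le_neg (hp.monotoneOn_rank τ hp.type_mem htb ht.1)
  · intro t ht hnt
    obtain ⟨l, hl, r, hr, e⟩ := hp.extRank_gap hτt ht hnt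
    exact ⟨l, hl, r, hr, fun y hy j => hp.priorityInterim_congr hn (e y hy) j⟩
  · exact hp.integral_ironed_mul_eq hn (hint 0) fun c =>
      hf.setIntegral_interimShare hn (hmj 0) (measurable_comp_clamp hb (Or.inl hp.monotoneOn_ironed))
        (by simpa using hle) c
  · refine hp.integral_sub_ironed_mul_eq hn (hint 1) fun c =>
      hf.setIntegral_interimShare hn (hmj 1)
        (measurable_comp_clamp hb (Or.inr hp.antitoneOn_sub_ironed)) (fun y z h => ?_) c
    simp only [if_neg (show (1 : Fin 2) ≠ 0 by decide), Pi.neg_apply, neg_le_neg_iff] at h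
    exact sub_le_sub_left (hle z y h) b

/-- The types that lose the first item have `φ = 0`, so they carry no weight in the surplus from
that item. Cutting off low ranks also preserves monotonicity. -/
lemma isOptimalRule_reserve (hn : 1 ≤ n) (hs : s = 0) {τ : ℝ} (hτt : Touches b f ts τ) :
    IsOptimalRule n b f ts (reserveShare b f ts τ) (reserveInterim n hn b f ts τ) := by
  have h := hp.isOptimalRule_priority hn hτt
  have hf := hp.density
  have hprob := hf.isProbabilityMeasure
  have hm := hp.measurable_extRank τ
  have e1 : reserveShare (n := n) b f ts τ 1 = priorityShare b f ts τ 1 := by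
    ext i : 1; simp [reserveShare]
  have e2 : reserveInterim n hn b f ts τ 1 = priorityInterim n hn b f ts τ 1 := by
    simp [reserveInterim]
  have e3 : ∀ i : Fin n, reserveShare (n := n) b f ts τ 0 i =
      {s | ironedValue b f ts ts < extRank b f ts τ (s i)}.indicator (priorityShare b f ts τ 0 i) :=
    fun i => by simp [reserveShare]
  have e4 : reserveInterim n hn b f ts τ 0 =
      {t | ironedValue b f ts ts < extRank b f ts τ t}.indicator (priorityInterim n hn b f ts τ 0) := by
    simp [reserveInterim]
  have h0 : ∀ t, 0 ≤ priorityInterim n hn b f ts τ 0 t := fun t => by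
    rw [← h.interim_eq 0 ⟨0, hn⟩]; exact (h.alloc 0).interim_nonneg _ _
  constructor
  · rw [Fin.forall_fin_two, e1]
    refine ⟨⟨fun i => ?_, fun i s => ?_, fun s => ?_⟩, h.alloc 1⟩
    · rw [e3]
      exact ((h.alloc 0).measurable i).indicator
        (measurableSet_lt measurable_const (hm.comp (measurable_pi_apply i)))
    · rw [e3]
      exact indicator_nonneg (fun s _ => (h.alloc 0).nonneg i s) s
    · refine (Finset.sum_le_sum fun i _ => ?_).trans ((h.alloc 0).sum_le s)
      rw [e3]
      exact indicator_le_self' (fun s _ => (h.alloc 0).nonneg i s) s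
  · rw [Fin.forall_fin_two, e1, e2]
    refine ⟨fun i => ?_, h.interim_eq 1⟩
    ext t
    rw [e3, e4, ← h.interim_eq 0 i]
    simp only [interim, indicator, mem_ofPred_eq, Function.update_self]
    split_ifs
    · rfl
    · exact integral_zero _ _
  · rw [e4]
    intro y hy z hz hyz
    by_cases hyr : ironedValue b f ts ts < extRank b f ts τ y
    · have hyz' : extRank b f ts τ y ≤ extRank b f ts τ z := by
        rw [extRank_eq hy, extRank_eq hz]; exact hp.monotoneOn_rank τ hy hz hyz
      rw [indicator_of_mem (show y ∈ {t | ironedValue b f ts ts < extRank b f ts τ t} from hyr),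
        indicator_of_mem (show z ∈ {t | ironedValue b f ts ts < extRank b f ts τ t} from hyr.trans_le hyz')]
      exact h.monotone hy hz hyz
    · rw [indicator_of_notMem (show y ∉ {t | ironedValue b f ts ts < extRank b f ts τ t} from hyr)]
      exact indicator_nonneg (fun t _ => h0 t) z
  · rw [e2]; exact h.antitone
  · rw [e2]; exact h.pos
  · intro t ht hnt
    obtain ⟨l, hl, r, hr, e⟩ := hp.extRank_gap hτt ht hnt
    refine ⟨l, hl, r, hr, fun y hy => ?_⟩
    rw [Fin.forall_fin_two, e2, e4]
    refine ⟨?_, hp.priorityInterim_congr hn (e y hy) 1⟩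
    simp only [indicator, mem_ofPred_eq, e y hy, hp.priorityInterim_congr hn (e y hy) 0]
  · rw [← h.surplus_one]
    refine setIntegral_congr_fun measurableSet_Icc fun t ht => ?_
    simp only [e4, indicator, mem_ofPred_eq]
    split_ifs with hr
    · rfl
    · rw [extRank_eq ht, hp.ironed_type, hs, not_lt] at hr
      have h1 : ironedValue b f ts t = 0 := by
        refine le_antisymm (le_trans ?_ hr) (hp.ironed_mem ht).1
        unfold rank
        split_ifs <;> linarith
      rw [h1, zero_mul, zero_mul]
  · rw [e2]; exact h.surplus_two

/-- For `s = 0` no type has a smaller ironed value. The rank test therefore excludes exactly the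
types of pivotal value below the split; those above it pass thanks to the unit bonus in their rank.
-/
lemma reserveAlloc_eq (hs : s = 0) {τ : ℝ} (j : Fin 2) (i : Fin n) {r : Fin n → ℝ}
    (hr : r ∈ profiles n b) : reserveAlloc b f ts τ j i r = reserveShare b f ts τ j i r := by
  rw [reserveAlloc, reserveShare, priorityAlloc_eq j i hr]
  by_cases hj : j = 0
  · subst hj
    simp only [true_and, if_true, indicator, mem_ofPred_eq, extRank_eq (hr i)]
    have h0 : ironedValue b f ts ts ≤ ironedValue b f ts (r i) := by
      rw [hp.ironed_type, hs]; exact (hp.ironed_mem (hr i)).1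
    split_ifs with h1 h2 h2
    · rw [rank_of_lt h1.1 h1.2] at h2
      exact absurd h2 (lt_irrefl _)
    · rfl
    · rfl
    · exfalso
      rcases h0.lt_or_eq with h3 | h3
      · rw [rank_of_gt h3] at h2; linarith
      · refine h1 ⟨h3.symm, not_le.1 fun h4 => h2 ?_⟩
        rw [rank_of_le h3.symm h4]; linarith
  · simp [hj]

end IsPivot

end TwoItemAuction

end

noncomputable section

namespace TwoItemAuction

variable {n : ℕ} {b : ℝ} {f : ℝ → ℝ}

/-! ### The slope of the interim utility at the pivotal type -/

/-- The convex function whose increments determine the slope of the interim utility at the pivotal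
type under a priority rule. -/
def slopePotential (n : ℕ) (a z : ℝ) : ℝ := z ^ n + (1 - z) ^ n / a

lemma continuous_slopePotential (n : ℕ) (a : ℝ) : Continuous (slopePotential n a) := by
  unfold slopePotential; fun_prop

lemma convexOn_slopePotential (n : ℕ) {a : ℝ} (ha : 0 < a) :
    ConvexOn ℝ (Icc 0 1) (slopePotential n a) := by
  have h1 : ConvexOn ℝ (Icc (0 : ℝ) 1) fun z : ℝ => z ^ n :=
    (convexOn_pow n).subset Icc_subset_Ici_self (convex_Icc 0 1)
  refine h1.add ⟨convex_Icc 0 1, fun x hx y hy c d hc hd hcd => ?_⟩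
  have hx' : 1 - x ∈ Icc (0 : ℝ) 1 := ⟨by linarith [hx.2], by linarith [hx.1]⟩
  have hy' : 1 - y ∈ Icc (0 : ℝ) 1 := ⟨by linarith [hy.2], by linarith [hy.1]⟩
  have h := h1.2 hx' hy' hc hd hcd
  have e : c • (1 - x) + d • (1 - y) = 1 - (c • x + d • y) := by
    simp only [smul_eq_mul]; linear_combination hcd
  simp only at h
  rw [e] at h
  simp only [smul_eq_mul] at h ⊢
  refine (div_le_div_of_nonneg_right h ha.le).trans (le_of_eq ?_)
  ring

/-- The place where `a ≥ 1` matters: it lets a term `(1 - z)^n / a` be bounded by `1 - z`, while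
`z^n ≤ z`. -/
lemma slopePotential_le_one (n : ℕ) {a z : ℝ} (ha : 1 ≤ a) (hn : 1 ≤ n) (hz : z ∈ Icc (0 : ℝ) 1) :
    slopePotential n a z ≤ slopePotential n a 1 := by
  have ha0 : 0 < a := by linarith
  have h1 : z ^ n ≤ z := pow_le_of_le_one hz.1 hz.2 (by omega)
  have h2 : (1 - z) ^ n ≤ 1 - z := pow_le_of_le_one (by linarith [hz.2]) (by linarith [hz.1]) (by omega)
  have h3 : (1 - z) ^ n / a ≤ 1 - z :=
    (div_le_self (pow_nonneg (by linarith [hz.2]) _) ha).trans h2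
  have h4 : slopePotential n a 1 = 1 := by
    simp [slopePotential, show n ≠ 0 by omega]
  rw [h4, slopePotential]
  linarith

/-- Once a convex function has not decreased from `x` to `y`, it is bounded by `g y` between them
and does not fall below beyond `y`. The comparison thus survives moving both points to the right. -/
lemma le_of_convexOn_of_shift_right {g : ℝ → ℝ} {s : Set ℝ} (hg : ConvexOn ℝ s g) {x x' y y' : ℝ}
    (hx : x ∈ s) (hx' : x' ∈ s) (hy : y ∈ s) (hy' : y' ∈ s) (h1 : x ≤ x') (h2 : y ≤ y')
    (hxy : x' < y) (h : g x ≤ g y) : g x' ≤ g y' := by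
  have h3 : g x' ≤ g y := (hg.le_max_of_mem_Icc hx hy ⟨h1, hxy.le⟩).trans (max_eq_right h).le
  rcases h2.eq_or_lt with rfl | h2
  · exact h3
  · refine h3.trans (hg.le_right_of_left_le hx' hy' ?_ h3)
    rw [openSegment_eq_Ioo (hxy.trans h2)]
    exact ⟨hxy, h2⟩

lemma le_of_convexOn_of_shift_left {g : ℝ → ℝ} {s : Set ℝ} (hg : ConvexOn ℝ s g) {x x' y y' : ℝ}
    (hx : x ∈ s) (hx' : x' ∈ s) (hy : y ∈ s) (hy' : y' ∈ s) (h1 : x' ≤ x) (h2 : y' ≤ y)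
    (hxy : x < y') (h : g y ≤ g x) : g y' ≤ g x' := by
  have h3 : g y' ≤ g x := (hg.le_max_of_mem_Icc hx hy ⟨hxy.le, h2⟩).trans (max_eq_left h).le
  rcases h1.eq_or_lt with rfl | h1
  · exact h3
  · refine h3.trans (hg.le_left_of_right_le hx' hy' ?_ h3)
    rw [openSegment_eq_Ioo (h1.trans hxy)]
    exact ⟨h1, hxy⟩

namespace IsPivot

variable {s ts x₁ x₂ y₁ y₂ : ℝ} (hp : IsPivot b f s ts x₁ x₂ y₁ y₂)
include hp

/-- The tie class of the pivotal type has mass `r - p`. The second item uses the reversed ranking,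
for which the two masses become `1 - r` and `1 - p`; the two instances of `interimShare_mul` combine
to an increment of `slopePotential`. -/
lemma slope_mul (hn : 1 ≤ n) (a : ℝ) {τ p r : ℝ}
    (h1 : (typeLaw b f).real {x | extRank b f ts τ x < extRank b f ts τ ts} = p)
    (h2 : (typeLaw b f).real {x | extRank b f ts τ x ≤ extRank b f ts τ ts} = r) :
    (priorityInterim n hn b f ts τ 0 ts - priorityInterim n hn b f ts τ 1 ts / a) * (n * (r - p)) =
      slopePotential n a r - slopePotential n a p := by
  have := hp.density.isProbabilityMeasure
  have hm := hp.measurable_extRank τ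
  have e0 := interimShare_mul (μ := typeLaw b f) hn hm ts
  have e1 := interimShare_mul (μ := typeLaw b f) hn hm.neg ts
  have c1 : {x | (-extRank b f ts τ) x ≤ (-extRank b f ts τ) ts} =
      {x | extRank b f ts τ x < extRank b f ts τ ts}ᶜ := by ext x; simp
  have c2 : {x | (-extRank b f ts τ) x < (-extRank b f ts τ) ts} =
      {x | extRank b f ts τ x ≤ extRank b f ts τ ts}ᶜ := by ext x; simp
  rw [c1, c2, probReal_compl_eq_one_sub (measurableSet_lt hm measurable_const),
    probReal_compl_eq_one_sub (measurableSet_le hm measurable_const), h1, h2] at e1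
  rw [h1, h2] at e0
  simp only [priorityInterim, if_true, if_neg (show (1 : Fin 2) ≠ 0 by decide), slopePotential]
  linear_combination e0 - e1 / a

/-- With the split at `y₁`, the type `ts` ties with `[x₁, y₁)`: smaller types have a smaller ironed
value, and those from `y₁` on receive the bonus. -/
lemma slope_right (hn : 1 ≤ n) (a : ℝ) :
    (priorityInterim n hn b f ts y₁ 0 ts - priorityInterim n hn b f ts y₁ 1 ts / a) *
      (n * (cdf f y₁ - cdf f x₁)) =
        slopePotential n a (cdf f y₁) - slopePotential n a (cdf f x₁) := by
  have hf := hp.density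
  have hts : extRank b f ts y₁ ts = s := by
    rw [extRank_eq hp.type_mem, rank_of_lt rfl hp.lt_y₁, hp.ironed_type]
  refine hp.slope_mul hn a ?_ ?_
  · rw [hts, hf.measureReal_eq_of_Ioo hp.x₁_mem.1 hf.zero_mem hp.x₁_mem, hf.cdf_zero, sub_zero]
    · intro t ht
      have htI : t ∈ Icc 0 b := ⟨ht.1.le, ht.2.le.trans hp.x₁_mem.2⟩
      have h := hp.ironed_lt ⟨ht.1.le, ht.2⟩
      rw [mem_ofPred_eq, extRank_eq htI, rank_of_value_lt (by rwa [hp.ironed_type])]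
      exact h
    · rintro t ⟨ht, htI⟩
      refine ⟨htI.1, not_lt.1 fun h => ?_⟩
      rw [mem_ofPred_eq, extRank_eq htI] at ht
      have h2 := hp.monotoneOn_rank y₁ hp.x₁_mem htI h.le
      have h3 : ironedValue b f ts x₁ = s :=
        hp.ironed_eq ⟨le_rfl, hp.x₁_lt_y₂.le⟩
      rw [rank_of_lt (by rw [h3, hp.ironed_type])
        ((hp.x₁_le_x₂.trans_lt hp.x₂_lt).trans hp.lt_y₁), hp.ironed_type] at h2
      linarith
  · rw [hts, hf.measureReal_eq_of_Ioo hp.y₁_mem.1 hf.zero_mem hp.y₁_mem, hf.cdf_zero, sub_zero]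
    · intro t ht
      have htI : t ∈ Icc 0 b := ⟨ht.1.le, ht.2.le.trans hp.y₁_mem.2⟩
      rw [mem_ofPred_eq, extRank_eq htI, ← hts, extRank_eq hp.type_mem]
      rcases le_total t ts with h | h
      · exact hp.monotoneOn_rank y₁ htI hp.type_mem h
      · refine le_of_eq (rank_eq_rank ?_ (iff_of_false (not_le.2 ht.2) (not_le.2 hp.lt_y₁)))
        rw [hp.ironed_type, hp.ironed_eq ⟨hp.type_mem_level.1.trans h, ht.2.le.trans hp.y₁_le_y₂⟩]
    · rintro t ⟨ht, htI⟩
      refine ⟨htI.1, not_lt.1 fun h => ?_⟩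
      rw [mem_ofPred_eq, extRank_eq htI] at ht
      have h2 := hp.monotoneOn_rank y₁ hp.y₁_mem htI h.le
      rw [rank_of_le (by rw [hp.ironed_type, hp.ironed_eq
        ⟨hp.type_mem_level.1.trans hp.lt_y₁.le, hp.y₁_le_y₂⟩]) le_rfl, hp.ironed_type] at h2
      linarith

/-- With the split at `x₂`, the type `ts` receives the bonus and ties with `[x₂, y₂]`; beyond `y₂`
the ironed value is larger. -/
lemma slope_left (hn : 1 ≤ n) (a : ℝ) :
    (priorityInterim n hn b f ts x₂ 0 ts - priorityInterim n hn b f ts x₂ 1 ts / a) *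
      (n * (cdf f y₂ - cdf f x₂)) =
        slopePotential n a (cdf f y₂) - slopePotential n a (cdf f x₂) := by
  have hf := hp.density
  have hts : extRank b f ts x₂ ts = s + 1 := by
    rw [extRank_eq hp.type_mem, rank_of_le rfl hp.x₂_lt.le, hp.ironed_type]
  have hx₂ : ironedValue b f ts x₂ = ironedValue b f ts ts := by
    rw [hp.ironed_type, hp.ironed_eq ⟨hp.x₁_le_x₂, hp.x₂_lt.le.trans hp.type_mem_level.2⟩]
  refine hp.slope_mul hn a ?_ ?_
  · rw [hts, hf.measureReal_eq_of_Ioo hp.x₂_mem.1 hf.zero_mem hp.x₂_mem, hf.cdf_zero, sub_zero]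
    · intro t ht
      have htI : t ∈ Icc 0 b := ⟨ht.1.le, ht.2.le.trans hp.x₂_mem.2⟩
      rw [mem_ofPred_eq, extRank_eq htI]
      rcases (hp.monotoneOn_ironed htI hp.type_mem (ht.2.trans hp.x₂_lt).le).lt_or_eq with h | h
      · rw [rank_of_value_lt h, ← hp.ironed_type]; linarith
      · rw [rank_of_lt h ht.2, hp.ironed_type]; linarith
    · rintro t ⟨ht, htI⟩
      refine ⟨htI.1, not_lt.1 fun h => ?_⟩
      rw [mem_ofPred_eq, extRank_eq htI] at ht
      have h2 := hp.monotoneOn_rank x₂ hp.x₂_mem htI h.le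
      rw [rank_of_le hx₂ le_rfl, hp.ironed_type] at h2
      linarith
  · rw [hts, hf.measureReal_eq_of_Ioo hp.y₂_mem.1 hf.zero_mem hp.y₂_mem, hf.cdf_zero, sub_zero]
    · intro t ht
      have htI : t ∈ Icc 0 b := ⟨ht.1.le, ht.2.le.trans hp.y₂_mem.2⟩
      rw [mem_ofPred_eq, extRank_eq htI, ← hts, extRank_eq hp.type_mem]
      rcases le_total t ts with h | h
      · exact hp.monotoneOn_rank x₂ htI hp.type_mem h
      · refine le_of_eq (rank_eq_rank ?_ (iff_of_true (hp.x₂_lt.le.trans h) hp.x₂_lt.le))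
        rw [hp.ironed_type, hp.ironed_eq ⟨hp.type_mem_level.1.trans h, ht.2.le⟩]
    · rintro t ⟨ht, htI⟩
      refine ⟨htI.1, not_lt.1 fun h => ?_⟩
      have h2 := hp.lt_ironed ⟨h, htI.2⟩
      rw [mem_ofPred_eq, extRank_eq htI, rank_of_gt (by rwa [hp.ironed_type])] at ht
      linarith

end IsPivot

/-! ### The choice of the pivotal type -/

/-- The triples of a slope and its two maximizers form a compact set, of which this set is a
projection. Allowing arbitrary maximizers matters here: the extreme ones need not vary continuously.
-/
lemma IsTypeDensity.isClosed_slopes (hf : IsTypeDensity b f) {G : ℝ → ℝ → ℝ}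
    (hG : Continuous fun p : ℝ × ℝ => G p.1 p.2) :
    IsClosed {s | s ∈ Icc 0 b ∧ ∃ x ∈ leftMax b f s, ∃ y ∈ rightMax b f s,
      G (cdf f x) (cdf f y) ≤ 0} := by
  have hb := hf.pos_b.le
  set F : ℝ → ℝ := fun t => cdf f (clamp b t) with hF
  have hFc : Continuous F := hf.continuousOn_cdf.comp_continuous (continuous_clamp b) (clamp_mem hb)
  have hFe : ∀ t ∈ Icc 0 b, F t = cdf f t := fun t ht => by rw [hF]; simp only [clamp_of_mem ht]
  set K : Set (ℝ × ℝ × ℝ) := {p | (p.1 ∈ Icc 0 b ∧ p.2.1 ∈ Icc 0 b ∧ p.2.2 ∈ Icc 0 b) ∧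
    (∀ t ∈ Icc 0 b, (p.1 - t) * F t ≤ (p.1 - p.2.1) * F p.2.1) ∧
    (∀ t ∈ Icc 0 b, (t - p.1) * (1 - F t) ≤ (p.2.2 - p.1) * (1 - F p.2.2)) ∧
    G (F p.2.1) (F p.2.2) ≤ 0} with hK
  have hKc : IsCompact K := by
    refine (isCompact_Icc.prod (isCompact_Icc.prod isCompact_Icc) :
      IsCompact (Icc 0 b ×ˢ (Icc 0 b ×ˢ Icc 0 b))).of_isClosed_subset ?_ fun p hp => hp.1
    have c1 : IsClosed (Icc 0 b ×ˢ (Icc 0 b ×ˢ Icc 0 b)) :=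
      isClosed_Icc.prod (isClosed_Icc.prod isClosed_Icc)
    have c2 : IsClosed {p : ℝ × ℝ × ℝ | ∀ t ∈ Icc 0 b, (p.1 - t) * F t ≤ (p.1 - p.2.1) * F p.2.1} := by
      simp only [ofPred_forall]
      exact isClosed_iInter fun t => isClosed_iInter fun _ => isClosed_le (by fun_prop) (by fun_prop)
    have c3 : IsClosed {p : ℝ × ℝ × ℝ | ∀ t ∈ Icc 0 b,
        (t - p.1) * (1 - F t) ≤ (p.2.2 - p.1) * (1 - F p.2.2)} := by
      simp only [ofPred_forall]
      exact isClosed_iInter fun t => isClosed_iInter fun _ => isClosed_le (by fun_prop) (by fun_prop)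
    have c4 : IsClosed {p : ℝ × ℝ × ℝ | G (F p.2.1) (F p.2.2) ≤ 0} :=
      isClosed_le (hG.comp ((hFc.comp (continuous_fst.comp continuous_snd)).prodMk
        (hFc.comp (continuous_snd.comp continuous_snd)))) continuous_const
    exact c1.inter (c2.inter (c3.inter c4))
  have himg : {s | s ∈ Icc 0 b ∧ ∃ x ∈ leftMax b f s, ∃ y ∈ rightMax b f s,
      G (cdf f x) (cdf f y) ≤ 0} = Prod.fst '' K := by
    ext s
    constructor
    · rintro ⟨hs, x, hx, y, hy, h⟩
      refine ⟨(s, x, y), ⟨⟨hs, hx.1, hy.1⟩, fun t ht => ?_, fun t ht => ?_, ?_⟩, rfl⟩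
      · simp only [hFe t ht, hFe x hx.1]; exact hx.2 t ht
      · simp only [hFe t ht, hFe y hy.1]; exact hy.2 t ht
      · simp only [hFe x hx.1, hFe y hy.1]; exact h
    · rintro ⟨⟨s', x, y⟩, ⟨⟨hs, hx, hy⟩, h1, h2, h3⟩, rfl⟩
      simp only at hs hx hy h1 h2 h3
      refine ⟨hs, x, ⟨hx, fun t ht => ?_⟩, y, ⟨hy, fun t ht => ?_⟩, ?_⟩
      · rw [← hFe t ht, ← hFe x hx]; exact h1 t ht
      · rw [← hFe t ht, ← hFe y hy]; exact h2 t ht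
      · rw [← hFe x hx, ← hFe y hy]; exact h3
  rw [himg]
  exact (hKc.image continuous_fst).isClosed

/-- A pivotal type for which either the two priority rules induce slopes of opposite sign, or the
ironed virtual value is zero and the priority rule with the right split induces a nonnegative slope. -/
lemma IsTypeDensity.exists_balanced_pivot (hf : IsTypeDensity b f) (hn : 1 ≤ n) {a : ℝ} (ha : 1 ≤ a) :
    ∃ s ts x₁ x₂ y₁ y₂, IsPivot b f s ts x₁ x₂ y₁ y₂ ∧
      ((slopePotential n a (cdf f y₁) ≤ slopePotential n a (cdf f x₁) ∧
          slopePotential n a (cdf f x₂) ≤ slopePotential n a (cdf f y₂)) ∨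
        (s = 0 ∧ slopePotential n a (cdf f x₁) ≤ slopePotential n a (cdf f y₁))) := by
  have hb := hf.pos_b.le
  have ha0 : 0 < a := by linarith
  have hP := continuous_slopePotential n a
  have hconv := convexOn_slopePotential n ha0
  have hmono := hf.strictMonoOn_cdf
  set P := slopePotential n a
  set A := {s | s ∈ Icc 0 b ∧ ∃ x ∈ leftMax b f s, ∃ y ∈ rightMax b f s,
    P (cdf f y) - P (cdf f x) ≤ 0} with hA
  set B := {s | s ∈ Icc 0 b ∧ ∃ x ∈ leftMax b f s, ∃ y ∈ rightMax b f s,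
    P (cdf f x) - P (cdf f y) ≤ 0} with hB
  have hAc : IsClosed A := hf.isClosed_slopes (G := fun x y => P y - P x) (by fun_prop)
  have hBc : IsClosed B := hf.isClosed_slopes (G := fun x y => P x - P y) (by fun_prop)
  by_cases h0 : (0 : ℝ) ∈ A
  -- Two closed sets that cover an interval and both meet it have a common point in it.
  · have hcover : Icc 0 b ⊆ A ∪ B := fun s hs => by
      obtain ⟨x, hx⟩ := (hf.leftMax_compact s).2
      obtain ⟨y, hy⟩ := (hf.rightMax_compact s).2
      rcases le_total (P (cdf f y)) (P (cdf f x)) with h | h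
      · exact Or.inl ⟨hs, x, hx, y, hy, sub_nonpos.2 h⟩
      · exact Or.inr ⟨hs, x, hx, y, hy, sub_nonpos.2 h⟩
    -- At slope `b` the type `b` itself maximizes on the right, and the potential is largest at
    -- `F(b) = 1`.
    have hbB : b ∈ B := by
      obtain ⟨x, hx⟩ := (hf.leftMax_compact b).2
      refine ⟨hf.b_mem, x, hx, b, ⟨hf.b_mem, fun t ht => ?_⟩, ?_⟩
      · rw [sub_self, zero_mul]
        exact mul_nonpos_of_nonpos_of_nonneg (by linarith [ht.2]) (by linarith [(hf.cdf_mem ht).2])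
      · rw [hf.cdf_b, sub_nonpos]
        exact slopePotential_le_one n ha hn (hf.cdf_mem hx.1)
    obtain ⟨s, hs, ⟨-, x, hx, y, hy, h⟩, ⟨-, x', hx', y', hy', h'⟩⟩ :=
      isPreconnected_closed_iff.1 isPreconnected_Icc A B hAc hBc hcover ⟨0, hf.zero_mem, h0⟩
        ⟨b, hf.b_mem, hbB⟩
    obtain ⟨ts, x₁, x₂, y₁, y₂, hp⟩ := hf.exists_isPivot hs
    refine ⟨s, ts, x₁, x₂, y₁, y₂, hp, Or.inl ⟨?_, ?_⟩⟩
    -- Membership in `A` and in `B` may come from different contacts; convexity moves the first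
    -- comparison to the least ones and the second to the greatest ones.
    · refine le_of_convexOn_of_shift_left hconv (hf.cdf_mem hx.1) (hf.cdf_mem hp.x₁_mem)
        (hf.cdf_mem hy.1) (hf.cdf_mem hp.y₁_mem) ?_ ?_ ?_ (sub_nonpos.1 h)
      · exact hmono.monotoneOn hp.x₁_mem hx.1 (hp.x₁_least.2 hx)
      · exact hmono.monotoneOn hp.y₁_mem hy.1 (hp.y₁_least.2 hy)
      · exact hmono hx.1 hp.y₁_mem (hf.leftMax_lt_rightMax hs hx hp.y₁_least.1)
    · refine le_of_convexOn_of_shift_right hconv (hf.cdf_mem hx'.1) (hf.cdf_mem hp.x₂_mem)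
        (hf.cdf_mem hy'.1) (hf.cdf_mem hp.y₂_mem) ?_ ?_ ?_ (sub_nonpos.1 h')
      · exact hmono.monotoneOn hx'.1 hp.x₂_mem (hp.x₂_greatest.2 hx')
      · exact hmono.monotoneOn hy'.1 hp.y₂_mem (hp.y₂_greatest.2 hy')
      · exact hmono hp.x₂_mem hy'.1 (hf.leftMax_lt_rightMax hs hp.x₂_greatest.1 hy')
  · obtain ⟨ts, x₁, x₂, y₁, y₂, hp⟩ := hf.exists_isPivot hf.zero_mem
    refine ⟨0, ts, x₁, x₂, y₁, y₂, hp, Or.inr ⟨rfl, ?_⟩⟩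
    by_contra! hc
    exact h0 ⟨hf.zero_mem, x₁, hp.x₁_least.1, y₁, hp.y₁_least.1, sub_nonpos.2 hc.le⟩

end TwoItemAuction

end

/-! ### Balancing two extreme rules -/

noncomputable section

namespace TwoItemAuction

variable {n : ℕ} {b : ℝ} {f : ℝ → ℝ}

lemma exists_balancing_weight {c d : ℝ} (hc : c ≤ 0) (hd : 0 ≤ d) :
    ∃ α ∈ Icc (0 : ℝ) 1, α * c + (1 - α) * d = 0 := by
  rcases hc.eq_or_lt with rfl | hc
  · exact ⟨1, by simp, by simp⟩
  · have h : 0 < d - c := by linarith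
    refine ⟨d / (d - c), ⟨div_nonneg hd h.le, (div_le_one h).2 (by linarith)⟩, ?_⟩
    field_simp
    ring

/-- Two optimal rules that induce slopes of opposite sign at the pivotal type. -/
lemma IsTypeDensity.exists_balanced_rules (hf : IsTypeDensity b f) (hn : 1 ≤ n) {a : ℝ}
    (ha : 1 ≤ a) :
    ∃ s ts x₁ x₂ y₁ y₂, IsPivot b f s ts x₁ x₂ y₁ y₂ ∧
      ∃ A B : Fin 2 → Fin n → (Fin n → ℝ) → ℝ, IsExtremePair b f ts A B ∧
      ∃ A' B' : Fin 2 → Fin n → (Fin n → ℝ) → ℝ, ∃ p q : Fin 2 → ℝ → ℝ,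
        (∀ j i, ∀ r ∈ profiles n b, A j i r = A' j i r ∧ B j i r = B' j i r) ∧
        IsOptimalRule n b f ts A' p ∧ IsOptimalRule n b f ts B' q ∧
        p 0 ts - p 1 ts / a ≤ 0 ∧ 0 ≤ q 0 ts - q 1 ts / a := by
  obtain ⟨s, ts, x₁, x₂, y₁, y₂, hp, h⟩ := hf.exists_balanced_pivot hn ha
  have ha0 : 0 < a := by linarith
  have hn0 : (0 : ℝ) < n := by positivity
  have hr := hp.isOptimalRule_priority hn (hp.touches_right hp.y₁_least.1)
  have hl := hp.isOptimalRule_priority hn (hp.touches_left hp.x₂_greatest.1)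
  have er := hp.slope_right hn a
  have el := hp.slope_left hn a
  have pr : 0 < n * (cdf f y₁ - cdf f x₁) := mul_pos hn0 (sub_pos.2 (hf.strictMonoOn_cdf hp.x₁_mem
    hp.y₁_mem ((hp.lt_type hp.x₁_least.1).trans hp.lt_y₁)))
  have pl : 0 < n * (cdf f y₂ - cdf f x₂) := mul_pos hn0 (sub_pos.2 (hf.strictMonoOn_cdf hp.x₂_mem
    hp.y₂_mem (hp.x₂_lt.trans (hp.type_lt hp.y₂_greatest.1))))
  refine ⟨s, ts, x₁, x₂, y₁, y₂, hp, ?_⟩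
  rcases h with ⟨h1, h2⟩ | ⟨hs, h1⟩
  · refine ⟨_, _, Or.inl ⟨rfl, rfl⟩, _, _, _, _, fun j i r hr => ?_, hr, hl, ?_, ?_⟩
    · rw [hp.rightSplit_eq, hp.leftSplit_eq]
      exact ⟨priorityAlloc_eq j i hr, priorityAlloc_eq j i hr⟩
    · exact nonpos_of_mul_nonpos_left (er.trans_le (sub_nonpos.2 h1)) pr
    · exact nonneg_of_mul_nonneg_left (el ▸ sub_nonneg.2 h2) pl
  · refine ⟨_, _, Or.inr ⟨hp.ironed_type.trans hs, rfl, rfl⟩, _, _, _, _, fun j i r hr => ?_,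
      hp.isOptimalRule_reserve hn hs (hp.touches_right hp.y₁_least.1), hr, ?_, ?_⟩
    · rw [hp.rightSplit_eq]
      exact ⟨hp.reserveAlloc_eq hs j i hr, priorityAlloc_eq j i hr⟩
    -- The pivotal type lies below the split `y₁`, so its rank is exactly the pivotal value and
    -- fails the strict test. Only the second item is left, and it can only lower the slope.
    · have e0 : reserveInterim n hn b f ts y₁ 0 ts = 0 := by
        rw [reserveInterim, if_pos rfl]
        refine indicator_of_notMem ?_ _
        rw [mem_ofPred_eq, extRank_eq hp.type_mem, rank_of_lt rfl hp.lt_y₁]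
        exact lt_irrefl _
      rw [e0, zero_sub, neg_nonpos]
      exact div_nonneg hr.pos.le ha0.le
    · exact nonneg_of_mul_nonneg_left (er ▸ sub_nonneg.2 h1) pr

end TwoItemAuction

end

theorem mainTheorem3 (n : ℕ) (hn : 1 ≤ n) (a b : ℝ) (ha : 1 ≤ a) (hb : 0 < b)
    (f : ℝ → ℝ) (hf : DifferentiableOn ℝ f (Icc 0 b)) (hpos : ∀ t ∈ Ioo (0 : ℝ) b, 0 < f t)
    (hint : (∫ t in (0 : ℝ)..b, f t) = 1) :
    ∃ tstar ∈ Icc (0 : ℝ) b, ∃ q1 q2 u : ℝ → ℝ,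
      -- the interim rules are feasible, `u ≥ 0` and `u' = q¹ - q² / a`; the minimum of `u` is at `t*`
      TwoItemAuction.IsReducedFeasible n a b f q1 q2 u ∧ u tstar = 0 ∧
      -- the allocation-independent bound holds for all Border-feasible rules and is attained
      (∀ p1 p2 : ℝ → ℝ, TwoItemAuction.IsBorderFeasible n b f p1 →
        TwoItemAuction.IsBorderFeasible n b f p2 →
        TwoItemAuction.ironedSurplus a b f tstar p1 p2 ≤
          TwoItemAuction.revenueBound n a b f tstar) ∧
      TwoItemAuction.reducedRevenue a b f q1 q2 u = TwoItemAuction.revenueBound n a b f tstar ∧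
      -- implementation by an optimal mechanism
      ∃ M : TwoItemAuction.Mechanism n b f,
        (∀ i, ∀ t ∈ Icc (0 : ℝ) b, M.interimAlloc 0 i t = q1 t ∧ M.interimAlloc 1 i t = q2 t ∧
          M.interimUtility a i t t = u t) ∧
        M.IsBIC a ∧ M.IsInterimIR a ∧ M.IsExPostIR a ∧
        M.revenue = n * TwoItemAuction.revenueBound n a b f tstar ∧
        (∀ M' : TwoItemAuction.Mechanism n b f, M'.IsBIC a → M'.IsInterimIR a →
          M'.revenue ≤ M.revenue) ∧
        -- the allocation is a randomization between two extreme allocation rules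
        (∃ α ∈ Icc (0 : ℝ) 1, ∃ A B : Fin 2 → Fin n → (Fin n → ℝ) → ℝ,
          TwoItemAuction.IsExtremePair b f tstar A B ∧
          ∀ j i, ∀ s ∈ TwoItemAuction.profiles n b,
            M.alloc j i s = α * A j i s + (1 - α) * B j i s) ∧
        -- the payment rule
        ∀ i, ∀ s ∈ TwoItemAuction.profiles n b,
          0 < s i * q1 (s i) + (b - s i) / a * q2 (s i) ∧
          M.pay i s = (1 - u (s i) / (s i * q1 (s i) + (b - s i) / a * q2 (s i))) *
            (s i * M.alloc 0 i s + (b - s i) / a * M.alloc 1 i s) := by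
  have hd : TwoItemAuction.IsTypeDensity b f := ⟨hb, hf, hpos, hint⟩
  have ha0 : 0 < a := by linarith
  obtain ⟨s, ts, x₁, x₂, y₁, y₂, hp, A, B, hAB, A', B', p, q, heq, hA, hB, hA0, hB0⟩ :=
    hd.exists_balanced_rules hn ha
  obtain ⟨α, hα, hbal⟩ := TwoItemAuction.exists_balancing_weight hA0 hB0
  have hopt := hA.mix hn hp hB hα
  set x : Fin 2 → Fin n → (Fin n → ℝ) → ℝ := fun j i r => α * A' j i r + (1 - α) * B' j i r with hx
  set Q : Fin 2 → ℝ → ℝ := fun j t => α * p j t + (1 - α) * q j t with hQ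
  -- The slope is linear in the rule, so the balancing weight makes it vanish at the pivotal type.
  have hslope : Q 0 ts - Q 1 ts / a = 0 := by rw [← hbal]; simp only [hQ]; ring
  obtain ⟨u, hu, huts, hu0, hden, M, hMx, hMi, hbic, hir, hex, hrev, hpay⟩ :=
    hd.exists_mechanism hn ha0 hopt.alloc hopt.interim_eq (hopt.measurable hn hd) hopt.monotone
      hopt.antitone hp.type_mem_Ioo hslope hopt.pos
  have hred : TwoItemAuction.reducedRevenue a b f (Q 0) (Q 1) u =
      TwoItemAuction.revenueBound n a b f ts := by
    rw [hp.reducedRevenue_eq hu (fun _ _ => rfl) (hopt.integrableOn hn hd 1),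
      hp.integral_mul_sub_hIr_eq_zero hu.monotoneOn, hopt.ironedSurplus_eq hn hp, huts, zero_add,
      sub_zero]
    -- Both interim rules are constant near a type where the hull does not touch, hence so is `D`,
    -- and ironing causes no loss.
    intro t ht hnt
    obtain ⟨l, hl, r, hr, e⟩ := hopt.gap t ht hnt
    exact ⟨l, hl, r, hr, fun y hy => by rw [e y hy 0, e y hy 1]⟩
  rw [hred] at hrev
  refine ⟨ts, hp.type_mem, Q 0, Q 1, u, ⟨hopt.isBorderFeasible hn hd 0, hopt.isBorderFeasible hn hd 1,
    hu0, hu.convexOn, hu.ae_hasDerivAt, fun t ht => ?_⟩, huts,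
    fun p1 p2 h1 h2 => hp.ironedSurplus_le hn ha0 h1 h2, hred, M, hMi, hbic, hir, hex, hrev,
    fun M' h1 h2 => ?_, ⟨α, hα, A, B, hAB, fun j i r hr => ?_⟩,
    fun i r hr => ⟨hden _ (hr i), hpay i r hr⟩⟩
  · rw [hu.integral_eq hb.le hd.zero_mem ht]; ring
  · rw [hrev]; exact hp.revenue_le hn ha0 M' h1 h2
  · rw [hMx, (heq j i r hr).1, (heq j i r hr).2]
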